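/- Let $2\mathcal{C}at$ be the category of small (strict) $2$-categories and strict $2$-functors, and let $t\Delta$ be Verity's category: its objects are $[m]$ for $m\ge 0$ and $[m]_t$ for $m\ge 1$; its morphisms are generated by cofaces $d^i\colon[m]\to[m+1]$, codegeneracies $s^i\colon[m+1]\to[m]$, maps $\varphi\colon[m]\to[m]_t$ and $\zeta^i\colon[m]_t\to[m-1]$ ($m\ge1$, $0\le i\le m-1$), subject to the cosimplicial identities, $\zeta^i\varphi=s^i$, and $s^i\zeta^{j+1}=s^j\zeta^i$ for $i\le j$. Let $\mathcal{O}_2[m]$ be the $2$-truncated $m$-th oriental: the $2$-category with objects $0,\dots,m$ whose category of morphisms $i\to j$ is the poset, under inclusion, of subsets of $\{i,\dots,j\}$ containing $i$ and $j$ (empty if $i>j$), with composition given by union. Let $\mathbb{E}$ be the free adjoint equivalence $(f,g,\eta,\epsilon)$ (an adjunction with invertible unit and counit), and let $\mathbb{O}_2[2]$ be $\mathcal{O}_2[2]$ with its non-identity $2$-morphism $\{0,2\}\Rightarrow\{0,1,2\}$ made invertible. Consider the co-$t\Delta$-object in $2\mathcal{C}at$ given by $[m]\mapsto\mathcal{O}_2[m]$,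 $[1]_t\mapsto\mathbb{E}$, $[2]_t\mapsto\mathbb{O}_2[2]$ and $[m]_t\mapsto\mathcal{O}_2[m]$ for $m\ge3$, with the usual cosimplicial structure on the $\mathcal O_2[m]$ and in which $\varphi$ is the inclusion of $f\colon[1]\to\mathbb{E}$, the inclusion $\mathcal{O}_2[2]\to\mathbb{O}_2[2]$, or the identity. The natural nerve $N^\natural_2\colon 2\mathcal{C}at\to \mathrm{Set}^{t\Delta^{op}}$ sends $\mathcal{C}$ to the presheaf of strict $2$-functors from this object to $\mathcal{C}$. Lack's model structure on $2\mathcal{C}at$ has as weak equivalences the biequivalences (strict $2$-functors that are surjective on objects up to equivalence and induce equivalences of hom-categories), as generating acyclic cofibrations $[0]\hookrightarrow\mathbb{E}$ and $\Sigma[0]\hookrightarrow\Sigma\mathbb{I}$, and as generating cofibrations $[-1]\hookrightarrow[0]$, $[0]\amalg[0]\hookrightarrow[1]$, $\Sigma([0]\amalg[0])\hookrightarrow\Sigma[1]$ and $\Sigma[\rightrightarrows]\to\Sigma[1]$. Here $\Sigma$ is the suspension of a category ($\Sigma\mathcal{A}$ has two objects $x,y$, the category $\mathcal{A}$ of morphisms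 $x\to y$, only identities as endomorphisms, and no morphism $y\to x$), $\mathbb{I}$ is the free isomorphism, $[\rightrightarrows]$ is the free parallel pair of morphisms, and $[-1]$ is empty. **Theorem.** The natural nerve $N^\natural_2$ has a left adjoint. For every left adjoint $c^\natural_2$ of $N^\natural_2$ and every small $2$-category $\mathcal{C}$, the counit $$\epsilon^\natural_{\mathcal{C}}\colon c^\natural_2(N^\natural_2(\mathcal{C}))\to\mathcal{C}$$ is an acyclic fibration in Lack's model structure. That is, it has the right lifting property with respect to the generating acyclic cofibrations and is a biequivalence; moreover, it has the right lifting property with respect to the generating cofibrations. -/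

import Mathlib

open CategoryTheory Bicategory

universe u

/-- A (small, strict) 2-category. -/
structure TwoCat : Type (u + 1) where
  carrier : Type u
  [bicategory : Bicategory.{u, u} carrier]
  [strict : Bicategory.Strict carrier]

namespace TwoCat

instance : CoeSort TwoCat.{u} (Type u) := ⟨carrier⟩

attribute [instance] TwoCat.bicategory TwoCat.strict

/-- A strict 2-functor is determined by its values on objects, 1-morphisms and 2-morphisms. -/
theorem functor_ext {B C : Type u} [Bicategory.{u, u} B] [Bicategory.{u, u} C]
    {F G : StrictPseudofunctor B C} (h : F.toPrelaxFunctor = G.toPrelaxFunctor) : F = G := by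
  rcases F with ⟨⟨⟨F, i, c, _, _, _, _, _⟩, hi, hi'⟩, hc, hc'⟩
  rcases G with ⟨⟨⟨G, j, d, _, _, _, _, _⟩, hj, hj'⟩, hd, hd'⟩
  dsimp at h
  subst h
  have e₁ : i = j := by funext a; exact (hi' a).trans (hj' a).symm
  have e₂ : @c = @d := by funext a b c f g; exact (hc' f g).trans (hd' f g).symm
  subst e₁ e₂
  rfl

/-- The category of 2-categories and strict 2-functors. -/
instance : Category.{u} TwoCat.{u} where
  Hom B C := StrictPseudofunctor B C
  id B := StrictPseudofunctor.id B
  comp F G := StrictPseudofunctor.comp F G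
  id_comp _ := functor_ext rfl
  comp_id _ := functor_ext rfl
  assoc _ _ _ := functor_ext rfl

/-- The underlying strict 2-functor of a morphism of 2-categories. -/
abbrev Hom.functor {B C : TwoCat.{u}} (F : B ⟶ C) : StrictPseudofunctor B C := F

end TwoCat

/-- A compatible preorder on the hom-sets of a category. -/
structure LocalPreorder (J : Type u) [Category.{u} J] where
  le {a b : J} (f g : a ⟶ b) : Prop
  refl {a b : J} (f : a ⟶ b) : le f f
  trans {a b : J} {f g h : a ⟶ b} : le f g → le g h → le f h
  comp {a b c : J} {f f' : a ⟶ b} {g g' : b ⟶ c} : le f f' → le g g' → le (f ≫ g) (f' ≫ g')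

/-- The 2-category with the objects and 1-morphisms of `J`, and with one 2-morphism
`f ⟶ g` if `f ≤ g`, and none otherwise. -/
structure LocallyThin {J : Type u} [Category.{u} J] (P : LocalPreorder J) : Type u where
  as : J

namespace LocallyThin

variable {J : Type u} [Category.{u} J] (P : LocalPreorder J)

instance : CategoryStruct.{u} (LocallyThin P) where
  Hom a b := a.as ⟶ b.as
  id a := 𝟙 a.as
  comp f g := CategoryStruct.comp (obj := J) f g

instance (a b : LocallyThin P) : Category.{u} (a ⟶ b) where
  Hom f g := ULift.{u} (PLift (P.le f g))
  id f := ⟨⟨P.refl f⟩⟩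
  comp η θ := ⟨⟨P.trans η.down.down θ.down.down⟩⟩

variable {P} in
/-- The 2-morphism given by an inequality. -/
def homMk {a b : LocallyThin P} {f g : a ⟶ b} (h : P.le f g) : f ⟶ g := ⟨⟨h⟩⟩

variable {P} in
theorem le_of_hom {a b : LocallyThin P} {f g : a ⟶ b} (η : f ⟶ g) : P.le f g := η.down.down

instance {a b : LocallyThin P} (f g : a ⟶ b) : Subsingleton (f ⟶ g) :=
  inferInstanceAs (Subsingleton (ULift (PLift (P.le f g))))

instance : Bicategory.{u, u} (LocallyThin P) where
  whiskerLeft f _ _ η := homMk (P.comp (P.refl f) (le_of_hom η))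
  whiskerRight η h := homMk (P.comp (le_of_hom η) (P.refl h))
  associator f g h := eqToIso (Category.assoc (obj := J) f g h)
  leftUnitor f := eqToIso (Category.id_comp (obj := J) f)
  rightUnitor f := eqToIso (Category.comp_id (obj := J) f)
  whiskerLeft_id _ _ := Subsingleton.elim _ _
  whiskerLeft_comp _ _ _ _ _ _ := Subsingleton.elim _ _
  id_whiskerLeft _ := Subsingleton.elim _ _
  comp_whiskerLeft _ _ _ _ _ := Subsingleton.elim _ _
  id_whiskerRight _ _ := Subsingleton.elim _ _
  comp_whiskerRight _ _ _ := Subsingleton.elim _ _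
  whiskerRight_id _ := Subsingleton.elim _ _
  whiskerRight_comp _ _ _ := Subsingleton.elim _ _
  whisker_assoc _ _ _ _ _ := Subsingleton.elim _ _
  whisker_exchange _ _ := Subsingleton.elim _ _
  pentagon _ _ _ _ := Subsingleton.elim _ _
  triangle _ _ := Subsingleton.elim _ _

instance : Bicategory.Strict (LocallyThin P) where
  id_comp f := Category.id_comp (obj := J) f
  comp_id f := Category.comp_id (obj := J) f
  assoc f g h := Category.assoc (obj := J) f g h

variable {P}

/-- A strict 2-functor into a locally thin 2-category is determined by its values on objects
and 1-morphisms. -/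
theorem functor_ext {B : Type u} [Bicategory.{u, u} B] {F G : StrictPseudofunctor B (LocallyThin P)}
    (h : F.toPrefunctor = G.toPrefunctor) : F = G := by
  apply TwoCat.functor_ext
  rcases F with ⟨⟨⟨⟨⟨F, m⟩, _, _⟩, _, _, _, _, _, _, _⟩, _, _⟩, _, _⟩
  rcases G with ⟨⟨⟨⟨⟨G, n⟩, _, _⟩, _, _, _, _, _, _, _⟩, _, _⟩, _, _⟩
  dsimp at h
  subst h
  dsimp
  have : @m = @n := by funext a b f g η; exact Subsingleton.elim _ _
  subst this
  rfl

/-- The strict 2-functor given by a functor that is monotone on hom-sets. -/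
def map {K : Type u} [Category.{u} K] {P : LocalPreorder J} {Q : LocalPreorder K} (F : J ⥤ K)
    (hF : ∀ {a b : J} {f g : a ⟶ b}, P.le f g → Q.le (F.map f) (F.map g)) :
    StrictPseudofunctor (LocallyThin P) (LocallyThin Q) :=
  StrictPseudofunctor.mk''
    { obj a := ⟨F.obj a.as⟩
      map f := F.map f
      map₂ η := homMk (hF (le_of_hom η))
      map₂_id _ := Subsingleton.elim _ _
      map₂_comp _ _ := Subsingleton.elim _ _
      map_id a := F.map_id a.as
      map_comp f g := F.map_comp (X := _) f g
      map₂_whisker_left _ _ _ _ := Subsingleton.elim _ _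
      map₂_whisker_right _ _ := Subsingleton.elim _ _ }

end LocallyThin

/-! ### Truncated orientals -/

namespace Oriental

/-- The functor induced by a monotone map `φ` on the categories whose objects are the elements of
a linear order and whose morphisms `i ⟶ j` are the subsets of `[i, j]` that contain `i` and `j`,
composed by union. -/
def pathFunctor {J K : Type u} [LinearOrder J] [LinearOrder K] (φ : J →o K) :
    SimplicialThickening J ⥤ SimplicialThickening K where
  obj i := ⟨φ i.as⟩
  map S :=
    { I := φ '' S.I
      left := ⟨_, S.left, rfl⟩
      right := ⟨_, S.right, rfl⟩
      left_le := by rintro _ ⟨k, hk, rfl⟩; exact φ.monotone (S.left_le k hk)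
      le_right := by rintro _ ⟨k, hk, rfl⟩; exact φ.monotone (S.le_right k hk) }
  map_id _ := SimplicialThickening.Path.ext (Set.image_singleton ..)
  map_comp _ _ := SimplicialThickening.Path.ext (Set.image_union ..)

/-- The inclusion order on the sets of morphisms of `SimplicialThickening J`. -/
def inclusion (J : Type u) [LinearOrder J] : LocalPreorder (SimplicialThickening J) where
  le S T := S.I ⊆ T.I
  refl _ := subset_rfl
  trans := subset_trans
  comp h h' := Set.union_subset_union h h'

/-- The order for which any two parallel morphisms are comparable. -/
def indiscrete (J : Type u) [Category.{u} J] : LocalPreorder J where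
  le _ _ := True
  refl _ := trivial
  trans _ _ := trivial
  comp _ _ := trivial

end Oriental

/-- The cosimplicial 2-category `[m] ↦ 𝒪₂[m]` of 2-truncated orientals. The objects of `𝒪₂[m]` are
`0, …, m`, and its category of morphisms from `i` to `j` is the poset, ordered by inclusion, of
subsets of `{i, …, j}` that contain `i` and `j`. -/
def oriental : SimplexCategory ⥤ TwoCat.{u} where
  obj m := ⟨LocallyThin (Oriental.inclusion (ULift.{u} (Fin (m.len + 1))))⟩
  map φ := LocallyThin.map (Oriental.pathFunctor φ.toOrderHom.uliftMap) (fun h => Set.image_mono h)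
  map_id m := LocallyThin.functor_ext <| by
    refine Prefunctor.ext (fun _ => rfl) fun a b f => ?_
    exact SimplicialThickening.Path.ext (Set.image_id _)
  map_comp φ ψ := LocallyThin.functor_ext <| by
    refine Prefunctor.ext (fun _ => rfl) fun a b f => ?_
    exact SimplicialThickening.Path.ext (Set.image_comp ψ.toOrderHom.uliftMap φ.toOrderHom.uliftMap
      (SimplicialThickening.Path.I f))

/-- The 2-category `𝕆₂[2]` obtained from `𝒪₂[2]` by inverting the top 2-morphism
`{0, 2} ⟶ {0, 1, 2}`. As these are the only two distinct parallel 1-morphisms of `𝒪₂[2]`, it has the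
1-morphisms of `𝒪₂[2]` and exactly one 2-morphism between any two parallel 1-morphisms. -/
def invOriental : TwoCat.{u} :=
  ⟨LocallyThin (Oriental.indiscrete (SimplicialThickening (ULift.{u} (Fin 3))))⟩

/-- The inclusion `𝒪₂[2] ⟶ 𝕆₂[2]`. -/
def orientalToInv : oriental.{u}.obj ⟨2⟩ ⟶ invOriental.{u} :=
  LocallyThin.map (𝟭 _) (fun _ => trivial)

theorem Oriental.path_eq {n : ℕ} (hn : n ≤ 1) {i j : ULift.{u} (Fin (n + 1))}
    (S T : SimplicialThickening.Path i j) : S = T := by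
  have key : ∀ S : SimplicialThickening.Path i j, S.I = {i, j} := by
    intro S
    ext k
    simp only [Set.mem_insert_iff, Set.mem_singleton_iff]
    constructor
    · intro hk
      have h₁ := S.left_le k hk
      have h₂ := S.le_right k hk
      rcases i with ⟨i⟩
      rcases j with ⟨j⟩
      rcases k with ⟨k⟩
      simp only [ULift.up_le, ULift.up_inj] at *
      omega
    · rintro (rfl | rfl)
      exacts [S.left, S.right]
  exact SimplicialThickening.Path.ext ((key S).trans (key T).symm)

/-- The factorization `𝕆₂[2] ⟶ 𝒪₂[1]` of the `i`-th codegeneracy. -/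
def invOrientalσ (i : Fin 2) : invOriental.{u} ⟶ oriental.{u}.obj ⟨1⟩ :=
  LocallyThin.map (Oriental.pathFunctor (SimplexCategory.σ i).toOrderHom.uliftMap)
    (fun _ => (congrArg _ (Oriental.path_eq le_rfl _ _)).subset)

theorem orientalToInv_σ (i : Fin 2) :
    orientalToInv.{u} ≫ invOrientalσ i = oriental.map (SimplexCategory.σ i) :=
  LocallyThin.functor_ext rfl

theorem toPoint_ext {B : TwoCat.{u}} (F G : B ⟶ oriental.{u}.obj ⟨0⟩) : F = G := by
  refine LocallyThin.functor_ext (Prefunctor.ext (fun _ => ?_) fun a b f => ?_)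
  · exact congrArg LocallyThin.mk (congrArg SimplicialThickening.mk (ULift.ext _ _ (Subsingleton.elim (α := Fin 1) _ _)))
  · exact Oriental.path_eq (Nat.zero_le 1) _ _

/-- The 2-functor to the terminal 2-category `𝒪₂[0]`. -/
def toPoint (B : TwoCat.{u}) : B ⟶ oriental.{u}.obj ⟨0⟩ :=
  StrictPseudofunctor.mk'' (C := LocallyThin (Oriental.inclusion (ULift.{u} (Fin 1))))
    { obj _ := ⟨⟨⟨0⟩⟩⟩
      map _ := 𝟙 _
      map₂ _ := 𝟙 _
      map_comp _ _ := (Category.id_comp _).symm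
      map₂_whisker_left _ _ _ _ := Subsingleton.elim _ _
      map₂_whisker_right _ _ := Subsingleton.elim _ _ }

/-- The 2-functor from the terminal 2-category `[0] = 𝒪₂[0]` that picks out an object. -/
def pickObj (B : TwoCat.{u}) (a : B) : oriental.{u}.obj ⟨0⟩ ⟶ B :=
  StrictPseudofunctor.mk''
    { obj _ := a
      map _ := 𝟙 a
      map₂ _ := 𝟙 _
      map_comp _ _ := (Category.id_comp _).symm }

section

theorem pathLE {n : ℕ} {i j : oriental.{u}.obj ⟨n⟩} (S : i ⟶ j) : i.as.as.down ≤ j.as.as.down :=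
  SimplicialThickening.Path.le (J := ULift.{u} (Fin (n + 1))) S

variable (B : TwoCat.{u}) {a b : B} (f : a ⟶ b)

/-- The 2-functor `[1] ⟶ B` that picks out a 1-morphism, on objects. -/
def pickHomObj {B : TwoCat.{u}} (a b : B) : Fin 2 → B
  | 0 => a
  | 1 => b

/-- The 2-functor `[1] ⟶ B` that picks out a 1-morphism, on 1-morphisms. -/
def pickHomMap : ∀ i j : Fin 2, i ≤ j → (pickHomObj a b i ⟶ pickHomObj a b j)
  | 0, 0, _ => 𝟙 a
  | 0, 1, _ => f
  | 1, 1, _ => 𝟙 b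

/-- The 2-functor from `[1] = 𝒪₂[1]` that picks out a 1-morphism. -/
def pickHom : oriental.{u}.obj ⟨1⟩ ⟶ B :=
  StrictPseudofunctor.mk''
    { obj i := pickHomObj a b i.as.as.down
      map {i j} S := pickHomMap B f i.as.as.down j.as.as.down (pathLE S)
      map₂ _ := 𝟙 _
      map_id := by
        rintro ⟨⟨⟨i⟩⟩⟩
        fin_cases i <;> rfl
      map_comp := by
        rintro ⟨⟨⟨i⟩⟩⟩ ⟨⟨⟨j⟩⟩⟩ ⟨⟨⟨k⟩⟩⟩ S T
        have h : i ≤ j := pathLE S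
        have h' : j ≤ k := pathLE T
        fin_cases i <;> fin_cases j <;> fin_cases k <;> first
          | exact absurd h (by decide)
          | exact absurd h' (by decide)
          | exact (Category.id_comp _).symm
          | exact (Category.comp_id _).symm }

end

/-! ### 2-categories presented by generators and relations -/

open Quiver in
/-- Formal composites of generating 2-morphisms `G` between paths in a quiver. -/
inductive PreHom₂ {V : Type u} [Quiver.{u} V]
    (G : ∀ a b : V, Path a b → Path a b → Type u) : ∀ {a b : V}, Path a b → Path a b → Type u
  | of {a b : V} {p q : Path a b} (γ : G a b p q) : PreHom₂ G p q
  | id {a b : V} (p : Path a b) : PreHom₂ G p p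
  | vcomp {a b : V} {p q r : Path a b} (η : PreHom₂ G p q) (θ : PreHom₂ G q r) : PreHom₂ G p r
  | whiskerLeft {a b c : V} (p : Path a b) {q r : Path b c} (η : PreHom₂ G q r) :
      PreHom₂ G (p.comp q) (p.comp r)
  | whiskerRight {a b c : V} {p q : Path a b} (η : PreHom₂ G p q) (r : Path b c) :
      PreHom₂ G (p.comp r) (q.comp r)

open Quiver in
/-- The formal identity 2-morphism between two equal paths. -/
def PreHom₂.ofEq {V : Type u} [Quiver.{u} V]
    {G : ∀ a b : V, Path a b → Path a b → Type u} {a b : V} {p q : Path a b} (h : p = q) :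
    PreHom₂ G p q := h ▸ .id p

open Quiver in
/-- A presentation of a 2-category whose underlying category is the free category on `V`: a family
of generating 2-morphisms and a family of relations between their formal composites. -/
structure TwoPresentation (V : Type u) [Quiver.{u} V] where
  gen (a b : V) : Path a b → Path a b → Type u
  rel {a b : V} {p q : Path a b} : PreHom₂ gen p q → PreHom₂ gen p q → Prop

namespace TwoPresentation

open PreHom₂ Quiver

variable {V : Type u} [Quiver.{u} V] (P : TwoPresentation V)

/-- The congruence on formal composites generated by the relations of `P` and the axioms of
2-categories. -/
inductive Rel : ∀ {a b : V} {p q : Path a b}, PreHom₂ P.gen p q → PreHom₂ P.gen p q → Prop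
  | of_rel {a b : V} {p q : Path a b} {η θ : PreHom₂ P.gen p q} (h : P.rel η θ) : Rel η θ
  | vcomp_right {a b : V} {p q r : Path a b} (η : PreHom₂ P.gen p q) {θ θ' : PreHom₂ P.gen q r}
      (h : Rel θ θ') : Rel (vcomp η θ) (vcomp η θ')
  | vcomp_left {a b : V} {p q r : Path a b} {η η' : PreHom₂ P.gen p q} (h : Rel η η')
      (θ : PreHom₂ P.gen q r) : Rel (vcomp η θ) (vcomp η' θ)
  | id_comp {a b : V} {p q : Path a b} (η : PreHom₂ P.gen p q) : Rel (vcomp (id p) η) η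
  | comp_id {a b : V} {p q : Path a b} (η : PreHom₂ P.gen p q) : Rel (vcomp η (id q)) η
  | assoc {a b : V} {p q r s : Path a b} (η : PreHom₂ P.gen p q) (θ : PreHom₂ P.gen q r)
      (κ : PreHom₂ P.gen r s) : Rel (vcomp (vcomp η θ) κ) (vcomp η (vcomp θ κ))
  | whiskerLeft_congr {a b c : V} (p : Path a b) {q r : Path b c} {η η' : PreHom₂ P.gen q r}
      (h : Rel η η') : Rel (whiskerLeft p η) (whiskerLeft p η')
  | whiskerLeft_id {a b c : V} (p : Path a b) (q : Path b c) :
      Rel (whiskerLeft p (id q)) (id (p.comp q))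
  | whiskerLeft_comp {a b c : V} (p : Path a b) {q r s : Path b c} (η : PreHom₂ P.gen q r)
      (θ : PreHom₂ P.gen r s) :
      Rel (whiskerLeft p (vcomp η θ)) (vcomp (whiskerLeft p η) (whiskerLeft p θ))
  | id_whiskerLeft {a b : V} {p q : Path a b} (η : PreHom₂ P.gen p q) :
      Rel (whiskerLeft .nil η)
        (vcomp (ofEq (Path.nil_comp p)) (vcomp η (ofEq (Path.nil_comp q).symm)))
  | comp_whiskerLeft {a b c d : V} (p : Path a b) (q : Path b c) {r s : Path c d}
      (η : PreHom₂ P.gen r s) :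
      Rel (whiskerLeft (p.comp q) η)
        (vcomp (ofEq (Path.comp_assoc p q r))
          (vcomp (whiskerLeft p (whiskerLeft q η)) (ofEq (Path.comp_assoc p q s).symm)))
  | whiskerRight_congr {a b c : V} {p q : Path a b} {η η' : PreHom₂ P.gen p q}
      (h : Rel η η') (r : Path b c) : Rel (whiskerRight η r) (whiskerRight η' r)
  | id_whiskerRight {a b c : V} (p : Path a b) (q : Path b c) :
      Rel (whiskerRight (id p) q) (id (p.comp q))
  | comp_whiskerRight {a b c : V} {p q r : Path a b} (η : PreHom₂ P.gen p q)
      (θ : PreHom₂ P.gen q r) (s : Path b c) :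
      Rel (whiskerRight (vcomp η θ) s) (vcomp (whiskerRight η s) (whiskerRight θ s))
  | whiskerRight_id {a b : V} {p q : Path a b} (η : PreHom₂ P.gen p q) :
      Rel (whiskerRight η .nil)
        (vcomp (ofEq (Path.comp_nil p)) (vcomp η (ofEq (Path.comp_nil q).symm)))
  | whiskerRight_comp {a b c d : V} {p q : Path a b} (η : PreHom₂ P.gen p q) (r : Path b c)
      (s : Path c d) :
      Rel (whiskerRight η (r.comp s))
        (vcomp (ofEq (Path.comp_assoc p r s).symm)
          (vcomp (whiskerRight (whiskerRight η r) s) (ofEq (Path.comp_assoc q r s))))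
  | whisker_assoc {a b c d : V} (p : Path a b) {q r : Path b c} (η : PreHom₂ P.gen q r)
      (s : Path c d) :
      Rel (whiskerRight (whiskerLeft p η) s)
        (vcomp (ofEq (Path.comp_assoc p q s))
          (vcomp (whiskerLeft p (whiskerRight η s)) (ofEq (Path.comp_assoc p r s).symm)))
  | whisker_exchange {a b c : V} {p q : Path a b} {r s : Path b c} (η : PreHom₂ P.gen p q)
      (θ : PreHom₂ P.gen r s) :
      Rel (vcomp (whiskerLeft p θ) (whiskerRight η s))
        (vcomp (whiskerRight η r) (whiskerLeft q θ))

/-- The objects of the 2-category presented by `P`. -/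
@[nolint unusedArguments]
structure Presented (_ : TwoPresentation V) : Type u where
  as : V

variable {P}

instance : CategoryStruct.{u} P.Presented where
  Hom a b := Path a.as b.as
  id _ := .nil
  comp p q := Path.comp p q

instance (a b : P.Presented) : Category.{u} (a ⟶ b) where
  Hom p q := Quot (@Rel _ _ P a.as b.as p q)
  id p := Quot.mk _ (.id p)
  comp := Quot.map₂ vcomp (fun η _ _ h => .vcomp_right η h) (fun _ _ θ h => .vcomp_left h θ)
  id_comp := by rintro p q ⟨η⟩; exact Quot.sound (.id_comp η)
  comp_id := by rintro p q ⟨η⟩; exact Quot.sound (.comp_id η)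
  assoc := by rintro p q r s ⟨η⟩ ⟨θ⟩ ⟨κ⟩; exact Quot.sound (.assoc η θ κ)

namespace Presented

/-- The 2-morphism represented by a formal composite. -/
def homMk {a b : P.Presented} {p q : a ⟶ b} (η : PreHom₂ P.gen (a := a.as) (b := b.as) p q) :
    p ⟶ q :=
  Quot.mk _ η

theorem homMk_ofEq {a b : P.Presented} {p q : a ⟶ b} (h : p = q) :
    homMk (ofEq h) = eqToHom h := by
  subst h; rfl

/-- Left whiskering. -/
def wl {a b c : P.Presented} (p : a ⟶ b) {q r : b ⟶ c} : (q ⟶ r) → (p ≫ q ⟶ p ≫ r) :=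
  Quot.map (PreHom₂.whiskerLeft p) (fun _ _ h => .whiskerLeft_congr p h)

/-- Right whiskering. -/
def wr {a b c : P.Presented} {p q : a ⟶ b} (η : p ⟶ q) (r : b ⟶ c) : p ≫ r ⟶ q ≫ r :=
  Quot.map (fun η => PreHom₂.whiskerRight η r) (fun _ _ h => .whiskerRight_congr h r) η

theorem wl_eqToHom {a b c : P.Presented} (p : a ⟶ b) {q r : b ⟶ c} (h : q = r) :
    wl p (eqToHom h) = eqToHom (congrArg (p ≫ ·) h) := by
  subst h; exact Quot.sound (.whiskerLeft_id p q)

theorem wr_eqToHom {a b c : P.Presented} {p q : a ⟶ b} (h : p = q) (r : b ⟶ c) :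
    wr (eqToHom h) r = eqToHom (congrArg (· ≫ r) h) := by
  subst h; exact Quot.sound (.id_whiskerRight p r)

instance : Bicategory.{u, u} P.Presented where
  whiskerLeft p _ _ η := wl p η
  whiskerRight η r := wr η r
  associator p q r := eqToIso (Path.comp_assoc p q r)
  leftUnitor p := eqToIso (Path.nil_comp p)
  rightUnitor p := eqToIso (Path.comp_nil p)
  whiskerLeft_id p q := wl_eqToHom p (rfl : q = q)
  whiskerLeft_comp := by rintro a b c p q r s ⟨η⟩ ⟨θ⟩; exact Quot.sound (.whiskerLeft_comp p η θ)
  id_whiskerLeft := by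
    rintro a b p q ⟨η⟩
    refine (Quot.sound (.id_whiskerLeft η)).trans ?_
    rw [eqToIso.hom, eqToIso.inv, ← homMk_ofEq, ← homMk_ofEq]; rfl
  comp_whiskerLeft := by
    rintro a b c d p q r s ⟨η⟩
    refine (Quot.sound (.comp_whiskerLeft p q η)).trans ?_
    rw [eqToIso.hom, eqToIso.inv, ← homMk_ofEq, ← homMk_ofEq]; rfl
  id_whiskerRight p q := wr_eqToHom (rfl : p = p) q
  comp_whiskerRight := by
    rintro a b c p q r ⟨η⟩ ⟨θ⟩ s; exact Quot.sound (.comp_whiskerRight η θ s)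
  whiskerRight_id := by
    rintro a b p q ⟨η⟩
    refine (Quot.sound (.whiskerRight_id η)).trans ?_
    rw [eqToIso.hom, eqToIso.inv, ← homMk_ofEq, ← homMk_ofEq]; rfl
  whiskerRight_comp := by
    rintro a b c d p q ⟨η⟩ r s
    refine (Quot.sound (.whiskerRight_comp η r s)).trans ?_
    rw [eqToIso.hom, eqToIso.inv, ← homMk_ofEq, ← homMk_ofEq]; rfl
  whisker_assoc := by
    rintro a b c d p q r ⟨η⟩ s
    refine (Quot.sound (.whisker_assoc p η s)).trans ?_
    rw [eqToIso.hom, eqToIso.inv, ← homMk_ofEq, ← homMk_ofEq]; rfl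
  whisker_exchange := by
    rintro a b c p q r s ⟨η⟩ ⟨θ⟩; exact Quot.sound (.whisker_exchange η θ)
  pentagon p q r s := by
    simp only [eqToIso.hom, wl_eqToHom, wr_eqToHom, eqToHom_trans]
  triangle p q := by
    simp only [eqToIso.hom, wl_eqToHom, wr_eqToHom, eqToHom_trans]

end Presented

instance : Bicategory.Strict P.Presented where
  id_comp p := Path.nil_comp p
  comp_id p := Path.comp_nil p
  assoc p q r := Path.comp_assoc p q r

end TwoPresentation

/-! ### The free adjoint equivalence -/

namespace FreeAdjEquiv

/-- The two objects of the free adjoint equivalence. -/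
inductive Obj : Type u
  | x
  | y

/-- The generating 1-morphisms of the free adjoint equivalence. -/
inductive Gen₁ : Obj.{u} → Obj.{u} → Type u
  | f : Gen₁ .x .y
  | g : Gen₁ .y .x

instance : Quiver.{u} Obj.{u} := ⟨Gen₁⟩

open Quiver

/-- The left adjoint `f`. -/
abbrev f : Path Obj.x.{u} Obj.y := Hom.toPath (V := Obj.{u}) Gen₁.f

/-- The right adjoint `g`. -/
abbrev g : Path Obj.y.{u} Obj.x := Hom.toPath (V := Obj.{u}) Gen₁.g

/-- The generating 2-morphisms: a unit, a counit and their inverses. -/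
inductive Gen₂ : ∀ a b : Obj.{u}, Path a b → Path a b → Type u
  | η : Gen₂ _ _ .nil (f.comp g)
  | ηInv : Gen₂ _ _ (f.comp g) .nil
  | ε : Gen₂ _ _ (g.comp f) .nil
  | εInv : Gen₂ _ _ .nil (g.comp f)

open PreHom₂ in
/-- The relations: `ηInv` and `εInv` are inverse to `η` and `ε`, and the triangle identities
`(ε * f) ∘ (f * η) = id_f` and `(g * ε) ∘ (η * g) = id_g`. -/
inductive Rel₂ : ∀ {a b : Obj.{u}} {p q : Path a b}, PreHom₂ Gen₂ p q → PreHom₂ Gen₂ p q → Prop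
  | η_ηInv : Rel₂ (vcomp (of .η) (of .ηInv)) (.id _)
  | ηInv_η : Rel₂ (vcomp (of .ηInv) (of .η)) (.id _)
  | ε_εInv : Rel₂ (vcomp (of .ε) (of .εInv)) (.id _)
  | εInv_ε : Rel₂ (vcomp (of .εInv) (of .ε)) (.id _)
  | left_triangle :
      Rel₂ (vcomp (whiskerRight (of .η) f) (vcomp (ofEq (Path.comp_assoc f g f))
        (whiskerLeft f (of .ε)))) (ofEq (Path.nil_comp f))
  | right_triangle :
      Rel₂ (vcomp (whiskerLeft g (of .η)) (vcomp (ofEq (Path.comp_assoc g f g).symm)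
        (whiskerRight (of .ε) g))) (ofEq (Path.nil_comp g).symm)

end FreeAdjEquiv

/-- The free adjoint equivalence `𝔼`, presented by `f`, `g`, an invertible unit `η : id ⟶ gf` and an
invertible counit `ε : fg ⟶ id` subject to the triangle identities. In Mathlib's order of
composition `gf` is `f ≫ g`. -/
def freeAdjEquiv : TwoCat.{u} :=
  ⟨TwoPresentation.Presented (V := FreeAdjEquiv.Obj.{u}) ⟨FreeAdjEquiv.Gen₂, FreeAdjEquiv.Rel₂⟩⟩

namespace FreeAdjEquiv

/-- The source of `f`, as an object of `𝔼`. -/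
def objX : freeAdjEquiv.{u} := ⟨.x⟩

/-- The target of `f`, as an object of `𝔼`. -/
def objY : freeAdjEquiv.{u} := ⟨.y⟩

/-- The 1-morphism `f` of `𝔼`. -/
def homF : objX.{u} ⟶ objY := f

end FreeAdjEquiv

/-! ### The category `tΔ` and the co-`tΔ`-object in 2-categories -/

/-- The objects of `tΔ`: `simplex m` is `[m]`, and `marked m` is `[m + 1]ₜ`. -/
inductive MarkedSimplex : Type
  | simplex (m : ℕ)
  | marked (m : ℕ)

namespace MarkedSimplex

/-- The generating morphisms of `tΔ`. -/
inductive Gen : MarkedSimplex → MarkedSimplex → Type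
  /-- cofaces `[m] ⟶ [m + 1]` -/
  | δ {m : ℕ} (i : Fin (m + 2)) : Gen (simplex m) (simplex (m + 1))
  /-- codegeneracies `[m + 1] ⟶ [m]` -/
  | σ {m : ℕ} (i : Fin (m + 1)) : Gen (simplex (m + 1)) (simplex m)
  /-- counmarking maps `[m + 1] ⟶ [m + 1]ₜ` -/
  | φ (m : ℕ) : Gen (simplex (m + 1)) (marked m)
  /-- comarking maps `[m + 1]ₜ ⟶ [m]` -/
  | ζ {m : ℕ} (i : Fin (m + 1)) : Gen (marked m) (simplex m)

instance : Quiver MarkedSimplex := ⟨Gen⟩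

/-- A generator, as a morphism of the free category on the generators. -/
abbrev of {a b : MarkedSimplex} (f : Gen a b) :
    (Paths.of MarkedSimplex).obj a ⟶ (Paths.of MarkedSimplex).obj b :=
  (Paths.of MarkedSimplex).map f

/-- The defining relations of `tΔ`: the cosimplicial identities, `ζⁱ φ = sⁱ`, and
`sⁱ ζʲ⁺¹ = sʲ ζⁱ` for `i ≤ j`. -/
inductive Rel : HomRel (Paths MarkedSimplex)
  | δ_comp_δ {m : ℕ} {i j : Fin (m + 2)} (h : i ≤ j) :
      Rel (of (.δ i) ≫ of (.δ j.succ)) (of (.δ j) ≫ of (.δ i.castSucc))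
  | δ_comp_σ_of_le {m : ℕ} {i : Fin (m + 2)} {j : Fin (m + 1)} (h : i ≤ j.castSucc) :
      Rel (of (.δ i.castSucc) ≫ of (.σ j.succ)) (of (.σ j) ≫ of (.δ i))
  | δ_comp_σ_self {m : ℕ} (i : Fin (m + 1)) : Rel (of (.δ i.castSucc) ≫ of (.σ i)) (𝟙 _)
  | δ_comp_σ_succ {m : ℕ} (i : Fin (m + 1)) : Rel (of (.δ i.succ) ≫ of (.σ i)) (𝟙 _)
  | δ_comp_σ_of_gt {m : ℕ} {i : Fin (m + 2)} {j : Fin (m + 1)} (h : j.castSucc < i) :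
      Rel (of (.δ i.succ) ≫ of (.σ j.castSucc)) (of (.σ j) ≫ of (.δ i))
  | σ_comp_σ {m : ℕ} {i j : Fin (m + 1)} (h : i ≤ j) :
      Rel (of (.σ i.castSucc) ≫ of (.σ j)) (of (.σ j.succ) ≫ of (.σ i))
  | φ_comp_ζ {m : ℕ} (i : Fin (m + 1)) : Rel (of (.φ m) ≫ of (.ζ i)) (of (.σ i))
  | ζ_comp_σ {m : ℕ} {i j : Fin (m + 1)} (h : i ≤ j) :
      Rel (of (.ζ j.succ) ≫ of (.σ i)) (of (.ζ i.castSucc) ≫ of (.σ j))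

end MarkedSimplex

/-- Verity's category `tΔ`. -/
abbrev tDelta : Type := CategoryTheory.Quotient MarkedSimplex.Rel

namespace NaturalNerve

open MarkedSimplex

/-- The 2-category assigned to `[m]`, respectively to `[m + 1]ₜ`. -/
def obj : MarkedSimplex → TwoCat.{u}
  | simplex m => oriental.obj ⟨m⟩
  | marked 0 => freeAdjEquiv
  | marked 1 => invOriental
  | marked (m + 2) => oriental.obj ⟨m + 3⟩

/-- The inclusions `[1] ⟶ 𝔼` (which picks out `f`), `𝒪₂[2] ⟶ 𝕆₂[2]`, and the identity of `𝒪₂[m]` for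
`m ≥ 3`. -/
def φ : ∀ m : ℕ, obj.{u} (simplex (m + 1)) ⟶ obj (marked m)
  | 0 => pickHom freeAdjEquiv FreeAdjEquiv.homF
  | 1 => orientalToInv
  | _ + 2 => 𝟙 _

/-- The factorizations of the codegeneracies through the 2-categories assigned to `[m + 1]ₜ`. -/
def ζ : ∀ (m : ℕ) (_ : Fin (m + 1)), obj.{u} (marked m) ⟶ obj (simplex m)
  | 0, _ => toPoint _
  | 1, i => invOrientalσ i
  | _ + 2, i => oriental.map (SimplexCategory.σ i)

/-- The value of the co-`tΔ`-object on generators. -/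
def genMap : ∀ {a b : MarkedSimplex}, Gen a b → (obj.{u} a ⟶ obj b)
  | _, _, .δ i => oriental.map (SimplexCategory.δ i)
  | _, _, .σ i => oriental.map (SimplexCategory.σ i)
  | _, _, .φ m => φ m
  | _, _, .ζ i => ζ _ i

/-- The co-`tΔ`-object on the free category on the generators of `tΔ`. -/
def pathMap : Paths MarkedSimplex ⥤ TwoCat.{u} := Paths.lift { obj := obj, map := genMap }

theorem pathMap_of {a b : MarkedSimplex} (f : Gen a b) :
    pathMap.{u}.map (MarkedSimplex.of f) = genMap f :=
  Category.id_comp _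

theorem pathMap_of_comp {a b c : MarkedSimplex} (f : Gen a b) (g : Gen b c) :
    pathMap.{u}.map (MarkedSimplex.of f ≫ MarkedSimplex.of g) = genMap f ≫ genMap g := by
  rw [pathMap.map_comp, pathMap_of, pathMap_of]; rfl

theorem oriental_comp {a b c d : SimplexCategory} {f : a ⟶ b} {g : b ⟶ c} {f' : a ⟶ d}
    {g' : d ⟶ c} (h : f ≫ g = f' ≫ g') :
    oriental.{u}.map f ≫ oriental.map g = oriental.map f' ≫ oriental.map g' := by
  rw [← Functor.map_comp, h, Functor.map_comp]

theorem pathMap_rel {a b : Paths MarkedSimplex} {f g : a ⟶ b} (h : Rel f g) :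
    pathMap.{u}.map f = pathMap.map g := by
  induction h with
  | δ_comp_δ h =>
    rw [pathMap_of_comp, pathMap_of_comp]
    exact oriental_comp (SimplexCategory.δ_comp_δ h)
  | δ_comp_σ_of_le h =>
    rw [pathMap_of_comp, pathMap_of_comp]
    exact oriental_comp (SimplexCategory.δ_comp_σ_of_le h)
  | δ_comp_σ_self i =>
    rw [pathMap_of_comp, pathMap.map_id]
    exact ((oriental.map_comp _ _).symm.trans
      (congrArg oriental.map (SimplexCategory.δ_comp_σ_self (i := i)))).trans (oriental.map_id _)
  | δ_comp_σ_succ i =>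
    rw [pathMap_of_comp, pathMap.map_id]
    exact ((oriental.map_comp _ _).symm.trans
      (congrArg oriental.map (SimplexCategory.δ_comp_σ_succ (i := i)))).trans (oriental.map_id _)
  | δ_comp_σ_of_gt h =>
    rw [pathMap_of_comp, pathMap_of_comp]
    exact oriental_comp (SimplexCategory.δ_comp_σ_of_gt h)
  | σ_comp_σ h =>
    rw [pathMap_of_comp, pathMap_of_comp]
    exact oriental_comp (SimplexCategory.σ_comp_σ h)
  | @φ_comp_ζ m i =>
    rw [pathMap_of_comp, pathMap_of]
    match m, i with
    | 0, _ => exact toPoint_ext _ _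
    | 1, i => exact orientalToInv_σ i
    | _ + 2, _ => exact Category.id_comp _
  | @ζ_comp_σ m i j h =>
    rw [pathMap_of_comp, pathMap_of_comp]
    match m, i, j, h with
    | 0, _, _, _ => exact toPoint_ext _ _
    | _ + 1, _, _, h => exact oriental_comp (SimplexCategory.σ_comp_σ h).symm

/-- The co-`tΔ`-object in 2-categories that defines the natural nerve. -/
def coNatural : tDelta ⥤ TwoCat.{u} :=
  CategoryTheory.Quotient.lift _ pathMap fun _ _ _ _ h => pathMap_rel h

end NaturalNerve

/-- The natural nerve `N♮₂`, that sends a 2-category `C` to the presheaf of strict 2-functors from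
the co-`tΔ`-object to `C`. -/
def naturalNerve : TwoCat.{u} ⥤ (tDeltaᵒᵖ ⥤ Type u) :=
  yoneda ⋙ (Functor.whiskeringLeft _ _ _).obj NaturalNerve.coNatural.op

/-! ### Suspensions -/

/-- The objects of the suspension `ΣC` of a category `C`. -/
inductive Suspension (C : Type u) : Type u
  | x
  | y

namespace Suspension

variable {C : Type u}

/-- The 1-morphisms of `ΣC`: the identities, and the objects of `C` as 1-morphisms `x ⟶ y`. -/
inductive Mor : Suspension C → Suspension C → Type u
  | id (a : Suspension C) : Mor a a
  | of (c : C) : Mor x y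

instance : CategoryStruct.{u} (Suspension C) where
  Hom a b := Mor a b
  id a := .id a
  comp
    | .id _, g => g
    | .of c, .id _ => .of c

theorem comp_id' : ∀ {a b : Suspension C} (f : a ⟶ b), f ≫ 𝟙 b = f
  | _, _, .id _ => rfl
  | _, _, .of _ => rfl

theorem assoc' : ∀ {a b c d : Suspension C} (f : a ⟶ b) (g : b ⟶ c) (h : c ⟶ d),
    (f ≫ g) ≫ h = f ≫ g ≫ h
  | _, _, _, _, .id _, _, _ => rfl
  | _, _, _, _, .of _, .id _, .id _ => rfl

variable [Category.{u} C]

/-- The 2-morphisms of `ΣC`: the identities of identities, and the morphisms of `C`. -/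
inductive Mor₂ : ∀ {a b : Suspension C}, Mor a b → Mor a b → Type u
  | id (a : Suspension C) : Mor₂ (.id a) (.id a)
  | of {c d : C} (f : c ⟶ d) : Mor₂ (.of c) (.of d)

instance (a b : Suspension C) : Category.{u} (a ⟶ b) where
  Hom f g := Mor₂ f g
  id
    | .id a => .id a
    | .of c => .of (𝟙 c)
  comp
    | .id a, .id _ => .id a
    | .of f, .of g => .of (f ≫ g)
  id_comp := by rintro _ _ (_ | f) <;> simp
  comp_id := by rintro _ _ (_ | f) <;> simp
  assoc := by rintro _ _ _ _ (_ | f) (_ | g) (_ | h) <;> simp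

/-- Left whiskering. -/
def wl : ∀ {a b c : Suspension C} (f : a ⟶ b) {g h : b ⟶ c}, (g ⟶ h) → (f ≫ g ⟶ f ≫ h)
  | _, _, _, .id _, _, _, η => η
  | _, _, _, .of c, _, _, .id _ => Mor₂.of (𝟙 c)

/-- Right whiskering. -/
def wr : ∀ {a b c : Suspension C} {f g : a ⟶ b}, (f ⟶ g) → ∀ h : b ⟶ c, f ≫ h ⟶ g ≫ h
  | _, _, _, _, _, .id _, .id a => Mor₂.id a
  | _, _, _, _, _, .id _, .of c => Mor₂.of (𝟙 c)
  | _, _, _, _, _, .of f, .id _ => Mor₂.of f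

theorem wl_id {a b c : Suspension C} (f : a ⟶ b) (g : b ⟶ c) : wl f (𝟙 g) = 𝟙 (f ≫ g) := by
  rcases f with _ | _ <;> rcases g with _ | _ <;> rfl

theorem wr_id {a b c : Suspension C} (f : a ⟶ b) (g : b ⟶ c) : wr (𝟙 f) g = 𝟙 (f ≫ g) := by
  rcases f with _ | _ <;> rcases g with _ | _ <;> rfl

theorem wl_eqToHom {a b c : Suspension C} (f : a ⟶ b) {g h : b ⟶ c} (e : g = h) :
    wl f (eqToHom e) = eqToHom (congrArg (f ≫ ·) e) := by
  subst e; exact wl_id f g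

theorem wr_eqToHom {a b c : Suspension C} {f g : a ⟶ b} (e : f = g) (h : b ⟶ c) :
    wr (eqToHom e) h = eqToHom (congrArg (· ≫ h) e) := by
  subst e; exact wr_id f h

instance : Bicategory.{u, u} (Suspension C) where
  whiskerLeft f _ _ η := wl f η
  whiskerRight η h := wr η h
  associator f g h := eqToIso (assoc' f g h)
  leftUnitor f := eqToIso (rfl : 𝟙 _ ≫ f = f)
  rightUnitor f := eqToIso (comp_id' f)
  whiskerLeft_id := wl_id
  whiskerLeft_comp f _ _ _ η θ := by
    rcases f with _ | _
    · rfl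
    · rcases η with _ | _; rcases θ with _ | _; exact congrArg Mor₂.of (Category.id_comp _).symm
  id_whiskerLeft η := by
    rcases η with _ | η
    · rfl
    · exact congrArg Mor₂.of (by simp : η = 𝟙 _ ≫ η ≫ 𝟙 _)
  comp_whiskerLeft f g _ _ η := by
    rcases f with _ | c
    · exact ((Category.id_comp _).trans (Category.comp_id _)).symm
    · rcases g with _ | _; rcases η with _ | _
      exact congrArg Mor₂.of (by simp : 𝟙 c = 𝟙 c ≫ 𝟙 c ≫ 𝟙 c)
  id_whiskerRight := wr_id
  comp_whiskerRight η θ h := by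
    rcases η with _ | _ <;> rcases θ with _ | _ <;> rcases h with _ | c
    · rfl
    · exact congrArg Mor₂.of (by simp : 𝟙 c = 𝟙 c ≫ 𝟙 c)
    · rfl
  whiskerRight_id η := by
    rcases η with _ | η
    · rfl
    · exact congrArg Mor₂.of (by simp : η = 𝟙 _ ≫ η ≫ 𝟙 _)
  whiskerRight_comp η f g := by
    rcases η with _ | η <;> rcases f with _ | c <;> rcases g with _ | d
    · rfl
    · exact congrArg Mor₂.of (by simp : 𝟙 d = 𝟙 d ≫ 𝟙 d ≫ 𝟙 d)
    · exact congrArg Mor₂.of (by simp : 𝟙 c = 𝟙 c ≫ 𝟙 c ≫ 𝟙 c)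
    · exact congrArg Mor₂.of (by simp : η = 𝟙 _ ≫ η ≫ 𝟙 _)
  whisker_assoc f _ _ η g := by
    rcases f with _ | c
    · exact ((Category.id_comp _).trans (Category.comp_id _)).symm
    · rcases η with _ | _; rcases g with _ | _
      exact congrArg Mor₂.of (by simp : 𝟙 c = 𝟙 c ≫ 𝟙 c ≫ 𝟙 c)
  whisker_exchange η θ := by
    rcases η with _ | η
    · rcases θ with _ | θ
      · rfl
      · exact congrArg Mor₂.of (by simp : θ ≫ 𝟙 _ = 𝟙 _ ≫ θ)
    · rcases θ with _ | _
      exact congrArg Mor₂.of (by simp : 𝟙 _ ≫ η = η ≫ 𝟙 _)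
  pentagon f g h i := by simp only [eqToIso.hom, wl_eqToHom, wr_eqToHom, eqToHom_trans]
  triangle f g := by simp only [eqToIso.hom, wl_eqToHom, wr_eqToHom, eqToHom_trans]

instance : Bicategory.Strict (Suspension C) where
  id_comp _ := rfl
  comp_id := comp_id'
  assoc := assoc'

section

variable {D : Type u} [Category.{u} D] (F : C ⥤ D)

/-- The action of `ΣF` on objects. -/
def mapObj : Suspension C → Suspension D
  | x => x
  | y => y

/-- The action of `ΣF` on 1-morphisms. -/
def mapMor : ∀ {a b : Suspension C}, (a ⟶ b) → ((mapObj a : Suspension D) ⟶ mapObj b)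
  | _, _, .id a => .id (mapObj a)
  | _, _, .of c => .of (F.obj c)

/-- The action of `ΣF` on 2-morphisms. -/
def mapMor₂ : ∀ {a b : Suspension C} {f g : a ⟶ b}, (f ⟶ g) → (mapMor F f ⟶ mapMor F g)
  | _, _, _, _, .id a => .id (mapObj a)
  | _, _, _, _, .of f => .of (F.map f)

theorem mapMor_comp {a b c : Suspension C} (f : a ⟶ b) (g : b ⟶ c) :
    mapMor F (f ≫ g) = mapMor F f ≫ mapMor F g := by
  rcases f with _ | _ <;> rcases g with _ | _ <;> rfl

/-- The strict 2-functor `ΣF : ΣC ⟶ ΣD` induced by a functor `F : C ⥤ D`. -/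
def map : StrictPseudofunctor (Suspension C) (Suspension D) :=
  StrictPseudofunctor.mk''
    { obj := mapObj
      map := mapMor F
      map₂ := mapMor₂ F
      map₂_id f := by
        rcases f with _ | c
        · rfl
        · exact congrArg Mor₂.of (F.map_id c)
      map₂_comp η θ := by
        rcases η with _ | η <;> rcases θ with _ | θ
        · rfl
        · exact congrArg Mor₂.of (F.map_comp η θ)
      map_id _ := rfl
      map_comp := mapMor_comp F
      map₂_whisker_left f _ _ η := by
        rcases f with _ | c <;> rcases η with _ | η
        · rfl
        · exact congrArg Mor₂.of (by simp : F.map η = 𝟙 _ ≫ F.map η ≫ 𝟙 _)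
        · exact congrArg Mor₂.of (by simp : F.map (𝟙 c) = 𝟙 _ ≫ 𝟙 _ ≫ 𝟙 _)
      map₂_whisker_right η f := by
        rcases η with _ | η <;> rcases f with _ | c
        · rfl
        · exact congrArg Mor₂.of (by simp : F.map (𝟙 c) = 𝟙 _ ≫ 𝟙 _ ≫ 𝟙 _)
        · exact congrArg Mor₂.of (by simp : F.map η = 𝟙 _ ≫ F.map η ≫ 𝟙 _) }

end

end Suspension

/-- The strict 2-functor `ΣF : ΣC ⟶ ΣD`, as a morphism of 2-categories. -/
def suspend {C D : Type u} [Category.{u} C] [Category.{u} D] (F : C ⥤ D) :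
    TwoCat.mk (Suspension C) ⟶ TwoCat.mk (Suspension D) :=
  Suspension.map F

/-! ### Lack's model structure -/

/-- The empty 2-category `[-1]`. -/
def emptyTwoCat : TwoCat.{u} := ⟨LocallyDiscrete (Discrete PEmpty.{u + 1})⟩

/-- The 2-functor from the empty 2-category. -/
def fromEmpty (B : TwoCat.{u}) : emptyTwoCat.{u} ⟶ B :=
  StrictPseudofunctor.mk'' (B := LocallyDiscrete (Discrete PEmpty.{u + 1}))
    { obj a := a.as.as.elim
      map {a} := a.as.as.elim
      map₂ {a} := a.as.as.elim
      map₂_id {a} := a.as.as.elim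
      map₂_comp {a} := a.as.as.elim
      map_id a := a.as.as.elim
      map_comp {a} := a.as.as.elim
      map₂_whisker_left {a} := a.as.as.elim
      map₂_whisker_right {a} := a.as.as.elim }

/-- The two objects of the free isomorphism `𝕀`. -/
inductive FreeIso : Type u
  | x
  | y

/-- The free isomorphism `𝕀`: there is exactly one morphism between any two objects. -/
instance : Category.{u} FreeIso.{u} where
  Hom _ _ := PUnit
  id _ := ⟨⟩
  comp _ _ := ⟨⟩

/-- The poset `[1]`, regarded as a category. -/
abbrev Arrow01 : Type u := ULift.{u} (Fin 2)

/-- The two objects of `[⇉]`. -/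
inductive FreeParallel : Type u
  | x
  | y

/-- The morphisms of `[⇉]`: the identities and two parallel morphisms `x ⟶ y`. -/
inductive FreeParallel.Mor : FreeParallel.{u} → FreeParallel.{u} → Type u
  | id (a : FreeParallel) : Mor a a
  | left : Mor x y
  | right : Mor x y

/-- The category `[⇉]` freely generated by a pair of parallel morphisms. -/
instance : Category.{u} FreeParallel.{u} where
  Hom := FreeParallel.Mor
  id a := .id a
  comp
    | .id _, g => g
    | .left, .id _ => .left
    | .right, .id _ => .right
  id_comp _ := rfl
  comp_id := by rintro _ _ (_ | _ | _) <;> rfl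
  assoc := by rintro _ _ _ _ (_ | _ | _) (_ | _ | _) (_ | _ | _) <;> rfl

/-- The functor `[⇉] ⥤ [1]` on objects. -/
def parallelToArrowObj : FreeParallel.{u} → Arrow01.{u}
  | .x => ⟨0⟩
  | .y => ⟨1⟩

/-- The functor `[⇉] ⥤ [1]` that identifies the two parallel morphisms. -/
def parallelToArrow : FreeParallel.{u} ⥤ Arrow01.{u} where
  obj := parallelToArrowObj
  map f := homOfLE <| by rcases f with _ | _ | _ <;> simp [parallelToArrowObj]

/-- The generating cofibrations of Lack's model structure: `[-1] ⟶ [0]`, `[0] ⨿ [0] ⟶ [1]`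
(that is, `Σ∅ ⟶ Σ[0]`), `Σ([0] ⨿ [0]) ⟶ Σ[1]` and `Σ[⇉] ⟶ Σ[1]`. -/
inductive lackGeneratingCofibrations : MorphismProperty TwoCat.{u}
  | empty_point : lackGeneratingCofibrations (fromEmpty (oriental.obj ⟨0⟩))
  | objects_arrow : lackGeneratingCofibrations
      (suspend (Functor.empty.{u} (Discrete PUnit.{u + 1})))
  | arrows_cell : lackGeneratingCofibrations
      (suspend (Discrete.functor (fun i : ULift.{u} (Fin 2) => (i : Arrow01.{u}))))
  | parallel_cell : lackGeneratingCofibrations (suspend parallelToArrow.{u})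

/-- The generating acyclic cofibrations of Lack's model structure: `[0] ⟶ 𝔼` and
`[1] = Σ[0] ⟶ Σ𝕀`. -/
inductive lackGeneratingAcyclicCofibrations : MorphismProperty TwoCat.{u}
  | point_adjEquiv : lackGeneratingAcyclicCofibrations (pickObj freeAdjEquiv FreeAdjEquiv.objX)
  | arrow_iso : lackGeneratingAcyclicCofibrations
      (suspend (Discrete.functor (fun _ : PUnit.{u + 1} => FreeIso.x.{u})))

/-- The biequivalences: strict 2-functors that are surjective on objects up to equivalence and
induce equivalences of hom-categories. -/
def biequivalences : MorphismProperty TwoCat.{u} := fun B C F =>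
  (∀ c : C, ∃ b : B, Nonempty (Bicategory.Equivalence ((TwoCat.Hom.functor F).obj b) c)) ∧
    ∀ a b : B, ((TwoCat.Hom.functor F).mapFunctor a b).IsEquivalence

/-- The fibrations of Lack's model structure. -/
def lackFibrations : MorphismProperty TwoCat.{u} := lackGeneratingAcyclicCofibrations.rlp

/-- The acyclic fibrations of Lack's model structure: the fibrations that are weak equivalences. -/
def lackAcyclicFibrations : MorphismProperty TwoCat.{u} := lackFibrations ⊓ biequivalences

/-!
The nerve of any diagram `F : T ⥤ TwoCat` has a left adjoint. It sends a presheaf `X` to the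
2-category generated by the cells of the 2-categories `F k`, one copy for each element of `X k`,
inside the product of all 2-categories `C` equipped with a map `X ⟶ nerve C`. To form sub-objects
and products without reference to boundaries, 2-categories are encoded by the set of all their cells
(`SingleSorted`, `CellCat`); see `TwoCat.nerve_isRightAdjoint`.

Let `N` be the natural nerve, `c ⊣ N`, `A = c (N C)`, and let `ε : A ⟶ C` be the counit. Any map
`u : N C ⟶ N B` determines a pseudofunctor `J : C ⥤ᵖ B` (`NaturalNerve.toPseudofunctor`): the
2-simplices of `N C` are the triangles `h ⟶ f ≫ g`, the 3-simplices express that the action of `u`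
on triangles is compatible with pasting, and the marked 2-simplices make the comparison
2-morphisms `J (f ≫ g) ⟶ J f ≫ J g` invertible. Moreover, `u` factors as

  `N C ⟶ N (Strictification J) ⟶ N B`.

Here `Strictification J` is the 2-category whose objects and 2-morphisms are those of `C`, and whose
1-morphisms are pairs of a 1-morphism `f` of `C` and a 1-morphism of `B` with an isomorphism to
`J f`. It has strict projections to `C` and to `B`, and the map `N C ⟶ N (Strictification J)`
(`NaturalNerve.nerveLift`) is a section of the projection to `N C`. It exists because a 2-functor
on `𝒪₂[m]` can be lifted freely on edges (`Oriental.exists_functor`), and because right adjoints are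
unique up to a unique isomorphism, which gives a unique lift on the marked 1-simplices
(`Strictification.exists_adjEquiv`, `Strictification.adjEquiv_ext`).

For the unit `u : N C ⟶ N A` the lift transposes to a 2-functor `s : A ⟶ Strictification J` over `C`
with `s ≫ proj₂ = 𝟙 A`, by the uniqueness in the universal property of `A`
(`NaturalNerve.exists_section`). Thus `A` is a retract of `Strictification J`, in which 1-morphisms
lift along, and 2-morphisms correspond bijectively under, the projection to `C`. Together with
`u ≫ N ε = 𝟙` this shows that `ε` is surjective on objects, full on 1-morphisms and fully faithful
on 2-morphisms, in the strict sense (`NaturalNerve.isTrivial_of_section`). Lifts against suspensions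
are then constructed by hand, and an adjoint equivalence in `C` lifts to its image under the unit.
-/

universe w v w₁ v₁ u₁ w₂ v₂ u₂

/-! ### Cells of a 2-category -/

/-- The type of all 2-morphisms of a bicategory, regardless of their boundary. Equality of cells
expresses an equality of 2-morphisms whose boundaries are only propositionally equal. -/
structure Cell (B : Type u) [Bicategory.{w, v} B] : Type (max u v w) where
  {src : B}
  {tgt : B}
  {dom : src ⟶ tgt}
  {cod : src ⟶ tgt}
  hom : dom ⟶ cod

namespace Cell

variable {B : Type u} [Bicategory.{w, v} B]

theorem mk_inj {a b : B} {f g : a ⟶ b} {η θ : f ⟶ g} (h : mk η = mk θ) : η = θ := by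
  injection h

/-- The cell of an identity 2-morphism; it records a 1-morphism regardless of its endpoints. -/
abbrev one {a b : B} (f : a ⟶ b) : Cell B := mk (𝟙 f)

/-- The cell of the identity 2-morphism of an identity; it records an object. -/
abbrev zero (a : B) : Cell B := one (𝟙 a)

theorem one_inj {a b : B} {f g : a ⟶ b} (h : one f = one g) : f = g := by
  injection h

theorem src_eq {a b a' b' : B} {f g : a ⟶ b} {f' g' : a' ⟶ b'} {η : f ⟶ g} {η' : f' ⟶ g'}
    (h : mk η = mk η') : a = a' := by injection h

theorem tgt_eq {a b a' b' : B} {f g : a ⟶ b} {f' g' : a' ⟶ b'} {η : f ⟶ g} {η' : f' ⟶ g'}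
    (h : mk η = mk η') : b = b' := by injection h

theorem dom_eq {a b a' b' : B} {f g : a ⟶ b} {f' g' : a' ⟶ b'} {η : f ⟶ g} {η' : f' ⟶ g'}
    (h : mk η = mk η') : one f = one f' := by cases h; rfl

theorem cod_eq {a b a' b' : B} {f g : a ⟶ b} {f' g' : a' ⟶ b'} {η : f ⟶ g} {η' : f' ⟶ g'}
    (h : mk η = mk η') : one g = one g' := by cases h; rfl

theorem comp_congr {a b a' b' : B} {f g k : a ⟶ b} {f' g' k' : a' ⟶ b'}
    {η : f ⟶ g} {θ : g ⟶ k} {η' : f' ⟶ g'} {θ' : g' ⟶ k'}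
    (h : mk η = mk η') (h' : mk θ = mk θ') : mk (η ≫ θ) = mk (η' ≫ θ') := by
  cases h; cases h'; rfl

theorem whiskerLeft_congr {a b c a' b' c' : B} {f : a ⟶ b} {f' : a' ⟶ b'} {g k : b ⟶ c}
    {g' k' : b' ⟶ c'} {η : g ⟶ k} {η' : g' ⟶ k'} (h : one f = one f') (h' : mk η = mk η') :
    mk (f ◁ η) = mk (f' ◁ η') := by
  cases h; cases h'; rfl

theorem whiskerRight_congr {a b c a' b' c' : B} {f g : a ⟶ b} {f' g' : a' ⟶ b'} {k : b ⟶ c}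
    {k' : b' ⟶ c'} {η : f ⟶ g} {η' : f' ⟶ g'} (h : mk η = mk η') (h' : one k = one k') :
    mk (η ▷ k) = mk (η' ▷ k') := by
  cases h; cases h'; rfl

theorem one_comp_congr {a b c a' b' c' : B} {f : a ⟶ b} {f' : a' ⟶ b'} {g : b ⟶ c} {g' : b' ⟶ c'}
    (h : one f = one f') (h' : one g = one g') : one (f ≫ g) = one (f' ≫ g') := by
  cases h; cases h'; rfl

theorem zero_congr {a a' : B} (h : a = a') : zero a = zero a' := by cases h; rfl

theorem inv_congr {a b a' b' : B} {f g : a ⟶ b} {f' g' : a' ⟶ b'} {η : f ≅ g} {η' : f' ≅ g'}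
    (h : mk η.hom = mk η'.hom) : mk η.inv = mk η'.inv := by
  obtain ⟨η, θ, h₁, h₂⟩ := η
  obtain ⟨η', θ', h₁', h₂'⟩ := η'
  dsimp only at h
  cases h
  dsimp only at *
  congr 1
  rw [← Category.comp_id θ, ← h₁', ← Category.assoc, h₂, Category.id_comp]

@[simp]
theorem mk_eqToHom {a b : B} {f g : a ⟶ b} (h : f = g) : mk (eqToHom h) = one f := by
  cases h; rfl

@[simp]
theorem mk_eqToHom_comp {a b : B} {f g k : a ⟶ b} (h : f = g) (η : g ⟶ k) :
    mk (eqToHom h ≫ η) = mk η := by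
  cases h; simp

@[simp]
theorem mk_comp_eqToHom {a b : B} {f g k : a ⟶ b} (η : f ⟶ g) (h : g = k) :
    mk (η ≫ eqToHom h) = mk η := by
  cases h; simp

theorem one_congr {a b : B} {f g : a ⟶ b} (h : f = g) : one f = one g := by cases h; rfl

section Strict

variable [Strict B]

@[simp]
theorem one_id_comp {a b : B} (f : a ⟶ b) : one (𝟙 a ≫ f) = one f :=
  one_congr (Strict.id_comp f)

@[simp]
theorem one_comp_id {a b : B} (f : a ⟶ b) : one (f ≫ 𝟙 b) = one f :=
  one_congr (Strict.comp_id f)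

theorem one_assoc {a b c d : B} (f : a ⟶ b) (g : b ⟶ c) (h : c ⟶ d) :
    one ((f ≫ g) ≫ h) = one (f ≫ g ≫ h) :=
  one_congr (Strict.assoc f g h)

@[simp]
theorem mk_id_whiskerLeft {a b : B} {f g : a ⟶ b} (η : f ⟶ g) : mk (𝟙 a ◁ η) = mk η := by
  simp [Strict.leftUnitor_eqToIso]

@[simp]
theorem mk_whiskerRight_id {a b : B} {f g : a ⟶ b} (η : f ⟶ g) : mk (η ▷ 𝟙 b) = mk η := by
  simp [Strict.rightUnitor_eqToIso]

theorem mk_comp_whiskerLeft {a b c d : B} (f : a ⟶ b) (g : b ⟶ c) {h k : c ⟶ d} (η : h ⟶ k) :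
    mk ((f ≫ g) ◁ η) = mk (f ◁ g ◁ η) := by
  simp [Strict.associator_eqToIso]

theorem mk_whiskerRight_comp {a b c d : B} {h k : a ⟶ b} (η : h ⟶ k) (f : b ⟶ c) (g : c ⟶ d) :
    mk (η ▷ (f ≫ g)) = mk (η ▷ f ▷ g) := by
  simp [Strict.associator_eqToIso]

theorem mk_whisker_assoc {a b c d : B} (f : a ⟶ b) {h k : b ⟶ c} (η : h ⟶ k) (g : c ⟶ d) :
    mk ((f ◁ η) ▷ g) = mk (f ◁ η ▷ g) := by
  simp [Strict.associator_eqToIso]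

end Strict

/-- A 2-morphism with prescribed boundary that represents a given cell. -/
theorem exists_hom {a b : B} {f g : a ⟶ b} (c : Cell B) (h : one c.dom = one f)
    (h' : one c.cod = one g) : ∃ η : f ⟶ g, mk η = c := by
  obtain ⟨c⟩ := c
  dsimp only at h h'
  cases h; cases h'
  exact ⟨c, rfl⟩

/-- A 1-morphism with prescribed endpoints that represents a given 1-morphism. -/
theorem exists_one {a b a' b' : B} (f : a ⟶ b) (h : a = a') (h' : b = b') :
    ∃ g : a' ⟶ b', one g = one f := by
  cases h; cases h'
  exact ⟨f, rfl⟩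

end Cell

namespace StrictCell

variable {B : Type u} [Bicategory.{w, v} B] {C : Type u₁} [Bicategory.{w₁, v₁} C]

/-- The action of a strict 2-functor on cells. -/
def mapCell (F : StrictPseudofunctor B C) (c : Cell B) : Cell C := .mk (F.map₂ c.hom)

variable (F : StrictPseudofunctor B C)

theorem map_congr {a b a' b' : B} {f g : a ⟶ b} {f' g' : a' ⟶ b'} {η : f ⟶ g} {η' : f' ⟶ g'}
    (h : Cell.mk η = .mk η') : Cell.mk (F.map₂ η) = .mk (F.map₂ η') :=
  congrArg (mapCell F) h

theorem map_one {a b : B} (f : a ⟶ b) : Cell.mk (F.map₂ (𝟙 f)) = .one (F.map f) := by simp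

theorem map_one_congr {a b a' b' : B} {f : a ⟶ b} {f' : a' ⟶ b'} (h : Cell.one f = .one f') :
    Cell.one (F.map f) = .one (F.map f') := by
  cases h; rfl

theorem one_map_id (a : B) : Cell.one (F.map (𝟙 a)) = .zero (F.obj a) :=
  Cell.one_congr (F.map_id a)

theorem one_map_comp {a b c : B} (f : a ⟶ b) (g : b ⟶ c) :
    Cell.one (F.map (f ≫ g)) = .one (F.map f ≫ F.map g) :=
  Cell.one_congr (F.map_comp f g)

theorem mk_map_whiskerLeft {a b c : B} (f : a ⟶ b) {g h : b ⟶ c} (η : g ⟶ h) :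
    Cell.mk (F.map₂ (f ◁ η)) = .mk (F.map f ◁ F.map₂ η) := by
  simp [F.map₂_whisker_left, F.mapComp_eq_eqToIso]

theorem mk_map_whiskerRight {a b c : B} {f g : a ⟶ b} (η : f ⟶ g) (h : b ⟶ c) :
    Cell.mk (F.map₂ (η ▷ h)) = .mk (F.map₂ η ▷ F.map h) := by
  simp [F.map₂_whisker_right, F.mapComp_eq_eqToIso]

end StrictCell

/-- Two strict 2-functors are equal if they agree on cells. -/
theorem TwoCat.functor_ext_cell {B C : Type u} [Bicategory.{u, u} B] [Bicategory.{u, u} C]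
    {F G : StrictPseudofunctor B C}
    (h : ∀ {a b : B} {f g : a ⟶ b} (η : f ⟶ g), Cell.mk (F.map₂ η) = .mk (G.map₂ η)) : F = G := by
  apply TwoCat.functor_ext
  have hobj (a : B) : F.obj a = G.obj a := Cell.src_eq (h (𝟙 (𝟙 a)))
  have hmap {a b : B} (f : a ⟶ b) : Cell.one (F.map f) = .one (G.map f) := by
    rw [← StrictCell.map_one, ← StrictCell.map_one]; exact h _
  clear hobj
  rcases F with ⟨⟨⟨⟨⟨⟨F, m⟩, n⟩, _, _⟩, _, _, _, _, _, _, _⟩, _, _⟩, _, _⟩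
  rcases G with ⟨⟨⟨⟨⟨⟨G, m'⟩, n'⟩, _, _⟩, _, _, _, _, _, _, _⟩, _, _⟩, _, _⟩
  dsimp at h hmap ⊢
  obtain rfl : F = G := funext fun a => Cell.src_eq (hmap (𝟙 a))
  obtain rfl : @m = @m' := by
    funext a b f
    exact Cell.one_inj (hmap f)
  obtain rfl : @n = @n' := by
    funext a b f g η
    exact Cell.mk_inj (h η)
  rfl

/-! ### Single-sorted 2-categories -/

/-- The operations of a single-sorted 2-category: identities on the source and target in both
dimensions, and vertical (`comp₁`) and horizontal (`comp₀`) composition. The compositions are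
total; their values on pairs that are not composable are irrelevant. -/
class CellOps (M : Type*) where
  /-- the identity of the source object -/
  s₀ : M → M
  /-- the identity of the target object -/
  t₀ : M → M
  /-- the identity of the source 1-morphism -/
  s₁ : M → M
  /-- the identity of the target 1-morphism -/
  t₁ : M → M
  /-- horizontal composition -/
  comp₀ : M → M → M
  /-- vertical composition -/
  comp₁ : M → M → M

open CellOps

/-- The laws of a single-sorted 2-category. -/
class SingleSorted (M : Type*) [CellOps M] : Prop where
  s₀_s₀ (m : M) : s₀ (s₀ m) = s₀ m
  t₀_s₀ (m : M) : t₀ (s₀ m) = s₀ m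
  s₀_t₀ (m : M) : s₀ (t₀ m) = t₀ m
  s₁_s₁ (m : M) : s₁ (s₁ m) = s₁ m
  t₁_s₁ (m : M) : t₁ (s₁ m) = s₁ m
  s₁_t₁ (m : M) : s₁ (t₁ m) = t₁ m
  s₁_s₀ (m : M) : s₁ (s₀ m) = s₀ m
  s₁_t₀ (m : M) : s₁ (t₀ m) = t₀ m
  s₀_s₁ (m : M) : s₀ (s₁ m) = s₀ m
  t₀_s₁ (m : M) : t₀ (s₁ m) = t₀ m
  s₀_t₁ (m : M) : s₀ (t₁ m) = s₀ m
  t₀_t₁ (m : M) : t₀ (t₁ m) = t₀ m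
  s₁_comp₁ (m n : M) : t₁ m = s₁ n → s₁ (comp₁ m n) = s₁ m
  t₁_comp₁ (m n : M) : t₁ m = s₁ n → t₁ (comp₁ m n) = t₁ n
  s₀_comp₀ (m n : M) : t₀ m = s₀ n → s₀ (comp₀ m n) = s₀ m
  t₀_comp₀ (m n : M) : t₀ m = s₀ n → t₀ (comp₀ m n) = t₀ n
  s₁_comp₀ (m n : M) : t₀ m = s₀ n → s₁ (comp₀ m n) = comp₀ (s₁ m) (s₁ n)
  t₁_comp₀ (m n : M) : t₀ m = s₀ n → t₁ (comp₀ m n) = comp₀ (t₁ m) (t₁ n)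
  s₁_comp (m : M) : comp₁ (s₁ m) m = m
  comp_t₁ (m : M) : comp₁ m (t₁ m) = m
  s₀_comp (m : M) : comp₀ (s₀ m) m = m
  comp_t₀ (m : M) : comp₀ m (t₀ m) = m
  assoc₁ (m n p : M) : t₁ m = s₁ n → t₁ n = s₁ p → comp₁ (comp₁ m n) p = comp₁ m (comp₁ n p)
  assoc₀ (m n p : M) : t₀ m = s₀ n → t₀ n = s₀ p → comp₀ (comp₀ m n) p = comp₀ m (comp₀ n p)
  interchange (m n p q : M) : t₁ m = s₁ n → t₁ p = s₁ q → t₀ m = s₀ p →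
    comp₀ (comp₁ m n) (comp₁ p q) = comp₁ (comp₀ m p) (comp₀ n q)

namespace Cell

variable {B : Type u} [Bicategory.{w, v} B]

open Classical in
noncomputable instance : CellOps (Cell B) where
  s₀ c := zero c.src
  t₀ c := zero c.tgt
  s₁ c := one c.dom
  t₁ c := one c.cod
  comp₀ c d := if h : ∃ (e : B) (f g : c.tgt ⟶ e) (θ : f ⟶ g), d = mk θ then
    mk (c.hom ▷ h.choose_spec.choose ≫
      c.cod ◁ h.choose_spec.choose_spec.choose_spec.choose) else c
  comp₁ c d := if h : ∃ (k : c.src ⟶ c.tgt) (θ : c.cod ⟶ k), d = mk θ then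
    mk (c.hom ≫ h.choose_spec.choose) else c

theorem s₀_mk {a b : B} {f g : a ⟶ b} (η : f ⟶ g) : s₀ (mk η) = zero a := rfl
theorem t₀_mk {a b : B} {f g : a ⟶ b} (η : f ⟶ g) : t₀ (mk η) = zero b := rfl
theorem s₁_mk {a b : B} {f g : a ⟶ b} (η : f ⟶ g) : s₁ (mk η) = one f := rfl
theorem t₁_mk {a b : B} {f g : a ⟶ b} (η : f ⟶ g) : t₁ (mk η) = one g := rfl

theorem comp₁_mk {a b : B} {f g k : a ⟶ b} (η : f ⟶ g) (θ : g ⟶ k) :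
    comp₁ (mk η) (mk θ) = mk (η ≫ θ) := by
  have h : ∃ (k' : (mk η).src ⟶ (mk η).tgt) (θ' : (mk η).cod ⟶ k'), mk θ = mk θ' := ⟨k, θ, rfl⟩
  have e : comp₁ (mk η) (mk θ) = mk ((mk η).hom ≫ h.choose_spec.choose) := dif_pos h
  rw [e]
  exact comp_congr rfl h.choose_spec.choose_spec.symm

theorem comp₀_mk {a b c : B} {f g : a ⟶ b} {h k : b ⟶ c} (η : f ⟶ g) (θ : h ⟶ k) :
    comp₀ (mk η) (mk θ) = mk (η ▷ h ≫ g ◁ θ) := by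
  have H : ∃ (e : B) (f g : (mk η).tgt ⟶ e) (θ' : f ⟶ g), mk θ = mk θ' := ⟨c, h, k, θ, rfl⟩
  have e : comp₀ (mk η) (mk θ) = mk ((mk η).hom ▷ H.choose_spec.choose ≫
      (mk η).cod ◁ H.choose_spec.choose_spec.choose_spec.choose) := dif_pos H
  rw [e]
  have := H.choose_spec.choose_spec.choose_spec.choose_spec.symm
  exact comp_congr (whiskerRight_congr rfl (dom_eq this)) (whiskerLeft_congr rfl this)

theorem comp₀_one_mk {a b c : B} (f : a ⟶ b) {h k : b ⟶ c} (θ : h ⟶ k) :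
    comp₀ (one f) (mk θ) = mk (f ◁ θ) := by
  rw [one, comp₀_mk]; simp

theorem comp₀_mk_one {a b c : B} {f g : a ⟶ b} (η : f ⟶ g) (k : b ⟶ c) :
    comp₀ (mk η) (one k) = mk (η ▷ k) := by
  rw [one, comp₀_mk]; simp

theorem comp₀_one_one {a b c : B} (f : a ⟶ b) (g : b ⟶ c) :
    comp₀ (one f) (one g) = one (f ≫ g) := by
  rw [comp₀_one_mk]; simp

instance [Strict B] : SingleSorted (Cell B) where
  s₀_s₀ _ := rfl
  t₀_s₀ _ := rfl
  s₀_t₀ _ := rfl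
  s₁_s₁ _ := rfl
  t₁_s₁ _ := rfl
  s₁_t₁ _ := rfl
  s₁_s₀ _ := rfl
  s₁_t₀ _ := rfl
  s₀_s₁ _ := rfl
  t₀_s₁ _ := rfl
  s₀_t₁ _ := rfl
  t₀_t₁ _ := rfl
  s₁_comp₁ := by
    rintro ⟨η⟩ ⟨θ⟩ h
    rw [t₁_mk, s₁_mk] at h; cases h
    rw [comp₁_mk]; rfl
  t₁_comp₁ := by
    rintro ⟨η⟩ ⟨θ⟩ h
    rw [t₁_mk, s₁_mk] at h; cases h
    rw [comp₁_mk]; rfl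
  s₀_comp₀ := by
    rintro ⟨η⟩ ⟨θ⟩ h
    rw [t₀_mk, s₀_mk] at h; cases h
    rw [comp₀_mk]; rfl
  t₀_comp₀ := by
    rintro ⟨η⟩ ⟨θ⟩ h
    rw [t₀_mk, s₀_mk] at h; cases h
    rw [comp₀_mk]; rfl
  s₁_comp₀ := by
    rintro ⟨η⟩ ⟨θ⟩ h
    rw [t₀_mk, s₀_mk] at h; cases h
    rw [comp₀_mk, s₁_mk, s₁_mk, s₁_mk, comp₀_one_one]
  t₁_comp₀ := by
    rintro ⟨η⟩ ⟨θ⟩ h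
    rw [t₀_mk, s₀_mk] at h; cases h
    rw [comp₀_mk, t₁_mk, t₁_mk, t₁_mk, comp₀_one_one]
  s₁_comp := by
    rintro ⟨η⟩
    rw [s₁_mk, comp₁_mk, Category.id_comp]
  comp_t₁ := by
    rintro ⟨η⟩
    rw [t₁_mk, comp₁_mk, Category.comp_id]
  s₀_comp := by
    rintro ⟨η⟩
    rw [s₀_mk, comp₀_one_mk, mk_id_whiskerLeft]
  comp_t₀ := by
    rintro ⟨η⟩
    rw [t₀_mk, comp₀_mk_one, mk_whiskerRight_id]
  assoc₁ := by
    rintro ⟨η⟩ ⟨θ⟩ ⟨κ⟩ h h'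
    rw [t₁_mk, s₁_mk] at h h'; cases h; cases h'
    simp only [comp₁_mk, Category.assoc]
  assoc₀ := by
    rintro ⟨η⟩ ⟨θ⟩ ⟨κ⟩ h h'
    rw [t₀_mk, s₀_mk] at h h'; cases h; cases h'
    simp only [comp₀_mk, comp_whiskerRight, whiskerLeft_comp, Category.assoc]
    exact comp_congr (mk_whiskerRight_comp _ _ _).symm
      (comp_congr (mk_whisker_assoc _ _ _) (mk_comp_whiskerLeft _ _ _))
  interchange := by
    rintro ⟨η⟩ ⟨θ⟩ ⟨κ⟩ ⟨μ⟩ h h' h''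
    rw [t₁_mk, s₁_mk] at h h'; cases h; cases h'
    rw [t₀_mk, s₀_mk] at h''; cases h''
    simp only [comp₁_mk, comp₀_mk, comp_whiskerRight, whiskerLeft_comp, Category.assoc]
    rw [whisker_exchange_assoc]

end Cell

/-- The 2-category with the cells of a single-sorted 2-category: its objects are the cells that
are identities of objects. -/
structure CellCat (M : Type u) [CellOps M] : Type u where
  val : M
  property : s₀ val = val

namespace CellCat

variable {M : Type u} [CellOps M] [SingleSorted M]

open SingleSorted

/-- A 1-morphism is a cell that is an identity of a 1-morphism. -/
@[ext]
structure Hom (a b : CellCat M) : Type u where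
  val : M
  s₁_val : s₁ val = val
  s₀_val : s₀ val = a.val
  t₀_val : t₀ val = b.val

instance : CategoryStruct.{u} (CellCat M) where
  Hom := Hom
  id a := ⟨a.val, by rw [← a.2, s₁_s₀], a.2, by rw [← a.2, t₀_s₀]⟩
  comp f g :=
    { val := comp₀ f.val g.val
      s₁_val := by rw [s₁_comp₀ _ _ (f.t₀_val.trans g.s₀_val.symm), f.s₁_val, g.s₁_val]
      s₀_val := by rw [s₀_comp₀ _ _ (f.t₀_val.trans g.s₀_val.symm), f.s₀_val]
      t₀_val := by rw [t₀_comp₀ _ _ (f.t₀_val.trans g.s₀_val.symm), g.t₀_val] }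

theorem t₁_val {a b : CellCat M} (f : a ⟶ b) : t₁ f.val = f.val := by rw [← f.s₁_val, t₁_s₁]

theorem comp_val {a b c : CellCat M} (f : a ⟶ b) (g : b ⟶ c) :
    (f ≫ g).val = comp₀ f.val g.val := rfl

theorem id_val (a : CellCat M) : Hom.val (𝟙 a) = a.val := rfl

theorem hom_ext {a b : CellCat M} {f g : a ⟶ b} (h : f.val = g.val) : f = g := Hom.ext h

/-- A 2-morphism is a cell with the given boundary. -/
@[ext]
structure Hom₂ {a b : CellCat M} (f g : a ⟶ b) : Type u where
  val : M
  s₁_val : s₁ val = f.val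
  t₁_val : t₁ val = g.val

theorem Hom₂.s₀_val {a b : CellCat M} {f g : a ⟶ b} (η : Hom₂ f g) : s₀ η.val = a.val := by
  rw [← s₀_s₁, η.s₁_val, f.s₀_val]

theorem Hom₂.t₀_val {a b : CellCat M} {f g : a ⟶ b} (η : Hom₂ f g) : t₀ η.val = b.val := by
  rw [← t₀_s₁, η.s₁_val, f.t₀_val]

instance (a b : CellCat M) : Category.{u} (a ⟶ b) where
  Hom := Hom₂
  id f := ⟨f.val, f.s₁_val, CellCat.t₁_val f⟩
  comp η θ :=
    { val := comp₁ η.val θ.val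
      s₁_val := by rw [s₁_comp₁ _ _ (η.t₁_val.trans θ.s₁_val.symm), η.s₁_val]
      t₁_val := by rw [t₁_comp₁ _ _ (η.t₁_val.trans θ.s₁_val.symm), θ.t₁_val] }
  id_comp η := Hom₂.ext <| by dsimp only; rw [← η.s₁_val, s₁_comp]
  comp_id η := Hom₂.ext <| by dsimp only; rw [← η.t₁_val, comp_t₁]
  assoc η θ κ := Hom₂.ext <|
    assoc₁ _ _ _ (η.t₁_val.trans θ.s₁_val.symm) (θ.t₁_val.trans κ.s₁_val.symm)

theorem hom₂_ext {a b : CellCat M} {f g : a ⟶ b} {η θ : f ⟶ g} (h : η.val = θ.val) : η = θ :=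
  Hom₂.ext h

theorem comp_val₂ {a b : CellCat M} {f g h : a ⟶ b} (η : f ⟶ g) (θ : g ⟶ h) :
    (η ≫ θ).val = comp₁ η.val θ.val := rfl

theorem eqToHom_comp_val {a b : CellCat M} {f g h : a ⟶ b} (e : f = g) (η : g ⟶ h) :
    (eqToHom e ≫ η).val = η.val := by
  subst e; simp

theorem comp_eqToHom_val {a b : CellCat M} {f g h : a ⟶ b} (η : f ⟶ g) (e : g = h) :
    (η ≫ eqToHom e).val = η.val := by
  subst e; simp

/-- Left whiskering. -/
def wl {a b c : CellCat M} (f : a ⟶ b) {g h : b ⟶ c} (η : g ⟶ h) : f ≫ g ⟶ f ≫ h where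
  val := comp₀ f.val η.val
  s₁_val := by rw [s₁_comp₀ _ _ (f.t₀_val.trans η.s₀_val.symm), f.s₁_val, η.s₁_val]; rfl
  t₁_val := by
    rw [t₁_comp₀ _ _ (f.t₀_val.trans η.s₀_val.symm), CellCat.t₁_val, η.t₁_val]; rfl

/-- Right whiskering. -/
def wr {a b c : CellCat M} {f g : a ⟶ b} (η : f ⟶ g) (h : b ⟶ c) : f ≫ h ⟶ g ≫ h where
  val := comp₀ η.val h.val
  s₁_val := by rw [s₁_comp₀ _ _ (η.t₀_val.trans h.s₀_val.symm), h.s₁_val, η.s₁_val]; rfl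
  t₁_val := by
    rw [t₁_comp₀ _ _ (η.t₀_val.trans h.s₀_val.symm), CellCat.t₁_val, η.t₁_val]; rfl

theorem wl_val {a b c : CellCat M} (f : a ⟶ b) {g h : b ⟶ c} (η : g ⟶ h) :
    (wl f η).val = comp₀ f.val η.val := rfl

theorem wr_val {a b c : CellCat M} {f g : a ⟶ b} (η : f ⟶ g) (h : b ⟶ c) :
    (wr η h).val = comp₀ η.val h.val := rfl

theorem id_comp' {a b : CellCat M} (f : a ⟶ b) : 𝟙 a ≫ f = f :=
  hom_ext <| by rw [comp_val, id_val, ← f.s₀_val, s₀_comp]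

theorem comp_id' {a b : CellCat M} (f : a ⟶ b) : f ≫ 𝟙 b = f :=
  hom_ext <| by rw [comp_val, id_val, ← f.t₀_val, comp_t₀]

theorem assoc' {a b c d : CellCat M} (f : a ⟶ b) (g : b ⟶ c) (h : c ⟶ d) :
    (f ≫ g) ≫ h = f ≫ g ≫ h :=
  hom_ext (assoc₀ _ _ _ (f.t₀_val.trans g.s₀_val.symm) (g.t₀_val.trans h.s₀_val.symm))

theorem wl_eqToHom {a b c : CellCat M} (f : a ⟶ b) {g h : b ⟶ c} (e : g = h) :
    wl f (eqToHom e) = eqToHom (congrArg (f ≫ ·) e) := by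
  subst e; rfl

theorem wr_eqToHom {a b c : CellCat M} {f g : a ⟶ b} (e : f = g) (h : b ⟶ c) :
    wr (eqToHom e) h = eqToHom (congrArg (· ≫ h) e) := by
  subst e; rfl

theorem comp₁_self {a b : CellCat M} (f : a ⟶ b) : comp₁ f.val f.val = f.val := by
  conv_lhs => enter [1]; rw [← f.s₁_val]
  exact s₁_comp _

theorem comp₁_cod {a b : CellCat M} {f g : a ⟶ b} (η : f ⟶ g) : comp₁ η.val g.val = η.val := by
  rw [← η.t₁_val, comp_t₁]

theorem comp₁_dom {a b : CellCat M} {f g : a ⟶ b} (η : f ⟶ g) : comp₁ f.val η.val = η.val := by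
  rw [← η.s₁_val, s₁_comp]

instance : Bicategory.{u, u} (CellCat M) where
  whiskerLeft f _ _ η := wl f η
  whiskerRight η h := wr η h
  associator f g h := eqToIso (assoc' f g h)
  leftUnitor f := eqToIso (id_comp' f)
  rightUnitor f := eqToIso (comp_id' f)
  whiskerLeft_id f g := rfl
  whiskerLeft_comp f _ _ _ η θ := by
    refine hom₂_ext ?_
    rw [wl_val, comp_val₂, comp_val₂, wl_val, wl_val, ← interchange, comp₁_self]
    exacts [(CellCat.t₁_val f).trans (Hom.s₁_val f).symm, η.t₁_val.trans θ.s₁_val.symm,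
      f.t₀_val.trans η.s₀_val.symm]
  id_whiskerLeft η := by
    refine hom₂_ext ?_
    rw [eqToIso.hom, eqToIso.inv, eqToHom_comp_val, comp_eqToHom_val, wl_val, id_val, ← η.s₀_val,
      s₀_comp]
  comp_whiskerLeft f g _ _ η := by
    refine hom₂_ext ?_
    rw [eqToIso.hom, eqToIso.inv, eqToHom_comp_val, comp_eqToHom_val]
    exact assoc₀ _ _ _ (f.t₀_val.trans g.s₀_val.symm) (g.t₀_val.trans η.s₀_val.symm)
  id_whiskerRight _ _ := rfl
  comp_whiskerRight η θ h := by
    refine hom₂_ext ?_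
    rw [wr_val, comp_val₂, comp_val₂, wr_val, wr_val, ← interchange, comp₁_self]
    exacts [η.t₁_val.trans θ.s₁_val.symm, (CellCat.t₁_val h).trans (Hom.s₁_val h).symm,
      η.t₀_val.trans h.s₀_val.symm]
  whiskerRight_id η := by
    refine hom₂_ext ?_
    rw [eqToIso.hom, eqToIso.inv, eqToHom_comp_val, comp_eqToHom_val, wr_val, id_val, ← η.t₀_val,
      comp_t₀]
  whiskerRight_comp η f g := by
    refine hom₂_ext ?_
    rw [eqToIso.hom, eqToIso.inv, eqToHom_comp_val, comp_eqToHom_val]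
    exact (assoc₀ _ _ _ (η.t₀_val.trans f.s₀_val.symm) (f.t₀_val.trans g.s₀_val.symm)).symm
  whisker_assoc f _ _ η g := by
    refine hom₂_ext ?_
    rw [eqToIso.hom, eqToIso.inv, eqToHom_comp_val, comp_eqToHom_val]
    exact assoc₀ _ _ _ (f.t₀_val.trans η.s₀_val.symm) (η.t₀_val.trans g.s₀_val.symm)
  whisker_exchange {a b c f g h i} η θ := by
    refine hom₂_ext ?_
    rw [comp_val₂, comp_val₂, wl_val, wl_val, wr_val, wr_val, ← interchange, ← interchange,
      comp₁_cod, comp₁_cod, comp₁_dom, comp₁_dom]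
    exacts [η.t₁_val.trans (Hom.s₁_val g).symm, (CellCat.t₁_val h).trans θ.s₁_val.symm,
      η.t₀_val.trans (Hom.s₀_val h).symm, (CellCat.t₁_val f).trans η.s₁_val.symm,
      θ.t₁_val.trans (Hom.s₁_val i).symm, f.t₀_val.trans θ.s₀_val.symm]
  pentagon f g h i := by simp only [eqToIso.hom, wl_eqToHom, wr_eqToHom, eqToHom_trans]
  triangle f g := by simp only [eqToIso.hom, wl_eqToHom, wr_eqToHom, eqToHom_trans]

instance : Bicategory.Strict (CellCat M) where
  id_comp := id_comp'
  comp_id := comp_id'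
  assoc := assoc'

theorem cell_ext {a b a' b' : CellCat M} {f g : a ⟶ b} {f' g' : a' ⟶ b'} {η : f ⟶ g}
    {η' : f' ⟶ g'} (h : Hom₂.val η = Hom₂.val η') : Cell.mk η = .mk η' := by
  obtain rfl : a = a' := by
    have := η.s₀_val.symm.trans ((congrArg s₀ h).trans η'.s₀_val)
    cases a; cases a'; dsimp only at this; subst this; rfl
  obtain rfl : b = b' := by
    have := η.t₀_val.symm.trans ((congrArg t₀ h).trans η'.t₀_val)
    cases b; cases b'; dsimp only at this; subst this; rfl
  obtain rfl : f = f' := hom_ext (η.s₁_val.symm.trans ((congrArg s₁ h).trans η'.s₁_val))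
  obtain rfl : g = g' := hom_ext (η.t₁_val.symm.trans ((congrArg t₁ h).trans η'.t₁_val))
  rw [hom₂_ext h]

/-- An element of a single-sorted 2-category, as a 2-morphism. -/
def toHom₂ (m : M) :
    Hom₂ (a := ⟨s₀ m, s₀_s₀ m⟩) (b := ⟨t₀ m, s₀_t₀ m⟩) ⟨s₁ m, s₁_s₁ m, s₀_s₁ m, t₀_s₁ m⟩
      ⟨t₁ m, s₁_t₁ m, s₀_t₁ m, t₀_t₁ m⟩ where
  val := m
  s₁_val := rfl
  t₁_val := rfl

theorem exists_comp₁ {m n : M} (h : t₁ m = s₁ n) :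
    ∃ (a b : CellCat M) (f g k : a ⟶ b) (η : f ⟶ g) (θ : g ⟶ k),
      Hom₂.val η = m ∧ Hom₂.val θ = n :=
  ⟨_, _, _, _, ⟨t₁ n, s₁_t₁ n, by rw [s₀_t₁, ← s₀_s₁, ← h, s₀_t₁], by
    rw [t₀_t₁, ← t₀_s₁, ← h, t₀_t₁]⟩, toHom₂ m, ⟨n, h.symm, rfl⟩, rfl, rfl⟩

theorem exists_comp₀ {m n : M} (h : t₀ m = s₀ n) :
    ∃ (a b c : CellCat M) (f g : a ⟶ b) (k l : b ⟶ c) (η : f ⟶ g) (θ : k ⟶ l),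
      Hom₂.val η = m ∧ Hom₂.val θ = n :=
  ⟨_, _, ⟨t₀ n, s₀_t₀ n⟩, _, _, ⟨s₁ n, s₁_s₁ n, (s₀_s₁ n).trans h.symm, t₀_s₁ n⟩,
    ⟨t₁ n, s₁_t₁ n, (s₀_t₁ n).trans h.symm, t₀_t₁ n⟩, toHom₂ m, ⟨n, rfl, rfl⟩, rfl, rfl⟩

theorem comp₀_val_eq {a b c : CellCat M} {f g : a ⟶ b} {k l : b ⟶ c} (η : f ⟶ g) (θ : k ⟶ l) :
    comp₀ (Hom₂.val η) (Hom₂.val θ) = Hom₂.val (η ▷ k ≫ g ◁ θ) := by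
  refine Eq.trans ?_ (interchange _ _ _ _ ?_ ?_ ?_)
  · rw [comp₁_cod, comp₁_dom]
  · exact (Hom₂.t₁_val η).trans (Hom.s₁_val g).symm
  · exact (CellCat.t₁_val k).trans (Hom₂.s₁_val θ).symm
  · exact (Hom₂.t₀_val η).trans (Hom.s₀_val k).symm

end CellCat

section

open CellOps Opposite

open Classical in
/-- The product of single-sorted 2-categories. A composite is formed only if all its components
are composable. -/
noncomputable instance {ι : Type*} (M : ι → Type*) [∀ i, CellOps (M i)] : CellOps (∀ i, M i) where
  s₀ m i := s₀ (m i)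
  t₀ m i := t₀ (m i)
  s₁ m i := s₁ (m i)
  t₁ m i := t₁ (m i)
  comp₀ m n := if ∀ i, t₀ (m i) = s₀ (n i) then fun i => comp₀ (m i) (n i) else m
  comp₁ m n := if ∀ i, t₁ (m i) = s₁ (n i) then fun i => comp₁ (m i) (n i) else m

namespace SingleSorted

section Pi

variable {ι : Type*} {M : ι → Type*} [∀ i, CellOps (M i)]

theorem pi_comp₀ {m n : ∀ i, M i} (h : t₀ m = s₀ n) :
    comp₀ m n = fun i => comp₀ (m i) (n i) := if_pos (congrFun h)

theorem pi_comp₁ {m n : ∀ i, M i} (h : t₁ m = s₁ n) :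
    comp₁ m n = fun i => comp₁ (m i) (n i) := if_pos (congrFun h)

theorem pi_comp₀_of_ne {m n : ∀ i, M i} (h : ¬ t₀ m = s₀ n) : comp₀ m n = m :=
  if_neg fun h' => h (funext h')

theorem pi_comp₁_of_ne {m n : ∀ i, M i} (h : ¬ t₁ m = s₁ n) : comp₁ m n = m :=
  if_neg fun h' => h (funext h')

instance [∀ i, SingleSorted (M i)] : SingleSorted (∀ i, M i) where
  s₀_s₀ _ := funext fun _ => s₀_s₀ _
  t₀_s₀ _ := funext fun _ => t₀_s₀ _
  s₀_t₀ _ := funext fun _ => s₀_t₀ _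
  s₁_s₁ _ := funext fun _ => s₁_s₁ _
  t₁_s₁ _ := funext fun _ => t₁_s₁ _
  s₁_t₁ _ := funext fun _ => s₁_t₁ _
  s₁_s₀ _ := funext fun _ => s₁_s₀ _
  s₁_t₀ _ := funext fun _ => s₁_t₀ _
  s₀_s₁ _ := funext fun _ => s₀_s₁ _
  t₀_s₁ _ := funext fun _ => t₀_s₁ _
  s₀_t₁ _ := funext fun _ => s₀_t₁ _
  t₀_t₁ _ := funext fun _ => t₀_t₁ _
  s₁_comp₁ m n h := by rw [pi_comp₁ h]; exact funext fun i => s₁_comp₁ _ _ (congrFun h i)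
  t₁_comp₁ m n h := by rw [pi_comp₁ h]; exact funext fun i => t₁_comp₁ _ _ (congrFun h i)
  s₀_comp₀ m n h := by rw [pi_comp₀ h]; exact funext fun i => s₀_comp₀ _ _ (congrFun h i)
  t₀_comp₀ m n h := by rw [pi_comp₀ h]; exact funext fun i => t₀_comp₀ _ _ (congrFun h i)
  s₁_comp₀ m n h := by
    rw [pi_comp₀ h, pi_comp₀ (funext fun i => ?_)]
    · exact funext fun i => s₁_comp₀ _ _ (congrFun h i)
    · exact (t₀_s₁ (m i)).trans ((congrFun h i).trans (s₀_s₁ (n i)).symm)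
  t₁_comp₀ m n h := by
    rw [pi_comp₀ h, pi_comp₀ (funext fun i => ?_)]
    · exact funext fun i => t₁_comp₀ _ _ (congrFun h i)
    · exact (t₀_t₁ (m i)).trans ((congrFun h i).trans (s₀_t₁ (n i)).symm)
  s₁_comp m := by
    rw [pi_comp₁ (m := s₁ m) (funext fun i => t₁_s₁ (m i))]; exact funext fun i => s₁_comp _
  comp_t₁ m := by
    rw [pi_comp₁ (n := t₁ m) (funext fun i => (s₁_t₁ (m i)).symm)]; exact funext fun i => comp_t₁ _
  s₀_comp m := by
    rw [pi_comp₀ (m := s₀ m) (funext fun i => t₀_s₀ (m i))]; exact funext fun i => s₀_comp _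
  comp_t₀ m := by
    rw [pi_comp₀ (n := t₀ m) (funext fun i => (s₀_t₀ (m i)).symm)]; exact funext fun i => comp_t₀ _
  assoc₁ m n p h h' := by
    rw [pi_comp₁ h, pi_comp₁ h', pi_comp₁, pi_comp₁]
    · exact funext fun i => assoc₁ _ _ _ (congrFun h i) (congrFun h' i)
    · exact funext fun i => (congrFun h i).trans (s₁_comp₁ _ _ (congrFun h' i)).symm
    · exact funext fun i => (t₁_comp₁ _ _ (congrFun h i)).trans (congrFun h' i)
  assoc₀ m n p h h' := by
    rw [pi_comp₀ h, pi_comp₀ h', pi_comp₀, pi_comp₀]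
    · exact funext fun i => assoc₀ _ _ _ (congrFun h i) (congrFun h' i)
    · exact funext fun i => (congrFun h i).trans (s₀_comp₀ _ _ (congrFun h' i)).symm
    · exact funext fun i => (t₀_comp₀ _ _ (congrFun h i)).trans (congrFun h' i)
  interchange m n p q h h' h'' := by
    have hi (i) : t₁ (m i) = s₁ (n i) := congrFun h i
    have hi' (i) : t₁ (p i) = s₁ (q i) := congrFun h' i
    have hn (i) : t₀ (n i) = s₀ (q i) := by
      rw [← t₀_s₁, ← s₀_s₁, ← hi, ← hi']
      exact (t₀_t₁ (m i)).trans ((congrFun h'' i).trans (s₀_t₁ (p i)).symm)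
    rw [pi_comp₁ h, pi_comp₁ h', pi_comp₀ h'', pi_comp₀ (funext hn), pi_comp₀, pi_comp₁]
    · exact funext fun i => interchange _ _ _ _ (congrFun h i) (congrFun h' i) (congrFun h'' i)
    · refine funext fun i => (t₁_comp₀ _ _ (congrFun h'' i)).trans
        (Eq.trans ?_ (s₁_comp₀ _ _ (hn i)).symm)
      rw [← hi, ← hi']
    · refine funext fun i => ?_
      change t₀ (comp₁ (m i) (n i)) = s₀ (comp₁ (p i) (q i))
      rw [← t₀_s₁, ← s₀_s₁, s₁_comp₁ _ _ (hi i), s₁_comp₁ _ _ (hi' i), t₀_s₁, s₀_s₁]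
      exact congrFun h'' i

end Pi

section Generated

variable {G : Type u} {N : Type v} [CellOps N] (g : G → N)

/-- Formal composites of generators. -/
inductive Term (G : Type u) : Type u
  | of (x : G)
  | s₀ (m : Term G)
  | t₀ (m : Term G)
  | s₁ (m : Term G)
  | t₁ (m : Term G)
  | comp₀ (m n : Term G)
  | comp₁ (m n : Term G)

/-- The value of a formal composite. -/
def Term.eval : Term G → N
  | of x => g x
  | s₀ m => CellOps.s₀ m.eval
  | t₀ m => CellOps.t₀ m.eval
  | s₁ m => CellOps.s₁ m.eval
  | t₁ m => CellOps.t₁ m.eval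
  | comp₀ m n => CellOps.comp₀ m.eval n.eval
  | comp₁ m n => CellOps.comp₁ m.eval n.eval

/-- The part of `N` generated by a family `g`, as a quotient of the formal composites; it lives in
the universe of the index type of `g`, however large `N` is. -/
def Generated : Type u := Quotient (Setoid.ker (Term.eval g))

namespace Generated

variable {g}

/-- The inclusion of the generated part. -/
def val : Generated g → N := Quotient.lift (Term.eval g) fun _ _ h => h

theorem val_injective : Function.Injective (val (g := g)) := by
  rintro ⟨m⟩ ⟨n⟩ h; exact Quotient.sound h

variable (g) in
/-- A generator. -/
def of (x : G) : Generated g := Quotient.mk _ (.of x)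

instance : CellOps (Generated g) where
  s₀ := Quotient.map .s₀ fun _ _ h => congrArg CellOps.s₀ h
  t₀ := Quotient.map .t₀ fun _ _ h => congrArg CellOps.t₀ h
  s₁ := Quotient.map .s₁ fun _ _ h => congrArg CellOps.s₁ h
  t₁ := Quotient.map .t₁ fun _ _ h => congrArg CellOps.t₁ h
  comp₀ := Quotient.map₂ .comp₀ fun _ _ h _ _ h' => congrArg₂ CellOps.comp₀ h h'
  comp₁ := Quotient.map₂ .comp₁ fun _ _ h _ _ h' => congrArg₂ CellOps.comp₁ h h'

@[simp] theorem val_s₀ (m : Generated g) : (s₀ m).val = s₀ m.val := by rcases m with ⟨m⟩; rfl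
@[simp] theorem val_t₀ (m : Generated g) : (t₀ m).val = t₀ m.val := by rcases m with ⟨m⟩; rfl
@[simp] theorem val_s₁ (m : Generated g) : (s₁ m).val = s₁ m.val := by rcases m with ⟨m⟩; rfl
@[simp] theorem val_t₁ (m : Generated g) : (t₁ m).val = t₁ m.val := by rcases m with ⟨m⟩; rfl
@[simp] theorem val_comp₀ (m n : Generated g) : (comp₀ m n).val = comp₀ m.val n.val := by
  rcases m with ⟨m⟩; rcases n with ⟨n⟩; rfl
@[simp] theorem val_comp₁ (m n : Generated g) : (comp₁ m n).val = comp₁ m.val n.val := by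
  rcases m with ⟨m⟩; rcases n with ⟨n⟩; rfl

theorem induction {P : Generated g → Prop} (of : ∀ x, P (of g x)) (s₀ : ∀ m, P m → P (s₀ m))
    (t₀ : ∀ m, P m → P (t₀ m)) (s₁ : ∀ m, P m → P (s₁ m)) (t₁ : ∀ m, P m → P (t₁ m))
    (comp₀ : ∀ m n, P m → P n → P (comp₀ m n)) (comp₁ : ∀ m n, P m → P n → P (comp₁ m n))
    (m : Generated g) : P m := by
  obtain ⟨m, rfl⟩ := Quotient.exists_rep m
  induction m with
  | of x => exact of x
  | s₀ m ih => exact s₀ _ ih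
  | t₀ m ih => exact t₀ _ ih
  | s₁ m ih => exact s₁ _ ih
  | t₁ m ih => exact t₁ _ ih
  | comp₀ m n ihm ihn => exact comp₀ _ _ ihm ihn
  | comp₁ m n ihm ihn => exact comp₁ _ _ ihm ihn

theorem val_t₀_eq {m n : Generated g} (h : t₀ m = s₀ n) : t₀ m.val = s₀ n.val := by
  rw [← val_t₀, h, val_s₀]

theorem val_t₁_eq {m n : Generated g} (h : t₁ m = s₁ n) : t₁ m.val = s₁ n.val := by
  rw [← val_t₁, h, val_s₁]

instance [SingleSorted N] : SingleSorted (Generated g) where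
  s₀_s₀ _ := val_injective <| by simp [s₀_s₀]
  t₀_s₀ _ := val_injective <| by simp [t₀_s₀]
  s₀_t₀ _ := val_injective <| by simp [s₀_t₀]
  s₁_s₁ _ := val_injective <| by simp [s₁_s₁]
  t₁_s₁ _ := val_injective <| by simp [t₁_s₁]
  s₁_t₁ _ := val_injective <| by simp [s₁_t₁]
  s₁_s₀ _ := val_injective <| by simp [s₁_s₀]
  s₁_t₀ _ := val_injective <| by simp [s₁_t₀]
  s₀_s₁ _ := val_injective <| by simp [s₀_s₁]
  t₀_s₁ _ := val_injective <| by simp [t₀_s₁]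
  s₀_t₁ _ := val_injective <| by simp [s₀_t₁]
  t₀_t₁ _ := val_injective <| by simp [t₀_t₁]
  s₁_comp₁ _ _ h := val_injective <| by simp [s₁_comp₁ _ _ (val_t₁_eq h)]
  t₁_comp₁ _ _ h := val_injective <| by simp [t₁_comp₁ _ _ (val_t₁_eq h)]
  s₀_comp₀ _ _ h := val_injective <| by simp [s₀_comp₀ _ _ (val_t₀_eq h)]
  t₀_comp₀ _ _ h := val_injective <| by simp [t₀_comp₀ _ _ (val_t₀_eq h)]
  s₁_comp₀ _ _ h := val_injective <| by simp [s₁_comp₀ _ _ (val_t₀_eq h)]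
  t₁_comp₀ _ _ h := val_injective <| by simp [t₁_comp₀ _ _ (val_t₀_eq h)]
  s₁_comp _ := val_injective <| by simp [s₁_comp]
  comp_t₁ _ := val_injective <| by simp [comp_t₁]
  s₀_comp _ := val_injective <| by simp [s₀_comp]
  comp_t₀ _ := val_injective <| by simp [comp_t₀]
  assoc₁ _ _ _ h h' := val_injective <| by simp [assoc₁ _ _ _ (val_t₁_eq h) (val_t₁_eq h')]
  assoc₀ _ _ _ h h' := val_injective <| by simp [assoc₀ _ _ _ (val_t₀_eq h) (val_t₀_eq h')]
  interchange _ _ _ _ h h' h'' := val_injective <| by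
    simp [interchange _ _ _ _ (val_t₁_eq h) (val_t₁_eq h') (val_t₀_eq h'')]

end Generated

end Generated

end SingleSorted

/-! ### Left adjoints of nerves -/

namespace TwoCat

open SingleSorted

variable {T : Type} [SmallCategory T] (F : T ⥤ TwoCat.{u})

/-- The nerve of a 2-category with respect to a diagram `F` of 2-categories: the presheaf of
strict 2-functors from `F`. -/
abbrev nerve : TwoCat.{u} ⥤ (Tᵒᵖ ⥤ Type u) := yoneda ⋙ (Functor.whiskeringLeft _ _ _).obj F.op

variable {F} (X : Tᵒᵖ ⥤ Type u)

/-- The generating cells of the realization of `X`: the cells of the 2-categories `F k`, one copy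
for each element of `X k`. -/
structure RealizationGen (F : T ⥤ TwoCat.{u}) (X : Tᵒᵖ ⥤ Type u) : Type u where
  shape : T
  elt : X.obj (op shape)
  cell : Cell (F.obj shape)

/-- The 2-functor indexed by an element of `X`, for a map from `X` to the nerve of `C`. -/
abbrev eltFunctor {X : Tᵒᵖ ⥤ Type u} {C : TwoCat.{u}} (α : X ⟶ (nerve F).obj C) {k : T}
    (x : X.obj (op k)) : F.obj k ⟶ C := α.app (op k) x

/-- The values of a generating cell under all maps from `X` to a nerve. -/
noncomputable def realizationVal {X : Tᵒᵖ ⥤ Type u} (g : RealizationGen F X) :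
    ∀ i : (Σ C : TwoCat.{u}, X ⟶ (nerve F).obj C), Cell i.1 :=
  fun i => StrictCell.mapCell (eltFunctor i.2 g.elt) g.cell

/-- The cells of the realization of `X`. They are the formal composites of the generating cells,
where two of them are identified if they agree under every map from `X` to a nerve. -/
noncomputable abbrev RealizationCell : Type u := Generated (realizationVal (F := F) (X := X))

/-- The realization of `X`, that is, the value at `X` of the left adjoint of the nerve. -/
noncomputable def realization (F : T ⥤ TwoCat.{u}) (X : Tᵒᵖ ⥤ Type u) : TwoCat.{u} :=
  ⟨CellCat (RealizationCell (F := F) X)⟩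

variable {X}

/-- A generating cell, as a cell of the realization. -/
noncomputable def genCell {k : T} (x : X.obj (op k)) (c : Cell (F.obj k)) :
    RealizationCell (F := F) X :=
  Generated.of _ ⟨k, x, c⟩

theorem realizationCell_ext {m n : RealizationCell (F := F) X} (h : ∀ i, m.val i = n.val i) :
    m = n :=
  Generated.val_injective (funext h)

theorem genCell_val {k : T} (x : X.obj (op k)) (c : Cell (F.obj k)) (i) :
    (genCell x c).val i = StrictCell.mapCell (eltFunctor i.2 x) c := rfl

section

variable {k : T} (x : X.obj (op k))

theorem s₀_genCell {a b : F.obj k} {f g : a ⟶ b} (η : f ⟶ g) :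
    s₀ (genCell x (.mk η)) = genCell x (.zero a) := realizationCell_ext fun i => by
  rw [Generated.val_s₀, genCell_val]
  exact Eq.symm (by change Cell.mk _ = _; rw [StrictCell.map_one, StrictCell.one_map_id]; rfl)

theorem t₀_genCell {a b : F.obj k} {f g : a ⟶ b} (η : f ⟶ g) :
    t₀ (genCell x (.mk η)) = genCell x (.zero b) := realizationCell_ext fun i => by
  rw [Generated.val_t₀, genCell_val]
  exact Eq.symm (by change Cell.mk _ = _; rw [StrictCell.map_one, StrictCell.one_map_id]; rfl)

theorem s₁_genCell {a b : F.obj k} {f g : a ⟶ b} (η : f ⟶ g) :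
    s₁ (genCell x (.mk η)) = genCell x (.one f) := realizationCell_ext fun i => by
  rw [Generated.val_s₁, genCell_val]
  exact Eq.symm (by change Cell.mk _ = _; rw [StrictCell.map_one]; rfl)

theorem t₁_genCell {a b : F.obj k} {f g : a ⟶ b} (η : f ⟶ g) :
    t₁ (genCell x (.mk η)) = genCell x (.one g) := realizationCell_ext fun i => by
  rw [Generated.val_t₁, genCell_val]
  exact Eq.symm (by change Cell.mk _ = _; rw [StrictCell.map_one]; rfl)

theorem comp₁_genCell {a b : F.obj k} {f g h : a ⟶ b} (η : f ⟶ g) (θ : g ⟶ h) :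
    comp₁ (genCell x (.mk η)) (genCell x (.mk θ)) = genCell x (.mk (η ≫ θ)) :=
  realizationCell_ext fun i => by
    rw [Generated.val_comp₁, pi_comp₁]
    · change comp₁ (Cell.mk _) (Cell.mk _) = Cell.mk _
      rw [Cell.comp₁_mk, PrelaxFunctor.map₂_comp]
    · rw [← Generated.val_t₁, ← Generated.val_s₁, t₁_genCell, s₁_genCell]

theorem comp₀_genCell_left {a b c : F.obj k} (f : a ⟶ b) {g h : b ⟶ c} (η : g ⟶ h) :
    comp₀ (genCell x (.one f)) (genCell x (.mk η)) = genCell x (.mk (f ◁ η)) :=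
  realizationCell_ext fun i => by
    rw [Generated.val_comp₀, pi_comp₀]
    · change comp₀ (Cell.mk _) (Cell.mk _) = Cell.mk _
      rw [StrictCell.map_one, Cell.comp₀_one_mk, StrictCell.mk_map_whiskerLeft]
    · rw [← Generated.val_t₀, ← Generated.val_s₀, t₀_genCell, s₀_genCell]

theorem comp₀_genCell_right {a b c : F.obj k} {f g : a ⟶ b} (η : f ⟶ g) (h : b ⟶ c) :
    comp₀ (genCell x (.mk η)) (genCell x (.one h)) = genCell x (.mk (η ▷ h)) :=
  realizationCell_ext fun i => by
    rw [Generated.val_comp₀, pi_comp₀]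
    · change comp₀ (Cell.mk _) (Cell.mk _) = Cell.mk _
      rw [StrictCell.map_one, Cell.comp₀_mk_one, StrictCell.mk_map_whiskerRight]
    · rw [← Generated.val_t₀, ← Generated.val_s₀, t₀_genCell, s₀_genCell]

theorem comp₀_genCell_one {a b c : F.obj k} (f : a ⟶ b) (h : b ⟶ c) :
    comp₀ (genCell x (.one f)) (genCell x (.one h)) = genCell x (.one (f ≫ h)) := by
  rw [Cell.one, comp₀_genCell_right, id_whiskerRight]

/-- The 2-functor into the realization that is indexed by an element of `X`. -/
noncomputable def realizationElt : F.obj k ⟶ realization F X :=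
  StrictPseudofunctor.mk'' (C := CellCat (RealizationCell (F := F) X))
    { obj a := ⟨genCell x (.zero a), s₀_genCell x _⟩
      map f := ⟨genCell x (.one f), s₁_genCell x _, s₀_genCell x _, t₀_genCell x _⟩
      map₂ η := ⟨genCell x (.mk η), s₁_genCell x _, t₁_genCell x _⟩
      map₂_id _ := rfl
      map₂_comp η θ := CellCat.hom₂_ext (comp₁_genCell x η θ).symm
      map_id _ := rfl
      map_comp f g := CellCat.hom_ext (comp₀_genCell_one x f g).symm
      map₂_whisker_left f _ _ η := CellCat.hom₂_ext <| by
        rw [CellCat.eqToHom_comp_val, CellCat.comp_eqToHom_val]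
        exact (comp₀_genCell_left x f η).symm
      map₂_whisker_right η h := CellCat.hom₂_ext <| by
        rw [CellCat.eqToHom_comp_val, CellCat.comp_eqToHom_val]
        exact (comp₀_genCell_right x η h).symm }

end

variable (F X) in
/-- The universal map from `X` to the nerve of its realization. -/
noncomputable def realizationUnit : X ⟶ (nerve F).obj (realization F X) where
  app k := ↾fun x => realizationElt (k := k.unop) x
  naturality k l φ := by
    ext x
    refine functor_ext_cell fun {a b f g} η => CellCat.cell_ext ?_
    refine realizationCell_ext fun i => ?_
    have := ConcreteCategory.congr_hom (i.2.naturality φ) x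
    exact congrArg (fun G => StrictCell.mapCell G (Cell.mk η)) this

section

variable {C : TwoCat.{u}} (α : X ⟶ (nerve F).obj C)

/-- The value of a cell of the realization under a map from `X` to the nerve of `C`. -/
noncomputable def cellVal (m : RealizationCell (F := F) X) : Cell C := m.val ⟨C, α⟩

theorem s₀_cellVal (m : RealizationCell (F := F) X) : s₀ (cellVal α m) = cellVal α (s₀ m) := by
  rw [cellVal, cellVal, Generated.val_s₀]; rfl

theorem t₀_cellVal (m : RealizationCell (F := F) X) : t₀ (cellVal α m) = cellVal α (t₀ m) := by
  rw [cellVal, cellVal, Generated.val_t₀]; rfl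

theorem s₁_cellVal (m : RealizationCell (F := F) X) : s₁ (cellVal α m) = cellVal α (s₁ m) := by
  rw [cellVal, cellVal, Generated.val_s₁]; rfl

theorem t₁_cellVal (m : RealizationCell (F := F) X) : t₁ (cellVal α m) = cellVal α (t₁ m) := by
  rw [cellVal, cellVal, Generated.val_t₁]; rfl

theorem comp₀_cellVal {m n : RealizationCell (F := F) X} (h : t₀ m = s₀ n) :
    cellVal α (comp₀ m n) = comp₀ (cellVal α m) (cellVal α n) := by
  rw [cellVal, Generated.val_comp₀, pi_comp₀ (Generated.val_t₀_eq h)]; rfl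

theorem comp₁_cellVal {m n : RealizationCell (F := F) X} (h : t₁ m = s₁ n) :
    cellVal α (comp₁ m n) = comp₁ (cellVal α m) (cellVal α n) := by
  rw [cellVal, Generated.val_comp₁, pi_comp₁ (Generated.val_t₁_eq h)]; rfl

theorem cellVal_obj (a : CellCat (RealizationCell (F := F) X)) :
    cellVal α a.val = .zero (cellVal α a.val).src := by
  conv_lhs => rw [← a.property, ← s₀_cellVal]
  rfl

theorem exists_descMap {a b : CellCat (RealizationCell (F := F) X)} (f : a ⟶ b) :
    ∃ g : (cellVal α a.val).src ⟶ (cellVal α b.val).src,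
      Cell.one g = cellVal α (CellCat.Hom.val f) := by
  have h : s₁ (cellVal α (CellCat.Hom.val f)) = cellVal α (CellCat.Hom.val f) := by
    rw [s₁_cellVal, CellCat.Hom.s₁_val]
  rw [← h]
  refine Cell.exists_one _ ?_ ?_
  · rw [← CellCat.Hom.s₀_val f, ← s₀_cellVal]; rfl
  · rw [← CellCat.Hom.t₀_val f, ← t₀_cellVal]; rfl

/-- The descended 2-functor on 1-morphisms. -/
noncomputable def descMap {a b : CellCat (RealizationCell (F := F) X)} (f : a ⟶ b) :
    (cellVal α a.val).src ⟶ (cellVal α b.val).src := (exists_descMap α f).choose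

theorem one_descMap {a b : CellCat (RealizationCell (F := F) X)} (f : a ⟶ b) :
    Cell.one (descMap α f) = cellVal α (CellCat.Hom.val f) := (exists_descMap α f).choose_spec

theorem exists_descMap₂ {a b : CellCat (RealizationCell (F := F) X)} {f g : a ⟶ b} (η : f ⟶ g) :
    ∃ θ : descMap α f ⟶ descMap α g, Cell.mk θ = cellVal α (CellCat.Hom₂.val η) := by
  apply Cell.exists_hom
  · rw [one_descMap, ← CellCat.Hom₂.s₁_val η, ← s₁_cellVal]; rfl
  · rw [one_descMap, ← CellCat.Hom₂.t₁_val η, ← t₁_cellVal]; rfl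

/-- The descended 2-functor on 2-morphisms. -/
noncomputable def descMap₂ {a b : CellCat (RealizationCell (F := F) X)} {f g : a ⟶ b}
    (η : f ⟶ g) : descMap α f ⟶ descMap α g := (exists_descMap₂ α η).choose

theorem mk_descMap₂ {a b : CellCat (RealizationCell (F := F) X)} {f g : a ⟶ b} (η : f ⟶ g) :
    Cell.mk (descMap₂ α η) = cellVal α (CellCat.Hom₂.val η) := (exists_descMap₂ α η).choose_spec

/-- The 2-functor out of the realization of `X` that corresponds to a map from `X` to a nerve. -/
noncomputable def realizationDesc : realization F X ⟶ C :=
  StrictPseudofunctor.mk'' (B := CellCat (RealizationCell (F := F) X))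
    { obj a := (cellVal α a.val).src
      map := descMap α
      map₂ := descMap₂ α
      map₂_id f := Cell.mk_inj <| (mk_descMap₂ α _).trans (one_descMap α f).symm
      map₂_comp η θ := Cell.mk_inj <| by
        rw [mk_descMap₂, ← Cell.comp₁_mk, mk_descMap₂, mk_descMap₂, CellCat.comp_val₂,
          comp₁_cellVal]
        exact (CellCat.Hom₂.t₁_val η).trans (CellCat.Hom₂.s₁_val θ).symm
      map_id a := Cell.one_inj <| by rw [one_descMap, CellCat.id_val, cellVal_obj α a]
      map_comp f g := Cell.one_inj <| by
        rw [one_descMap, ← Cell.comp₀_one_one, one_descMap, one_descMap, CellCat.comp_val,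
          comp₀_cellVal]
        exact (CellCat.Hom.t₀_val f).trans (CellCat.Hom.s₀_val g).symm
      map₂_whisker_left f _ _ η := Cell.mk_inj <| by
        rw [Cell.mk_eqToHom_comp, Cell.mk_comp_eqToHom, mk_descMap₂, ← Cell.comp₀_one_mk,
          one_descMap, mk_descMap₂]
        exact comp₀_cellVal α ((CellCat.Hom.t₀_val f).trans (CellCat.Hom₂.s₀_val η).symm)
      map₂_whisker_right η h := Cell.mk_inj <| by
        rw [Cell.mk_eqToHom_comp, Cell.mk_comp_eqToHom, mk_descMap₂, ← Cell.comp₀_mk_one,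
          one_descMap, mk_descMap₂]
        exact comp₀_cellVal α ((CellCat.Hom₂.t₀_val η).trans (CellCat.Hom.s₀_val h).symm) }

theorem unit_desc :
    realizationUnit F X ≫ (nerve F).map (realizationDesc α) = α := by
  ext k x
  exact functor_ext_cell fun {a b f g} η => mk_descMap₂ α _

/-- A 2-functor out of the realization of `X` is determined by its restriction to `X`. -/
theorem eq_realizationDesc (H : realization F X ⟶ C)
    (hH : realizationUnit F X ≫ (nerve F).map H = α) : H = realizationDesc α := by
  let H' : StrictPseudofunctor (CellCat (RealizationCell (F := F) X)) C := H
  have key (m : RealizationCell (F := F) X) :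
      Cell.mk (H'.map₂ (CellCat.toHom₂ m)) = cellVal α m := by
    have val_eq {a b : CellCat (RealizationCell (F := F) X)} {f g : a ⟶ b} (η : f ⟶ g)
        (m : RealizationCell (F := F) X) (h : CellCat.Hom₂.val η = m) :
        Cell.mk (H'.map₂ (CellCat.toHom₂ m)) = .mk (H'.map₂ η) :=
      StrictCell.map_congr H' (CellCat.cell_ext h.symm)
    induction m using Generated.induction with
    | of g =>
      obtain ⟨k, x, ⟨η⟩⟩ := g
      have h₁ := congrArg (fun β => StrictCell.mapCell (eltFunctor β x) (.mk η)) hH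
      exact (val_eq ((realizationElt x).map₂ η) _ rfl).trans h₁
    | s₀ m ih =>
      refine (val_eq (𝟙 (𝟙 (⟨s₀ m, s₀_s₀ m⟩ : CellCat _))) _ rfl).trans
        (Eq.trans ?_ (s₀_cellVal α m))
      rw [StrictCell.map_one, StrictCell.one_map_id]
      exact congrArg s₀ ih
    | t₀ m ih =>
      refine (val_eq (𝟙 (𝟙 (⟨t₀ m, s₀_t₀ m⟩ : CellCat _))) _ rfl).trans
        (Eq.trans ?_ (t₀_cellVal α m))
      rw [StrictCell.map_one, StrictCell.one_map_id]
      exact congrArg t₀ ih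
    | s₁ m ih =>
      let f : (⟨s₀ m, s₀_s₀ m⟩ : CellCat (RealizationCell (F := F) X)) ⟶ ⟨t₀ m, s₀_t₀ m⟩ :=
        ⟨s₁ m, s₁_s₁ m, s₀_s₁ m, t₀_s₁ m⟩
      refine (val_eq (𝟙 f) _ rfl).trans (Eq.trans ?_ (s₁_cellVal α m))
      rw [StrictCell.map_one]
      exact congrArg s₁ ih
    | t₁ m ih =>
      let f : (⟨s₀ m, s₀_s₀ m⟩ : CellCat (RealizationCell (F := F) X)) ⟶ ⟨t₀ m, s₀_t₀ m⟩ :=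
        ⟨t₁ m, s₁_t₁ m, s₀_t₁ m, t₀_t₁ m⟩
      refine (val_eq (𝟙 f) _ rfl).trans (Eq.trans ?_ (t₁_cellVal α m))
      rw [StrictCell.map_one]
      exact congrArg t₁ ih
    | comp₀ m n ihm ihn =>
      by_cases h : t₀ m = s₀ n
      · rw [comp₀_cellVal α h, ← ihm, ← ihn]
        obtain ⟨a, b, c, f, g, k, l, η, θ, rfl, rfl⟩ := CellCat.exists_comp₀ h
        rw [val_eq η _ rfl, val_eq θ _ rfl, Cell.comp₀_mk,
          val_eq _ _ (CellCat.comp₀_val_eq η θ).symm, PrelaxFunctor.map₂_comp]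
        exact Cell.comp_congr (StrictCell.mk_map_whiskerRight _ _ _)
          (StrictCell.mk_map_whiskerLeft _ _ _)
      · have : comp₀ m n = m := Generated.val_injective <| by
          rw [Generated.val_comp₀, pi_comp₀_of_ne]
          rw [← Generated.val_t₀, ← Generated.val_s₀]
          exact fun h' => h (Generated.val_injective h')
        rw [this, ihm]
    | comp₁ m n ihm ihn =>
      by_cases h : t₁ m = s₁ n
      · rw [comp₁_cellVal α h, ← ihm, ← ihn]
        obtain ⟨a, b, f, g, k, η, θ, rfl, rfl⟩ := CellCat.exists_comp₁ h
        rw [val_eq η _ rfl, val_eq θ _ rfl, Cell.comp₁_mk, ← PrelaxFunctor.map₂_comp]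
        exact val_eq (η ≫ θ) _ rfl
      · have : comp₁ m n = m := Generated.val_injective <| by
          rw [Generated.val_comp₁, pi_comp₁_of_ne]
          rw [← Generated.val_t₁, ← Generated.val_s₁]
          exact fun h' => h (Generated.val_injective h')
        rw [this, ihm]
  refine functor_ext_cell fun {a b f g} η => ?_
  refine Eq.trans ?_ (mk_descMap₂ α η).symm
  rw [← key]
  exact StrictCell.map_congr H' (CellCat.cell_ext rfl)

end

variable (F) in
/-- The nerve with respect to any small diagram of 2-categories has a left adjoint. -/
theorem nerve_isRightAdjoint : (nerve F).IsRightAdjoint := by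
  have (X : Tᵒᵖ ⥤ Type u) : Limits.HasInitial (StructuredArrow X (nerve F)) := by
    refine Limits.IsInitial.hasInitial (X := StructuredArrow.mk (realizationUnit F X)) ?_
    refine Limits.IsInitial.ofUniqueHom
      (fun Y => StructuredArrow.homMk (realizationDesc Y.hom) (unit_desc Y.hom)) fun Y m => ?_
    exact StructuredArrow.hom_ext _ _ (eq_realizationDesc Y.hom m.right (StructuredArrow.w m))
  exact isRightAdjoint_iff_hasInitial_structuredArrow.2 this

end TwoCat

end

/-! ### Tetrahedra -/

/-- The data of a 2-functor `𝒪₂[3] ⟶ C`: four objects, six 1-morphisms, and the four faces, which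
satisfy the cocycle condition. -/
structure Tetrahedron (C : Type u) [Bicategory.{w, v} C] where
  {x₀ : C}
  {x₁ : C}
  {x₂ : C}
  {x₃ : C}
  {f₀₁ : x₀ ⟶ x₁}
  {f₁₂ : x₁ ⟶ x₂}
  {f₂₃ : x₂ ⟶ x₃}
  {f₀₂ : x₀ ⟶ x₂}
  {f₁₃ : x₁ ⟶ x₃}
  {f₀₃ : x₀ ⟶ x₃}
  t₀₁₂ : f₀₂ ⟶ f₀₁ ≫ f₁₂
  t₁₂₃ : f₁₃ ⟶ f₁₂ ≫ f₂₃
  t₀₁₃ : f₀₃ ⟶ f₀₁ ≫ f₁₃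
  t₀₂₃ : f₀₃ ⟶ f₀₂ ≫ f₂₃
  cocycle : t₀₁₃ ≫ f₀₁ ◁ t₁₂₃ = t₀₂₃ ≫ t₀₁₂ ▷ f₂₃ ≫ (α_ f₀₁ f₁₂ f₂₃).hom

namespace LocallyThin

variable {J : Type u} [Category.{u} J] {P : LocalPreorder J}

theorem cell_ext {a b a' b' : LocallyThin P} {f g : a ⟶ b} {f' g' : a' ⟶ b'} {η : f ⟶ g}
    {η' : f' ⟶ g'} (h : Cell.one f = .one f') (h' : Cell.one g = .one g') :
    Cell.mk η = .mk η' := by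
  cases h; cases h'
  rw [Subsingleton.elim η η']

end LocallyThin

namespace Tetrahedron

variable {C : Type u} [Bicategory.{w, v} C] (D : Tetrahedron C)

/-- The vertices. -/
def obj : Fin 4 → C
  | 0 => D.x₀
  | 1 => D.x₁
  | 2 => D.x₂
  | 3 => D.x₃

/-- The 1-morphism from `i` to `j` that passes through those of the inner vertices `1`, `2` for
which the corresponding flag is set. -/
def map : ∀ i j : Fin 4, i ≤ j → Bool → Bool → (D.obj i ⟶ D.obj j)
  | 0, 0, _, _, _ => 𝟙 D.x₀
  | 1, 1, _, _, _ => 𝟙 D.x₁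
  | 2, 2, _, _, _ => 𝟙 D.x₂
  | 3, 3, _, _, _ => 𝟙 D.x₃
  | 0, 1, _, _, _ => D.f₀₁
  | 1, 2, _, _, _ => D.f₁₂
  | 2, 3, _, _, _ => D.f₂₃
  | 0, 2, _, true, _ => D.f₀₁ ≫ D.f₁₂
  | 0, 2, _, false, _ => D.f₀₂
  | 1, 3, _, _, true => D.f₁₂ ≫ D.f₂₃
  | 1, 3, _, _, false => D.f₁₃
  | 0, 3, _, true, true => D.f₀₁ ≫ D.f₁₂ ≫ D.f₂₃
  | 0, 3, _, true, false => D.f₀₁ ≫ D.f₁₃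
  | 0, 3, _, false, true => D.f₀₂ ≫ D.f₂₃
  | 0, 3, _, false, false => D.f₀₃

/-- The 2-morphism between two parallel composites of edges. -/
def map₂ : ∀ (i j : Fin 4) (h : i ≤ j) (a b a' b' : Bool), a ≤ a' → b ≤ b' →
    (D.map i j h a b ⟶ D.map i j h a' b')
  | 0, 0, _, _, _, _, _, _, _ => 𝟙 (𝟙 D.x₀)
  | 1, 1, _, _, _, _, _, _, _ => 𝟙 (𝟙 D.x₁)
  | 2, 2, _, _, _, _, _, _, _ => 𝟙 (𝟙 D.x₂)
  | 3, 3, _, _, _, _, _, _, _ => 𝟙 (𝟙 D.x₃)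
  | 0, 1, _, _, _, _, _, _, _ => 𝟙 D.f₀₁
  | 1, 2, _, _, _, _, _, _, _ => 𝟙 D.f₁₂
  | 2, 3, _, _, _, _, _, _, _ => 𝟙 D.f₂₃
  | 0, 2, _, true, _, true, _, _, _ => 𝟙 (D.f₀₁ ≫ D.f₁₂)
  | 0, 2, _, false, _, true, _, _, _ => D.t₀₁₂
  | 0, 2, _, false, _, false, _, _, _ => 𝟙 D.f₀₂
  | 1, 3, _, _, true, _, true, _, _ => 𝟙 (D.f₁₂ ≫ D.f₂₃)
  | 1, 3, _, _, false, _, true, _, _ => D.t₁₂₃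
  | 1, 3, _, _, false, _, false, _, _ => 𝟙 D.f₁₃
  | 0, 3, _, false, false, false, false, _, _ => 𝟙 D.f₀₃
  | 0, 3, _, false, false, true, false, _, _ => D.t₀₁₃
  | 0, 3, _, false, false, false, true, _, _ => D.t₀₂₃
  | 0, 3, _, false, false, true, true, _, _ => D.t₀₁₃ ≫ D.f₀₁ ◁ D.t₁₂₃
  | 0, 3, _, true, false, true, false, _, _ => 𝟙 (D.f₀₁ ≫ D.f₁₃)
  | 0, 3, _, true, false, true, true, _, _ => D.f₀₁ ◁ D.t₁₂₃
  | 0, 3, _, false, true, false, true, _, _ => 𝟙 (D.f₀₂ ≫ D.f₂₃)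
  | 0, 3, _, false, true, true, true, _, _ => D.t₀₁₂ ▷ D.f₂₃ ≫ (α_ D.f₀₁ D.f₁₂ D.f₂₃).hom
  | 0, 3, _, true, true, true, true, _, _ => 𝟙 (D.f₀₁ ≫ D.f₁₂ ≫ D.f₂₃)

theorem map₂_id : ∀ (i j : Fin 4) (h : i ≤ j) (a b : Bool) (ha : a ≤ a) (hb : b ≤ b),
    D.map₂ i j h a b a b ha hb = 𝟙 (D.map i j h a b)
  | 0, 0, _, _, _, _, _ | 1, 1, _, _, _, _, _ | 2, 2, _, _, _, _, _ | 3, 3, _, _, _, _, _ => rfl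
  | 0, 1, _, _, _, _, _ | 1, 2, _, _, _, _, _ | 2, 3, _, _, _, _, _ => rfl
  | 0, 2, _, true, _, _, _ | 0, 2, _, false, _, _, _ => rfl
  | 1, 3, _, _, true, _, _ | 1, 3, _, _, false, _, _ => rfl
  | 0, 3, _, true, true, _, _ | 0, 3, _, true, false, _, _ | 0, 3, _, false, true, _, _
  | 0, 3, _, false, false, _, _ => rfl

theorem map₂_comp (i j : Fin 4) (h : i ≤ j) (a b a' b' a'' b'' : Bool) (ha : a ≤ a') (hb : b ≤ b')
    (ha' : a' ≤ a'') (hb' : b' ≤ b'') :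
    D.map₂ i j h a b a'' b'' (ha.trans ha') (hb.trans hb') =
      D.map₂ i j h a b a' b' ha hb ≫ D.map₂ i j h a' b' a'' b'' ha' hb' := by
  fin_cases i <;> fin_cases j <;> first
    | exact absurd h (by decide)
    | (cases a <;> cases b <;> cases a' <;> cases b' <;> cases a'' <;> cases b'' <;> first
        | exact absurd ha (by decide)
        | exact absurd hb (by decide)
        | exact absurd ha' (by decide)
        | exact absurd hb' (by decide)
        | exact (Category.id_comp _).symm
        | exact (Category.comp_id _).symm
        | exact rfl
        | exact D.cocycle)

theorem map₂_heq {i j : Fin 4} {h : i ≤ j} {a b a' b' c d c' d' : Bool} {ha : a ≤ a'} {hb : b ≤ b'}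
    {hc : c ≤ c'} {hd : d ≤ d'} (e₁ : a = c) (e₂ : b = d) (e₃ : a' = c') (e₄ : b' = d') :
    Cell.mk (D.map₂ i j h a b a' b' ha hb) = .mk (D.map₂ i j h c d c' d' hc hd) := by
  subst e₁ e₂ e₃ e₄; rfl

end Tetrahedron

theorem Cell.mk_comp_associator {B : Type u} [Bicategory.{w, v} B] [Strict B] {a b c d : B}
    {k : a ⟶ d} (f : a ⟶ b) (g : b ⟶ c) (h : c ⟶ d) (η : k ⟶ (f ≫ g) ≫ h) :
    Cell.mk (η ≫ (α_ f g h).hom) = .mk η := by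
  simp [Strict.associator_eqToIso]

namespace Tetrahedron

section Flags

/-- The constraints on the flags of a path from `i` to `j`. -/
def FlagCond (i j : Fin 4) (a b : Bool) : Prop :=
  ((i = 1 ∨ j = 1) → a = true) ∧ ((i = 2 ∨ j = 2) → b = true) ∧
    ((1 < i ∨ j < 1) → a = false) ∧ ((2 < i ∨ j < 2) → b = false)

instance (i j : Fin 4) (a b : Bool) : Decidable (FlagCond i j a b) := by
  unfold FlagCond; infer_instance

variable {C : Type u} [Bicategory.{w, v} C] [Strict C] (D : Tetrahedron C)

theorem map_comp (i j k : Fin 4) (hij : i < j) (hjk : j < k) (a b c d : Bool)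
    (h : FlagCond i j a b) (h' : FlagCond j k c d) :
    D.map i k (hij.trans hjk).le (a || c) (b || d) =
      D.map i j hij.le a b ≫ D.map j k hjk.le c d := by
  fin_cases i <;> fin_cases j <;> first
    | exact absurd hij (by decide)
    | (fin_cases k <;> first
        | exact absurd hjk (by decide)
        | (cases a <;> cases b <;> first
            | exact absurd h (by decide)
            | (cases c <;> cases d <;> first
                | exact absurd h' (by decide)
                | exact rfl
                | exact (Strict.assoc _ _ _).symm)))

theorem map₂_left (i j k : Fin 4) (hij : i < j) (hjk : j < k) (a b c d c' d' : Bool)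
    (h : FlagCond i j a b) (h' : FlagCond j k c d) (h'' : FlagCond j k c' d')
    (hc : c ≤ c') (hd : d ≤ d') (hc' : (a || c) ≤ (a || c')) (hd' : (b || d) ≤ (b || d')) :
    Cell.mk (D.map₂ i k (hij.trans hjk).le (a || c) (b || d) (a || c') (b || d') hc' hd') =
      .mk (D.map i j hij.le a b ◁ D.map₂ j k hjk.le c d c' d' hc hd) := by
  fin_cases i <;> fin_cases j <;> first
    | exact absurd hij (by decide)
    | (fin_cases k <;> first
        | exact absurd hjk (by decide)
        | (cases a <;> cases b <;> first
            | exact absurd h (by decide)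
            | (cases c <;> cases d <;> first
                | exact absurd h' (by decide)
                | (cases c' <;> cases d' <;> first
                    | exact absurd h'' (by decide)
                    | exact absurd hc (by decide)
                    | exact absurd hd (by decide)
                    | exact rfl
                    | exact congrArg Cell.mk (whiskerLeft_id _ _).symm
                    | exact (Cell.one_assoc _ _ _).symm.trans
                        (congrArg Cell.mk (whiskerLeft_id _ _).symm)))))

theorem map₂_right (i j k : Fin 4) (hij : i < j) (hjk : j < k) (a b a' b' c d : Bool)
    (h : FlagCond i j a b) (h' : FlagCond i j a' b') (h'' : FlagCond j k c d)
    (ha : a ≤ a') (hb : b ≤ b') (ha' : (a || c) ≤ (a' || c)) (hb' : (b || d) ≤ (b' || d)) :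
    Cell.mk (D.map₂ i k (hij.trans hjk).le (a || c) (b || d) (a' || c) (b' || d) ha' hb') =
      .mk (D.map₂ i j hij.le a b a' b' ha hb ▷ D.map j k hjk.le c d) := by
  fin_cases i <;> fin_cases j <;> first
    | exact absurd hij (by decide)
    | (fin_cases k <;> first
        | exact absurd hjk (by decide)
        | (cases c <;> cases d <;> first
            | exact absurd h'' (by decide)
            | (cases a <;> cases b <;> first
                | exact absurd h (by decide)
                | (cases a' <;> cases b' <;> first
                    | exact absurd h' (by decide)
                    | exact absurd ha (by decide)
                    | exact absurd hb (by decide)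
                    | exact congrArg Cell.mk (id_whiskerRight _ _).symm
                    | exact (Cell.one_assoc _ _ _).symm.trans
                        (congrArg Cell.mk (id_whiskerRight _ _).symm)
                    | exact rfl
                    | exact Cell.mk_comp_associator _ _ _ _))))

end Flags

end Tetrahedron

/-! ### The 1-morphisms and 2-morphisms of orientals -/

namespace Oriental

variable {J : Type u} [LinearOrder J]

/-- The 1-morphism `i ⟶ j` with no inner vertices. -/
def edge {P : LocalPreorder (SimplicialThickening J)} {i j : J} (h : i ≤ j) :
    (⟨⟨i⟩⟩ : LocallyThin P) ⟶ ⟨⟨j⟩⟩ :=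
  SimplicialThickening.Path.mk {i, j} (by simp) (by simp) (by simp [h]) (by simp [h])

/-- The set of vertices of a 1-morphism. -/
def verts {P : LocalPreorder (SimplicialThickening J)} {i j : LocallyThin P} (S : i ⟶ j) : Set J :=
  SimplicialThickening.Path.I S

section

variable {P : LocalPreorder (SimplicialThickening J)}

theorem hom_ext {i j : LocallyThin P} {S T : i ⟶ j} (h : verts S = verts T) : S = T :=
  SimplicialThickening.Path.ext h

theorem verts_comp {i j k : LocallyThin P} (S : i ⟶ j) (T : j ⟶ k) :
    verts (S ≫ T) = verts S ∪ verts T := rfl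

theorem verts_id (i : LocallyThin P) : verts (𝟙 i) = {i.as.as} := rfl

theorem verts_edge {i j : J} (h : i ≤ j) : verts (P := P) (edge h) = {i, j} := rfl

theorem left_mem {i j : LocallyThin P} (S : i ⟶ j) : i.as.as ∈ verts S :=
  SimplicialThickening.Path.left S

theorem right_mem {i j : LocallyThin P} (S : i ⟶ j) : j.as.as ∈ verts S :=
  SimplicialThickening.Path.right S

theorem le_of_mem {i j : LocallyThin P} {S : i ⟶ j} {k : J} (h : k ∈ verts S) : i.as.as ≤ k :=
  SimplicialThickening.Path.left_le S k h

theorem ge_of_mem {i j : LocallyThin P} {S : i ⟶ j} {k : J} (h : k ∈ verts S) : k ≤ j.as.as :=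
  SimplicialThickening.Path.le_right S k h

theorem le_of_hom {i j : LocallyThin P} (S : i ⟶ j) : i.as.as ≤ j.as.as :=
  le_of_mem (right_mem S)

theorem eq_id {i : LocallyThin P} (S : i ⟶ i) : S = 𝟙 i := by
  apply hom_ext
  rw [verts_id]
  ext k
  rw [Set.mem_singleton_iff]
  exact ⟨fun h => (ge_of_mem h).antisymm (le_of_mem h), fun h => h ▸ left_mem S⟩

theorem edge_self (i : J) : edge (P := P) (le_refl i) = 𝟙 _ := eq_id _

end

theorem subset_of_hom {i j : LocallyThin (inclusion J)} {S T : i ⟶ j} (η : S ⟶ T) :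
    verts S ⊆ verts T := LocallyThin.le_of_hom η

/-- The 2-morphism given by an inclusion. -/
def homOfSubset {i j : LocallyThin (inclusion J)} {S T : i ⟶ j} (h : verts S ⊆ verts T) :
    S ⟶ T := LocallyThin.homMk h

/-- The 2-morphism `{i, k} ⟶ {i, j, k}`. -/
def face {i j k : J} (h : i ≤ j) (h' : j ≤ k) :
    edge (P := inclusion J) (h.trans h') ⟶ edge h ≫ edge h' :=
  homOfSubset (by
    rw [verts_comp, verts_edge, verts_edge, verts_edge]
    rintro x (rfl | rfl) <;> simp)

/-- The 2-category `𝒪₂[n]`, in a form whose structure is visible to unification. -/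
abbrev Orient (n : ℕ) : Type u := LocallyThin (inclusion (ULift.{u} (Fin (n + 1))))

end Oriental

/-! ### The 2-functor given by a tetrahedron -/

namespace Tetrahedron

open Oriental

open Classical in
/-- The flag that tells whether a path passes through the vertex `k`. -/
noncomputable def flag (k : Fin 4) {i j : Orient.{u} 3} (S : i ⟶ j) : Bool :=
  decide ((⟨k⟩ : ULift.{u} (Fin 4)) ∈ Oriental.verts S)

open Classical in
theorem flag_comp (l : Fin 4) {i j k : Orient.{u} 3} (S : i ⟶ j) (T : j ⟶ k) :
    flag l (S ≫ T) = (flag l S || flag l T) := by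
  unfold flag
  rw [← Bool.decide_or]
  exact decide_eq_decide.2 Iff.rfl

theorem flag_mono (l : Fin 4) {i j : Orient.{u} 3} {S T : i ⟶ j} (η : S ⟶ T) :
    flag l S ≤ flag l T := by
  unfold flag
  intro h
  simp only [decide_eq_true_eq] at h ⊢
  exact subset_of_hom η h

open Classical in
theorem flagCond {i j : Orient.{u} 3} (S : i ⟶ j) :
    FlagCond i.as.as.down j.as.as.down (flag 1 S) (flag 2 S) := by
  have h₁ (l : Fin 4) (h : i.as.as.down = l ∨ j.as.as.down = l) : flag l S = true := by
    refine decide_eq_true ?_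
    rcases h with rfl | rfl
    exacts [left_mem S, right_mem S]
  have h₂ (l : Fin 4) (h : l < i.as.as.down ∨ j.as.as.down < l) : flag l S = false := by
    refine decide_eq_false fun hl => ?_
    rcases h with h | h
    exacts [absurd h (not_lt.2 (le_of_mem hl)), absurd h (not_lt.2 (ge_of_mem hl))]
  exact ⟨h₁ 1, h₁ 2, h₂ 1, h₂ 2⟩

variable {C : TwoCat.{u}} (D : Tetrahedron C)

/-- The 2-functor on 1-morphisms. -/
noncomputable def mapHom {i j : Orient.{u} 3} (S : i ⟶ j) :
    D.obj i.as.as.down ⟶ D.obj j.as.as.down :=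
  D.map _ _ (le_of_hom S) (flag 1 S) (flag 2 S)

/-- The 2-functor on 2-morphisms. -/
noncomputable def mapHom₂ {i j : Orient.{u} 3} {S T : i ⟶ j} (η : S ⟶ T) :
    D.mapHom S ⟶ D.mapHom T :=
  D.map₂ _ _ _ _ _ _ _ (flag_mono 1 η) (flag_mono 2 η)

theorem mapHom_id (i : Orient.{u} 3) : D.mapHom (𝟙 i) = 𝟙 (D.obj i.as.as.down) := by
  obtain ⟨⟨⟨i⟩⟩⟩ := i
  unfold mapHom
  fin_cases i <;> rfl

theorem mapHom_comp {i j k : Orient.{u} 3} (S : i ⟶ j) (T : j ⟶ k) :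
    D.mapHom (S ≫ T) = D.mapHom S ≫ D.mapHom T := by
  rcases (le_of_hom S).eq_or_lt with h | h
  · obtain rfl : i = j := by obtain ⟨⟨i⟩⟩ := i; obtain ⟨⟨j⟩⟩ := j; dsimp only at h; rw [h]
    rw [eq_id S, Strict.id_comp, mapHom_id, Strict.id_comp]
  rcases (le_of_hom T).eq_or_lt with h' | h'
  · obtain rfl : j = k := by obtain ⟨⟨j⟩⟩ := j; obtain ⟨⟨k⟩⟩ := k; dsimp only at h'; rw [h']
    rw [eq_id T, Strict.comp_id, mapHom_id, Strict.comp_id]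
  rw [mapHom, flag_comp, flag_comp]
  exact D.map_comp _ _ _ h h' _ _ _ _ (flagCond S) (flagCond T)

theorem mapHom₂_congr {i j i' j' : Orient.{u} 3} {S T : i ⟶ j} {S' T' : i' ⟶ j'}
    {η : S ⟶ T} {η' : S' ⟶ T'} (h : Cell.mk η = .mk η') :
    Cell.mk (D.mapHom₂ η) = .mk (D.mapHom₂ η') :=
  congrArg (fun c : Cell (Orient.{u} 3) => Cell.mk (D.mapHom₂ c.hom)) h

theorem mapHom₂_left {i j k : Orient.{u} 3} (S : i ⟶ j) {T T' : j ⟶ k} (η : T ⟶ T') :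
    Cell.mk (D.mapHom₂ (S ◁ η)) = .mk (D.mapHom S ◁ D.mapHom₂ η) := by
  rcases (le_of_hom S).eq_or_lt with h | h
  · obtain rfl : i = j := by obtain ⟨⟨i⟩⟩ := i; obtain ⟨⟨j⟩⟩ := j; dsimp only at h; rw [h]
    rw [eq_id S, D.mapHom₂_congr (Cell.mk_id_whiskerLeft η), mapHom_id, Cell.mk_id_whiskerLeft]
  rcases (le_of_hom T).eq_or_lt with h' | h'
  · obtain rfl : j = k := by obtain ⟨⟨j⟩⟩ := j; obtain ⟨⟨k⟩⟩ := k; dsimp only at h'; rw [h']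
    obtain rfl := eq_id T
    obtain rfl := eq_id T'
    obtain rfl : η = 𝟙 _ := Subsingleton.elim _ _
    have (j : Orient.{u} 3) : D.mapHom₂ (𝟙 (𝟙 j)) = 𝟙 _ := D.map₂_id _ _ _ _ _ _ _
    have h₂ : D.mapHom₂ (𝟙 (S ≫ 𝟙 j)) = 𝟙 _ := D.map₂_id _ _ _ _ _ _ _
    rw [whiskerLeft_id, h₂, this, whiskerLeft_id, mapHom_comp]
  refine Eq.trans ?_ (D.map₂_left _ _ _ h h' _ _ _ _ _ _ (flagCond S) (flagCond T) (flagCond T')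
    (flag_mono 1 η) (flag_mono 2 η) ?_ ?_)
  · exact D.map₂_heq (flag_comp _ _ _) (flag_comp _ _ _) (flag_comp _ _ _) (flag_comp _ _ _)
  · rw [← flag_comp, ← flag_comp]; exact flag_mono 1 (S ◁ η)
  · rw [← flag_comp, ← flag_comp]; exact flag_mono 2 (S ◁ η)

theorem mapHom₂_right {i j k : Orient.{u} 3} {S S' : i ⟶ j} (η : S ⟶ S') (T : j ⟶ k) :
    Cell.mk (D.mapHom₂ (η ▷ T)) = .mk (D.mapHom₂ η ▷ D.mapHom T) := by
  rcases (le_of_hom T).eq_or_lt with h' | h'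
  · obtain rfl : j = k := by obtain ⟨⟨j⟩⟩ := j; obtain ⟨⟨k⟩⟩ := k; dsimp only at h'; rw [h']
    rw [eq_id T, D.mapHom₂_congr (Cell.mk_whiskerRight_id η), mapHom_id, Cell.mk_whiskerRight_id]
  rcases (le_of_hom S).eq_or_lt with h | h
  · obtain rfl : i = j := by obtain ⟨⟨i⟩⟩ := i; obtain ⟨⟨j⟩⟩ := j; dsimp only at h; rw [h]
    obtain rfl := eq_id S
    obtain rfl := eq_id S'
    obtain rfl : η = 𝟙 _ := Subsingleton.elim _ _
    have (j : Orient.{u} 3) : D.mapHom₂ (𝟙 (𝟙 j)) = 𝟙 _ := D.map₂_id _ _ _ _ _ _ _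
    have h₂ : D.mapHom₂ (𝟙 (𝟙 i ≫ T)) = 𝟙 _ := D.map₂_id _ _ _ _ _ _ _
    rw [id_whiskerRight, h₂, this, id_whiskerRight, mapHom_comp]
  refine Eq.trans ?_ (D.map₂_right _ _ _ h h' _ _ _ _ _ _ (flagCond S) (flagCond S') (flagCond T)
    (flag_mono 1 η) (flag_mono 2 η) ?_ ?_)
  · exact D.map₂_heq (flag_comp _ _ _) (flag_comp _ _ _) (flag_comp _ _ _) (flag_comp _ _ _)
  · rw [← flag_comp, ← flag_comp]; exact flag_mono 1 (η ▷ T)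
  · rw [← flag_comp, ← flag_comp]; exact flag_mono 2 (η ▷ T)

/-- The 2-functor `𝒪₂[3] ⟶ C` given by a tetrahedron. -/
noncomputable def functor : oriental.{u}.obj ⟨3⟩ ⟶ C :=
  StrictPseudofunctor.mk'' (B := Orient.{u} 3)
    { obj i := D.obj i.as.as.down
      map := D.mapHom
      map₂ := D.mapHom₂
      map₂_id _ := D.map₂_id _ _ _ _ _ _ _
      map₂_comp _ _ := D.map₂_comp _ _ _ _ _ _ _ _ _ _ _ _ _
      map_id := D.mapHom_id
      map_comp := D.mapHom_comp
      map₂_whisker_left f _ _ η := Cell.mk_inj <| by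
        rw [Cell.mk_eqToHom_comp, Cell.mk_comp_eqToHom, mapHom₂_left]
      map₂_whisker_right η f := Cell.mk_inj <| by
        rw [Cell.mk_eqToHom_comp, Cell.mk_comp_eqToHom, mapHom₂_right] }

end Tetrahedron

/-! ### The underlying category of an oriental is free -/

namespace Oriental

/-- The elements of a linear order, as the vertices of the quiver with one arrow `i ⟶ j` for
each `i < j`. -/
structure Vertex (J : Type u) : Type u where
  as : J

instance {J : Type u} [LinearOrder J] : Quiver.{u} (Vertex J) where
  Hom i j := ULift.{u} (PLift (i.as < j.as))

section Free

variable {J : Type u} [LinearOrder J] {P : LocalPreorder (SimplicialThickening J)}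

/-- The 1-morphism that passes through the vertices of a path of strict inequalities. -/
def chain (P : LocalPreorder (SimplicialThickening J)) {i : Vertex J} :
    ∀ {j : Vertex J}, Quiver.Path i j → ((⟨⟨i.as⟩⟩ : LocallyThin P) ⟶ ⟨⟨j.as⟩⟩)
  | _, .nil => 𝟙 _
  | _, .cons p e => chain P p ≫ edge e.down.down.le

theorem chain_comp {i j k : Vertex J} (p : Quiver.Path i j) (q : Quiver.Path j k) :
    chain P (p.comp q) = chain P p ≫ chain P q := by
  induction q with
  | nil => exact (Strict.comp_id _).symm
  | cons q e ih =>
    rw [Quiver.Path.comp_cons, chain, chain, ih, Strict.assoc]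

theorem mem_chain_cons {i j k : Vertex J} (p : Quiver.Path i j) (e : j ⟶ k) (l : J) :
    l ∈ verts (chain P (p.cons e)) ↔ l ∈ verts (chain P p) ∨ l = k.as := by
  rw [chain, verts_comp, verts_edge]
  constructor
  · rintro (h | rfl | rfl)
    exacts [.inl h, .inl (right_mem (chain P p)), .inr rfl]
  · rintro (h | rfl)
    exacts [.inl h, .inr (.inr rfl)]

theorem chain_injective {i j : Vertex J} (p q : Quiver.Path i j)
    (h : verts (chain P p) = verts (chain P q)) : p = q := by
  induction p with
  | nil =>
    cases q with
    | nil => rfl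
    | cons q e => exact absurd (le_of_hom (chain P q)) (not_le.2 e.down.down)
  | @cons k l p e ih =>
    cases q with
    | nil => exact absurd (le_of_hom (chain P p)) (not_le.2 e.down.down)
    | @cons k' _ q e' =>
      -- the last vertex but one is the largest element different from the last one
      have h₁ : ∀ m : J, m < l.as → (m ∈ verts (chain P p) ↔ m ∈ verts (chain P q)) := by
        intro m hm
        have := Set.ext_iff.1 h m
        rw [mem_chain_cons, mem_chain_cons] at this
        simpa only [hm.ne, or_false] using this
      have h₂ : k.as = k'.as := le_antisymm
        (ge_of_mem ((h₁ _ e.down.down).1 (right_mem (chain P p))))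
        (ge_of_mem ((h₁ _ e'.down.down).2 (right_mem (chain P q))))
      obtain ⟨k⟩ := k
      obtain ⟨k'⟩ := k'
      dsimp only at h₂
      subst h₂
      have h₃ : p = q := ih q <| by
        ext m
        refine ⟨fun hm => ?_, fun hm => ?_⟩
        · exact (h₁ m ((ge_of_mem hm).trans_lt e.down.down)).1 hm
        · exact (h₁ m ((ge_of_mem hm).trans_lt e'.down.down)).2 hm
      obtain ⟨⟨e⟩⟩ := e
      obtain ⟨⟨e'⟩⟩ := e'
      rw [h₃]

/-- The part of a 1-morphism up to one of its vertices. -/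
def upTo {i j : LocallyThin P} (S : i ⟶ j) (k : J) (h : k ∈ verts S) : i ⟶ ⟨⟨k⟩⟩ :=
  SimplicialThickening.Path.mk {l ∈ verts S | l ≤ k} ⟨left_mem S, le_of_mem h⟩ ⟨h, le_rfl⟩
    (fun _ hl => le_of_mem hl.1) (fun _ hl => hl.2)

/-- The part of a 1-morphism from one of its vertices on. -/
def upFrom {i j : LocallyThin P} (S : i ⟶ j) (k : J) (h : k ∈ verts S) :
    (⟨⟨k⟩⟩ : LocallyThin P) ⟶ j :=
  SimplicialThickening.Path.mk {l ∈ verts S | k ≤ l} ⟨h, le_rfl⟩ ⟨right_mem S, ge_of_mem h⟩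
    (fun _ hl => hl.2) (fun _ hl => ge_of_mem hl.1)

theorem upTo_comp_upFrom {i j : LocallyThin P} (S : i ⟶ j) (k : J) (h : k ∈ verts S) :
    upTo S k h ≫ upFrom S k h = S := by
  apply hom_ext
  ext l
  constructor
  · rintro (hl | hl)
    exacts [hl.1, hl.1]
  · intro hl
    rcases le_total l k with h' | h'
    exacts [.inl ⟨hl, h'⟩, .inr ⟨hl, h'⟩]

theorem exists_chain [Finite J] {i j : LocallyThin P} (S : i ⟶ j) :
    ∃ p : Quiver.Path (⟨i.as.as⟩ : Vertex J) ⟨j.as.as⟩, chain P p = S := by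
  obtain ⟨⟨j⟩⟩ := j
  induction j using WellFoundedLT.induction with
  | _ j ih =>
    rcases (le_of_hom S).eq_or_lt with h | h
    · obtain ⟨⟨i⟩⟩ := i
      dsimp only at h
      subst h
      exact ⟨.nil, (eq_id S).symm⟩
    · obtain ⟨k, ⟨hk, hkj⟩, hmax⟩ := (Set.toFinite {l ∈ verts S | l < j}).exists_maximal
        ⟨_, left_mem S, h⟩
      obtain ⟨p, hp⟩ := ih k hkj (upTo S k hk)
      refine ⟨p.cons ⟨⟨hkj⟩⟩, ?_⟩
      rw [chain, hp]
      refine Eq.trans (congrArg _ (hom_ext ?_)) (upTo_comp_upFrom S k hk)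
      rw [verts_edge]
      ext l
      constructor
      · rintro (rfl | rfl)
        exacts [⟨hk, le_rfl⟩, ⟨right_mem S, hkj.le⟩]
      · rintro ⟨hl, hl'⟩
        rcases (ge_of_mem hl).eq_or_lt with rfl | h'
        · exact .inr rfl
        · exact .inl ((hmax ⟨hl, h'⟩ hl').antisymm hl')

/-- Every 1-morphism is obtained from an identity by appending edges `k < j`. -/
theorem path_induction [Finite J] {i : LocallyThin P}
    {motive : ∀ {j : LocallyThin P}, (i ⟶ j) → Prop} (id : motive (𝟙 i))
    (comp : ∀ {k j : J} (S : i ⟶ ⟨⟨k⟩⟩) (h : k < j), motive S → motive (S ≫ edge h.le))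
    {j : LocallyThin P} (S : i ⟶ j) : motive S := by
  obtain ⟨p, rfl⟩ := exists_chain S
  obtain ⟨⟨j⟩⟩ := j
  dsimp only at p
  have key : ∀ {j : Vertex J} (p : Quiver.Path (⟨i.as.as⟩ : Vertex J) j), motive (chain P p) := by
    intro j p
    induction p with
    | nil => exact id
    | cons p e ih => exact comp _ e.down.down ih
  exact key p

/-- The composite of a family of 1-morphisms along a path. -/
def compositeAlong {K : Type u₁} [Bicategory.{w₁, v₁} K] {obj : J → K}
    (e : ∀ {i j : J}, i < j → (obj i ⟶ obj j)) {i : Vertex J} :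
    ∀ {j : Vertex J}, Quiver.Path i j → (obj i.as ⟶ obj j.as)
  | _, .nil => 𝟙 _
  | _, .cons p f => compositeAlong e p ≫ e f.down.down

theorem compositeAlong_comp {K : Type u₁} [Bicategory.{w₁, v₁} K] [Strict K] {obj : J → K}
    (e : ∀ {i j : J}, i < j → (obj i ⟶ obj j)) {i j k : Vertex J} (p : Quiver.Path i j)
    (q : Quiver.Path j k) :
    compositeAlong e (p.comp q) = compositeAlong e p ≫ compositeAlong e q := by
  induction q with
  | nil => exact (Strict.comp_id _).symm
  | cons q f ih => exact (congrArg (· ≫ e f.down.down) ih).trans (Strict.assoc _ _ _)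

/-- The underlying category of an oriental is free on the edges `i < j`. -/
theorem exists_functor (P : LocalPreorder (SimplicialThickening J)) [Finite J] {K : Type u₁}
    [Bicategory.{w₁, v₁} K] [Strict K] (obj : J → K) (e : ∀ {i j : J}, i < j → (obj i ⟶ obj j)) :
    ∃ m : ∀ {i j : LocallyThin P}, (i ⟶ j) → (obj i.as.as ⟶ obj j.as.as),
      (∀ i, m (𝟙 i) = 𝟙 _) ∧
      (∀ {i j k : LocallyThin P} (S : i ⟶ j) (T : j ⟶ k), m (S ≫ T) = m S ≫ m T) ∧
      ∀ {i j : J} (h : i < j), m (edge h.le) = e h := by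
  choose p hp using fun {i j : LocallyThin P} (S : i ⟶ j) => exists_chain S
  have hp' : ∀ {i j : LocallyThin P} (S : i ⟶ j) (q : Quiver.Path (⟨i.as.as⟩ : Vertex J) ⟨j.as.as⟩),
      chain P q = S → p S = q :=
    fun S q hq => chain_injective _ _ (congrArg verts ((hp S).trans hq.symm))
  refine ⟨fun S => compositeAlong e (p S), fun i => ?_, fun {i j k} S T => ?_, fun {i j} h => ?_⟩
  · exact congrArg (compositeAlong e) (hp' _ .nil rfl)
  · exact (congrArg (compositeAlong e) (hp' (S ≫ T) ((p S).comp (p T))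
      (by rw [chain_comp, hp, hp]))).trans (compositeAlong_comp e _ _)
  · exact (congrArg (compositeAlong e) (hp' (edge h.le) (.cons .nil ⟨⟨h⟩⟩)
      (Strict.id_comp _))).trans (Strict.id_comp _)

end Free

section Ext

variable {J : Type u} [LinearOrder J] [Finite J] {B : Type u₁} [Bicategory.{w₁, v₁} B]

/-- Strict 2-functors on a locally thin 2-category with the 1-morphisms of an oriental agree on
1-morphisms if they agree on edges. -/
theorem one_map_eq {P : LocalPreorder (SimplicialThickening J)}
    {F G : StrictPseudofunctor (LocallyThin P) B}
    (h : ∀ {i j : J} (hij : i ≤ j), Cell.one (F.map (edge hij)) = .one (G.map (edge hij)))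
    {i j : LocallyThin P} (S : i ⟶ j) : Cell.one (F.map S) = .one (G.map S) := by
  induction S using path_induction with
  | id => rw [← edge_self]; exact h le_rfl
  | comp S hkj ih =>
    rw [StrictCell.one_map_comp, StrictCell.one_map_comp]
    exact Cell.one_comp_congr ih (h hkj.le)

/-- A strict 2-functor on an oriental is determined by its values on the edges and on the
2-morphisms `{i, k} ⟶ {i, j, k}`. -/
theorem functor_ext {F G : StrictPseudofunctor (LocallyThin (inclusion J)) B}
    (h : ∀ {i j : J} (hij : i ≤ j), Cell.one (F.map (edge hij)) = .one (G.map (edge hij)))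
    (h₂ : ∀ {i j k : J} (hij : i < j) (hjk : j < k),
      Cell.mk (F.map₂ (face hij.le hjk.le)) = .mk (G.map₂ (face hij.le hjk.le)))
    {a b : LocallyThin (inclusion J)} {S T : a ⟶ b} (η : S ⟶ T) :
    Cell.mk (F.map₂ η) = .mk (G.map₂ η) := by
  have hrefl {i j : LocallyThin (inclusion J)} {S T : i ⟶ j} (e : S = T) (η : S ⟶ T) :
      Cell.mk (F.map₂ η) = .mk (G.map₂ η) := by
    subst e
    obtain rfl : η = 𝟙 _ := Subsingleton.elim _ _
    rw [StrictCell.map_one, StrictCell.map_one]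
    exact one_map_eq h S
  -- the 2-morphisms whose source is an edge
  have key {i j : LocallyThin (inclusion J)} (T : i ⟶ j) (η : edge (le_of_hom T) ⟶ T) :
      Cell.mk (F.map₂ η) = .mk (G.map₂ η) := by
    induction T using path_induction with
    | id => exact hrefl (edge_self _) η
    | @comp k j T hkj ih =>
      rcases (le_of_hom T).eq_or_lt with hik | hik
      · obtain ⟨⟨i⟩⟩ := i
        dsimp only at hik
        subst hik
        refine hrefl ?_ η
        rw [eq_id T, Strict.id_comp]
      · have e : η = face hik.le hkj.le ≫ homOfSubset (T := T) (by
            rintro x (rfl | rfl)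
            exacts [left_mem T, right_mem T]) ▷ edge hkj.le := Subsingleton.elim _ _
        rw [e, F.map₂_comp, G.map₂_comp]
        refine Cell.comp_congr (h₂ hik hkj) ?_
        rw [StrictCell.mk_map_whiskerRight, StrictCell.mk_map_whiskerRight]
        exact Cell.whiskerRight_congr (ih _) (h hkj.le)
  -- a general 2-morphism is split at the vertices of its source
  induction S using path_induction with
  | id => exact hrefl (eq_id T).symm η
  | @comp k j S hkj ih =>
    have hk : k ∈ verts T := subset_of_hom η (.inl (right_mem S))
    let η₁ : S ⟶ upTo T k hk := homOfSubset fun x hx =>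
      ⟨subset_of_hom η (.inl hx), ge_of_mem hx⟩
    let η₂ : edge hkj.le ⟶ upFrom T k hk := homOfSubset (by
      rintro x (rfl | rfl)
      exacts [⟨hk, le_rfl⟩, ⟨right_mem T, hkj.le⟩])
    have e : η = η₁ ▷ edge hkj.le ≫ upTo T k hk ◁ η₂ ≫ eqToHom (upTo_comp_upFrom T k hk) :=
      Subsingleton.elim _ _
    rw [e, F.map₂_comp, G.map₂_comp, F.map₂_comp, G.map₂_comp]
    refine Cell.comp_congr ?_ (Cell.comp_congr ?_ (hrefl (upTo_comp_upFrom T k hk) _))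
    · rw [StrictCell.mk_map_whiskerRight, StrictCell.mk_map_whiskerRight]
      exact Cell.whiskerRight_congr (ih _) (h hkj.le)
    · rw [StrictCell.mk_map_whiskerLeft, StrictCell.mk_map_whiskerLeft]
      exact Cell.whiskerLeft_congr (one_map_eq h _) (key _ _)

end Ext

end Oriental

/-! ### Low-dimensional simplices of the nerve -/

section

open Oriental

/-- The strict 2-functors `𝒪₂[m] ⟶ C`. -/
abbrev Simplex (C : TwoCat.{u}) (m : ℕ) : Type u := StrictPseudofunctor (Orient.{u} m) C

namespace Simplex

variable {C : TwoCat.{u}} {m n : ℕ}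

/-- A vertex of a simplex. -/
def vertex (x : Simplex C m) (i : Fin (m + 1)) : C := x.obj (⟨⟨⟨i⟩⟩⟩ : Orient.{u} m)

/-- An edge of a simplex. -/
def edge (x : Simplex C m) {i j : Fin (m + 1)} (h : i ≤ j) : x.vertex i ⟶ x.vertex j :=
  x.map (Oriental.edge (i := ULift.up.{u} i) (j := ULift.up.{u} j) h)

/-- The 2-morphism that fills a 2-dimensional face of a simplex. -/
def face (x : Simplex C m) {i j k : Fin (m + 1)} (h : i ≤ j) (h' : j ≤ k) :
    x.edge (h.trans h') ⟶ x.edge h ≫ x.edge h' :=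
  x.map₂ (Oriental.face (i := ULift.up.{u} i) (j := ULift.up.{u} j) (k := ULift.up.{u} k) h h') ≫
    eqToHom (x.map_comp _ _)

theorem mk_face (x : Simplex C m) {i j k : Fin (m + 1)} (h : i ≤ j) (h' : j ≤ k) :
    Cell.mk (x.face h h') =
      .mk (x.map₂ (Oriental.face (i := ULift.up.{u} i) (j := ULift.up.{u} j) (k := ULift.up.{u} k)
        h h')) :=
  Cell.mk_comp_eqToHom _ _

theorem edge_self (x : Simplex C m) {i : Fin (m + 1)} (h : i ≤ i) :
    x.edge h = 𝟙 (x.vertex i) :=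
  (congrArg x.map (Oriental.edge_self _)).trans (x.map_id _)

/-- The 2-functor between orientals induced by a monotone map. -/
def orientMap (φ : SimplexCategory.mk n ⟶ .mk m) :
    StrictPseudofunctor (Orient.{u} n) (Orient.{u} m) :=
  oriental.map φ

/-- The restriction of a simplex along a monotone map. -/
def pull (x : Simplex C m) (φ : SimplexCategory.mk n ⟶ .mk m) : Simplex C n :=
  StrictPseudofunctor.comp (orientMap φ) x

theorem one_edge_pull (x : Simplex C m) (φ : SimplexCategory.mk n ⟶ .mk m) {i j : Fin (n + 1)}
    (h : i ≤ j) : Cell.one ((x.pull φ).edge h) = .one (x.edge (φ.toOrderHom.monotone h)) := by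
  refine congrArg (fun S => Cell.one (x.map S)) (hom_ext ?_)
  exact Set.image_pair _ _ _

theorem mk_face_pull (x : Simplex C m) (φ : SimplexCategory.mk n ⟶ .mk m) {i j k : Fin (n + 1)}
    (h : i ≤ j) (h' : j ≤ k) : Cell.mk ((x.pull φ).face h h') =
      .mk (x.face (φ.toOrderHom.monotone h) (φ.toOrderHom.monotone h')) := by
  rw [mk_face, mk_face]
  refine StrictCell.map_congr x (LocallyThin.cell_ext (Cell.one_congr (hom_ext ?_))
    (Cell.one_congr (hom_ext ?_)))
  · exact Set.image_pair _ _ _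
  · refine (Set.image_union _ _ _).trans ?_
    exact congrArg₂ _ (Set.image_pair _ _ _) (Set.image_pair _ _ _)

theorem ext {x y : Simplex C m} (h₀ : ∀ i, x.vertex i = y.vertex i)
    (h₁ : ∀ {i j : Fin (m + 1)} (h : i < j), Cell.one (x.edge h.le) = .one (y.edge h.le))
    (h₂ : ∀ {i j k : Fin (m + 1)} (h : i < j) (h' : j < k),
      Cell.mk (x.face h.le h'.le) = .mk (y.face h.le h'.le)) : x = y := by
  refine TwoCat.functor_ext_cell fun η => Oriental.functor_ext ?_ ?_ η
  · rintro ⟨i⟩ ⟨j⟩ h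
    rcases (show i ≤ j from h).eq_or_lt with rfl | h'
    · rw [Oriental.edge_self, StrictCell.one_map_id, StrictCell.one_map_id]
      exact Cell.zero_congr (h₀ i)
    · exact h₁ h'
  · rintro ⟨i⟩ ⟨j⟩ ⟨k⟩ h h'
    rw [← mk_face, ← mk_face]
    exact h₂ h h'

/-- The 1-morphism of a 1-simplex. -/
abbrev arrow (x : Simplex C 1) : x.vertex 0 ⟶ x.vertex 1 := x.edge (by decide)

/-- The first edge of a 2-simplex. -/
abbrev e₀₁ (x : Simplex C 2) : x.vertex 0 ⟶ x.vertex 1 := x.edge (by decide)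

/-- The second edge of a 2-simplex. -/
abbrev e₁₂ (x : Simplex C 2) : x.vertex 1 ⟶ x.vertex 2 := x.edge (by decide)

/-- The long edge of a 2-simplex. -/
abbrev e₀₂ (x : Simplex C 2) : x.vertex 0 ⟶ x.vertex 2 := x.edge (by decide)

/-- The 2-morphism of a 2-simplex. -/
abbrev filler (x : Simplex C 2) : x.e₀₂ ⟶ x.e₀₁ ≫ x.e₁₂ := x.face (by decide) (by decide)

theorem ext₀ {x y : Simplex C 0} (h : x.vertex 0 = y.vertex 0) : x = y := by
  refine ext (fun i => ?_) (fun {i j} hij => ?_) (fun {i j k} hij _ => ?_)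
  · fin_cases i; exact h
  · fin_cases i; fin_cases j; exact absurd hij (by decide)
  · fin_cases i; fin_cases j; exact absurd hij (by decide)

theorem ext₁ {x y : Simplex C 1} (h : Cell.one x.arrow = .one y.arrow) : x = y := by
  refine ext (fun i => ?_) (fun {i j} hij => ?_) (fun {i j k} hij hjk => ?_)
  · fin_cases i
    exacts [Cell.src_eq h, Cell.tgt_eq h]
  · fin_cases i <;> fin_cases j <;> first
      | exact absurd hij (by decide)
      | exact h
  · fin_cases i <;> fin_cases j <;> first
      | exact absurd hij (by decide)
      | (fin_cases k <;> exact absurd hjk (by decide))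

theorem ext₂ {x y : Simplex C 2} (h₀₁ : Cell.one x.e₀₁ = .one y.e₀₁)
    (h₁₂ : Cell.one x.e₁₂ = .one y.e₁₂) (h : Cell.mk x.filler = .mk y.filler) : x = y := by
  refine ext (fun i => ?_) (fun {i j} hij => ?_) (fun {i j k} hij hjk => ?_)
  · fin_cases i
    exacts [Cell.src_eq h₀₁, Cell.tgt_eq h₀₁, Cell.tgt_eq h₁₂]
  · fin_cases i <;> fin_cases j <;> first
      | exact absurd hij (by decide)
      | exact h₀₁
      | exact h₁₂
      | exact Cell.dom_eq h
  · fin_cases i <;> fin_cases j <;> first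
      | exact absurd hij (by decide)
      | (fin_cases k <;> first
          | exact absurd hjk (by decide)
          | exact h)

/-- The 1-simplex given by a 1-morphism. -/
def ofHom {a b : C} (f : a ⟶ b) : Simplex C 1 := pickHom C f

/-- The 0-simplex given by an object. -/
def ofObj (a : C) : Simplex C 0 := pickObj C a

theorem edge_ofHom {a b : C} (f : a ⟶ b) : (ofHom f).arrow = f := rfl

theorem ofHom_id (a : C) : ofHom (𝟙 a) = (ofObj a).pull (SimplexCategory.σ 0) := by
  refine ext₁ ?_
  rw [one_edge_pull, edge_ofHom]
  rfl

end Simplex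

namespace Tetrahedron

variable {C : TwoCat.{u}} (D : Tetrahedron C)

/-- The 3-simplex given by a tetrahedron. -/
noncomputable def simplex : Simplex C 3 := D.functor

theorem flag_edge (k : Fin 4) {i j : Fin 4} (h : i ≤ j) :
    flag k (Oriental.edge (P := inclusion (ULift.{u} (Fin 4))) (i := ⟨i⟩) (j := ⟨j⟩) h) =
      decide (k = i ∨ k = j) := by
  unfold flag
  refine decide_eq_decide.2 ?_
  rw [verts_edge]
  simp [ULift.ext_iff]

theorem edge_eq {i j : Fin 4} (h : i ≤ j) (a b : Bool) (ha : decide (1 = i ∨ 1 = j) = a)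
    (hb : decide (2 = i ∨ 2 = j) = b) : D.simplex.edge h = D.map i j h a b := by
  subst ha hb
  exact congrArg₂ (D.map i j h) (flag_edge 1 h) (flag_edge 2 h)

theorem edge₀₁ : D.simplex.edge (i := 0) (j := 1) (by decide) = D.f₀₁ :=
  D.edge_eq _ true false rfl rfl
theorem edge₁₂ : D.simplex.edge (i := 1) (j := 2) (by decide) = D.f₁₂ :=
  D.edge_eq _ true true rfl rfl
theorem edge₂₃ : D.simplex.edge (i := 2) (j := 3) (by decide) = D.f₂₃ :=
  D.edge_eq _ false true rfl rfl
theorem edge₀₂ : D.simplex.edge (i := 0) (j := 2) (by decide) = D.f₀₂ :=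
  D.edge_eq _ false true rfl rfl
theorem edge₁₃ : D.simplex.edge (i := 1) (j := 3) (by decide) = D.f₁₃ :=
  D.edge_eq _ true false rfl rfl
theorem face_eq {i j k : Fin 4} (h : i ≤ j) (h' : j ≤ k) (a b a' b' : Bool)
    (ha : decide (1 = i ∨ 1 = k) = a) (hb : decide (2 = i ∨ 2 = k) = b)
    (ha' : (decide (1 = i ∨ 1 = j) || decide (1 = j ∨ 1 = k)) = a')
    (hb' : (decide (2 = i ∨ 2 = j) || decide (2 = j ∨ 2 = k)) = b') (haa : a ≤ a') (hbb : b ≤ b') :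
    Cell.mk (D.simplex.face h h') = .mk (D.map₂ i k (h.trans h') a b a' b' haa hbb) := by
  subst ha hb ha' hb'
  rw [Simplex.mk_face]
  refine D.map₂_heq (flag_edge _ _) (flag_edge _ _) ?_ ?_ <;>
  · refine (flag_comp _ _ _).trans ?_
    rw [flag_edge, flag_edge]

theorem face₀₁₂ : Cell.mk (D.simplex.face (i := 0) (j := 1) (k := 2) (by decide) (by decide)) =
    .mk D.t₀₁₂ := D.face_eq _ _ false true true true rfl rfl rfl rfl (by decide) (by decide)

theorem face₁₂₃ : Cell.mk (D.simplex.face (i := 1) (j := 2) (k := 3) (by decide) (by decide)) =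
    .mk D.t₁₂₃ := D.face_eq _ _ true false true true rfl rfl rfl rfl (by decide) (by decide)

theorem face₀₁₃ : Cell.mk (D.simplex.face (i := 0) (j := 1) (k := 3) (by decide) (by decide)) =
    .mk D.t₀₁₃ := D.face_eq _ _ false false true false rfl rfl rfl rfl (by decide) (by decide)

theorem face₀₂₃ : Cell.mk (D.simplex.face (i := 0) (j := 2) (k := 3) (by decide) (by decide)) =
    .mk D.t₀₂₃ := D.face_eq _ _ false false false true rfl rfl rfl rfl (by decide) (by decide)

end Tetrahedron

namespace Simplex

variable {C : TwoCat.{u}}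

/-- The faces of a simplex satisfy the cocycle condition. -/
theorem cocycle {m : ℕ} (x : Simplex C m) {i j k l : Fin (m + 1)} (h : i ≤ j) (h' : j ≤ k)
    (h'' : k ≤ l) : x.face h (h'.trans h'') ≫ x.edge h ◁ x.face h' h'' =
      x.face (h.trans h') h'' ≫ x.face h h' ▷ x.edge h'' ≫ (α_ _ _ _).hom := by
  apply Cell.mk_inj
  refine Eq.trans ?_ ((Cell.mk_comp_associator _ _ _ _).symm.trans
    (congrArg Cell.mk (Category.assoc _ _ _)))
  let e {i j : Fin (m + 1)} (h : i ≤ j) := Oriental.edge (P := inclusion (ULift.{u} (Fin (m + 1))))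
    (i := ⟨i⟩) (j := ⟨j⟩) h
  let t {i j k : Fin (m + 1)} (h : i ≤ j) (h' : j ≤ k) :=
    Oriental.face (i := ULift.up.{u} i) (j := ⟨j⟩) (k := ⟨k⟩) h h'
  have key : Cell.mk (t h (h'.trans h'') ≫ e h ◁ t h' h'') =
      .mk (t (h.trans h') h'' ≫ t h h' ▷ e h'') :=
    LocallyThin.cell_ext rfl (Cell.one_assoc _ _ _).symm
  replace key := StrictCell.map_congr x key
  rw [x.map₂_comp, x.map₂_comp] at key
  refine Eq.trans (Cell.comp_congr (mk_face _ _ _) ?_) (key.trans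
    (Cell.comp_congr (mk_face _ _ _) ?_).symm)
  · rw [StrictCell.mk_map_whiskerLeft]
    exact Cell.whiskerLeft_congr rfl (mk_face _ _ _)
  · rw [StrictCell.mk_map_whiskerRight]
    exact Cell.whiskerRight_congr (mk_face _ _ _) rfl

variable {a b c : C} {f : a ⟶ b} {g : b ⟶ c} {h : a ⟶ c}

/-- The 2-simplex given by a 2-morphism `t : h ⟶ f ≫ g`. -/
noncomputable def triangle (t : h ⟶ f ≫ g) : Simplex C 2 :=
  (Tetrahedron.simplex
    { t₀₁₂ := t, t₁₂₃ := (ρ_ g).inv, t₀₁₃ := t, t₀₂₃ := (ρ_ h).inv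
      cocycle := by simp }).pull (SimplexCategory.δ 3)

theorem one_edge₀₁_triangle (t : h ⟶ f ≫ g) :
    Cell.one (triangle t).e₀₁ = .one f :=
  (one_edge_pull _ _ _).trans (Cell.one_congr (Tetrahedron.edge₀₁ _))

theorem one_edge₁₂_triangle (t : h ⟶ f ≫ g) :
    Cell.one (triangle t).e₁₂ = .one g :=
  (one_edge_pull _ _ _).trans (Cell.one_congr (Tetrahedron.edge₁₂ _))

theorem one_edge₀₂_triangle (t : h ⟶ f ≫ g) :
    Cell.one (triangle t).e₀₂ = .one h :=
  (one_edge_pull _ _ _).trans (Cell.one_congr (Tetrahedron.edge₀₂ _))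

theorem mk_face_triangle (t : h ⟶ f ≫ g) :
    Cell.mk (triangle t).filler = .mk t :=
  (mk_face_pull _ _ _ _).trans (Tetrahedron.face₀₁₂ _)

theorem eq_triangle {x : Simplex C 2} {t : h ⟶ f ≫ g}
    (h₀₁ : Cell.one x.e₀₁ = .one f)
    (h₁₂ : Cell.one x.e₁₂ = .one g)
    (ht : Cell.mk x.filler = .mk t) :
    x = triangle t :=
  ext₂ (h₀₁.trans (one_edge₀₁_triangle t).symm) (h₁₂.trans (one_edge₁₂_triangle t).symm)
    (ht.trans (mk_face_triangle t).symm)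

theorem triangle_leftUnitor (f : a ⟶ b) :
    triangle (λ_ f).inv = (ofHom f).pull (SimplexCategory.σ 0) := by
  refine (eq_triangle ?_ ?_ ?_).symm
  · exact one_edge_pull _ _ _
  · exact one_edge_pull _ _ _
  · rw [mk_face_pull, mk_face, Strict.leftUnitor_eqToIso, eqToIso.inv, Cell.mk_eqToHom]
    rfl

theorem triangle_rightUnitor (f : a ⟶ b) :
    triangle (ρ_ f).inv = (ofHom f).pull (SimplexCategory.σ 1) := by
  refine (eq_triangle ?_ ?_ ?_).symm
  · exact one_edge_pull _ _ _
  · exact one_edge_pull _ _ _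
  · rw [mk_face_pull, mk_face, Strict.rightUnitor_eqToIso, eqToIso.inv, Cell.mk_eqToHom]
    rfl

end Simplex

namespace Tetrahedron

variable {C : TwoCat.{u}} (D : Tetrahedron C)

theorem pull₀₁₂ : D.simplex.pull (SimplexCategory.δ 3) = Simplex.triangle D.t₀₁₂ :=
  Simplex.eq_triangle ((Simplex.one_edge_pull _ _ _).trans (Cell.one_congr D.edge₀₁))
    ((Simplex.one_edge_pull _ _ _).trans (Cell.one_congr D.edge₁₂))
    ((Simplex.mk_face_pull _ _ _ _).trans D.face₀₁₂)

theorem pull₁₂₃ : D.simplex.pull (SimplexCategory.δ 0) = Simplex.triangle D.t₁₂₃ :=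
  Simplex.eq_triangle ((Simplex.one_edge_pull _ _ _).trans (Cell.one_congr D.edge₁₂))
    ((Simplex.one_edge_pull _ _ _).trans (Cell.one_congr D.edge₂₃))
    ((Simplex.mk_face_pull _ _ _ _).trans D.face₁₂₃)

theorem pull₀₁₃ : D.simplex.pull (SimplexCategory.δ 2) = Simplex.triangle D.t₀₁₃ :=
  Simplex.eq_triangle ((Simplex.one_edge_pull _ _ _).trans (Cell.one_congr D.edge₀₁))
    ((Simplex.one_edge_pull _ _ _).trans (Cell.one_congr D.edge₁₃))
    ((Simplex.mk_face_pull _ _ _ _).trans D.face₀₁₃)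

theorem pull₀₂₃ : D.simplex.pull (SimplexCategory.δ 1) = Simplex.triangle D.t₀₂₃ :=
  Simplex.eq_triangle ((Simplex.one_edge_pull _ _ _).trans (Cell.one_congr D.edge₀₂))
    ((Simplex.one_edge_pull _ _ _).trans (Cell.one_congr D.edge₂₃))
    ((Simplex.mk_face_pull _ _ _ _).trans D.face₀₂₃)

end Tetrahedron

end

section

open Oriental

/-! ### Triangles with an invertible 2-morphism -/

section

variable {C : TwoCat.{u}} {a b c : C} (f : a ⟶ b) (g : b ⟶ c)

/-- The vertices of a composable pair. -/
def composableObj {C : TwoCat.{u}} (a b c : C) : Fin 3 → C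
  | 0 => a
  | 1 => b
  | 2 => c

/-- The composites in a composable pair. -/
def composableMap : ∀ i j : Fin 3, i ≤ j → (composableObj a b c i ⟶ composableObj a b c j)
  | 0, 0, _ => 𝟙 a
  | 1, 1, _ => 𝟙 b
  | 2, 2, _ => 𝟙 c
  | 0, 1, _ => f
  | 1, 2, _ => g
  | 0, 2, _ => f ≫ g

/-- The 2-functor `𝕆₂[2] ⟶ C` whose 2-morphisms are the identities of a composable pair. -/
def markedTriangle : invOriental.{u} ⟶ C :=
  StrictPseudofunctor.mk''
    (B := LocallyThin (indiscrete (SimplicialThickening (ULift.{u} (Fin 3)))))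
    { obj i := composableObj a b c i.as.as.down
      map {i j} S := composableMap f g i.as.as.down j.as.as.down (Oriental.le_of_hom S)
      map₂ _ := 𝟙 _
      map_id := by
        rintro ⟨⟨⟨i⟩⟩⟩
        fin_cases i <;> rfl
      map_comp := by
        rintro ⟨⟨⟨i⟩⟩⟩ ⟨⟨⟨j⟩⟩⟩ ⟨⟨⟨k⟩⟩⟩ S T
        have h : i ≤ j := Oriental.le_of_hom S
        have h' : j ≤ k := Oriental.le_of_hom T
        fin_cases i <;> fin_cases j <;> first
          | exact absurd h (by decide)
          | (fin_cases k <;> first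
              | exact absurd h' (by decide)
              | exact (Category.id_comp _).symm
              | exact (Category.comp_id _).symm
              | exact rfl) }

theorem orientalToInv_markedTriangle :
    orientalToInv.{u} ≫ markedTriangle f g = Simplex.triangle (𝟙 (f ≫ g)) :=
  Simplex.eq_triangle rfl rfl ((Simplex.mk_face _ _ _).trans rfl)

end

theorem Oriental.subset_total {P : LocalPreorder (SimplicialThickening (ULift.{u} (Fin 3)))}
    {i j : LocallyThin P} (S T : i ⟶ j) : verts S ⊆ verts T ∨ verts T ⊆ verts S := by
  have key (S T : i ⟶ j) (h : ⟨1⟩ ∈ verts S → ⟨1⟩ ∈ verts T) : verts S ⊆ verts T := by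
    intro x hx
    rcases (le_of_mem hx).eq_or_lt with rfl | h₁
    · exact left_mem T
    rcases (ge_of_mem hx).eq_or_lt with rfl | h₂
    · exact right_mem T
    obtain ⟨⟨⟨i⟩⟩⟩ := i
    obtain ⟨⟨⟨j⟩⟩⟩ := j
    obtain ⟨x⟩ := x
    obtain rfl : x = 1 := by
      have h₁ : i < x := h₁
      have h₂ : x < j := h₂
      ext
      have := j.2
      simp only [Fin.lt_def] at h₁ h₂
      change x.1 = 1
      omega
    exact h hx
  by_cases h : ⟨1⟩ ∈ verts S
  · exact .inr (key T S fun _ => h)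
  · exact .inl (key S T fun h' => absurd h' h)

/-- The inclusion `𝒪₂[2] ⟶ 𝕆₂[2]` is an epimorphism: the new 2-morphisms are inverses. -/
theorem invOriental_ext {B : TwoCat.{u}} {F G : invOriental.{u} ⟶ B}
    (h : orientalToInv ≫ F = orientalToInv ≫ G) : F = G := by
  let I := LocallyThin (indiscrete (SimplicialThickening (ULift.{u} (Fin 3))))
  let F' : StrictPseudofunctor I B := F
  let G' : StrictPseudofunctor I B := G
  change F' = G'
  have h₁ {i j : Orient.{u} 2} {S T : i ⟶ j} (η : S ⟶ T) :
      Cell.mk (F'.map₂ ((LocallyThin.map (Q := indiscrete _) (𝟭 _)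
        (fun _ => trivial)).map₂ η)) = .mk (G'.map₂ ((LocallyThin.map (𝟭 _)
        (fun _ => trivial)).map₂ η)) :=
    congrArg (fun K : StrictPseudofunctor (Orient.{u} 2) B => Cell.mk (K.map₂ η)) h
  have h₂ {i j : I} {S T : i ⟶ j} (e : verts S ⊆ verts T) (η : S ⟶ T) :
      Cell.mk (F'.map₂ η) = .mk (G'.map₂ η) :=
    h₁ (i := ⟨i.as⟩) (j := ⟨j.as⟩) (homOfSubset e)
  refine TwoCat.functor_ext_cell fun {i j S T} η => ?_
  rcases subset_total S T with e | e
  · exact h₂ e η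
  · let θ : T ≅ S := ⟨LocallyThin.homMk trivial, η, Subsingleton.elim _ _, Subsingleton.elim _ _⟩
    exact Cell.inv_congr (η := F'.map₂Iso θ) (η' := G'.map₂Iso θ) (h₂ e θ.hom)

namespace Simplex

variable {C B : TwoCat.{u}} {l m n : ℕ}

theorem oriental_map_id_comp (x : oriental.{u}.obj (.mk m) ⟶ C) : oriental.map (𝟙 _) ≫ x = x := by
  rw [oriental.map_id, Category.id_comp]

theorem oriental_map_comp_comp (x : oriental.{u}.obj (.mk m) ⟶ C) (φ : SimplexCategory.mk l ⟶ .mk n)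
    (ψ : SimplexCategory.mk n ⟶ .mk m) :
    oriental.map (φ ≫ ψ) ≫ x = oriental.map φ ≫ oriental.map ψ ≫ x := by
  rw [oriental.map_comp, Category.assoc]

theorem pull_id (x : Simplex C m) : x.pull (𝟙 _) = x := oriental_map_id_comp x

theorem pull_comp (x : Simplex C m) (φ : SimplexCategory.mk l ⟶ .mk n)
    (ψ : SimplexCategory.mk n ⟶ .mk m) : x.pull (φ ≫ ψ) = (x.pull ψ).pull φ :=
  oriental_map_comp_comp x φ ψ

end Simplex

/-! ### Maps between natural nerves -/

namespace NaturalNerve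

open MarkedSimplex Opposite

/-- An object of `tΔ`. -/
def tObj (k : MarkedSimplex) : tDelta := (CategoryTheory.Quotient.functor MarkedSimplex.Rel).obj k

/-- A generating morphism of `tΔ`. -/
def tGen {k l : MarkedSimplex} (f : Gen k l) : tObj k ⟶ tObj l :=
  (CategoryTheory.Quotient.functor MarkedSimplex.Rel).map (MarkedSimplex.of f)

theorem coNatural_tGen {k l : MarkedSimplex} (f : Gen k l) :
    coNatural.{u}.map (tGen f) = genMap f := pathMap_of f

variable {B C D : TwoCat.{u}}

/-- The action of a map between nerves on simplices and marked simplices. -/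
def act (u : naturalNerve.obj C ⟶ naturalNerve.obj B) (k : MarkedSimplex) (x : obj k ⟶ C) :
    obj k ⟶ B :=
  ConcreteCategory.hom (u.app (op (tObj k))) x

theorem act_genMap (u : naturalNerve.obj C ⟶ naturalNerve.obj B) {k l : MarkedSimplex}
    (f : Gen k l) (x : obj l ⟶ C) : act u k (genMap f ≫ x) = genMap f ≫ act u l x := by
  have := ConcreteCategory.congr_hom (u.naturality (tGen f).op) x
  rw [← coNatural_tGen]
  exact this

theorem act_ext {u v : naturalNerve.obj C ⟶ naturalNerve.obj B}
    (h : ∀ (k : MarkedSimplex) (x : obj k ⟶ C), act u k x = act v k x) : u = v := by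
  ext ⟨⟨k⟩⟩ x
  exact h k x

theorem natural_pathMap {t : ∀ k : MarkedSimplex, (obj k ⟶ C) → (obj k ⟶ B)}
    (h : ∀ {k l : MarkedSimplex} (f : Gen k l) (x : obj l ⟶ C),
      t k (genMap f ≫ x) = genMap f ≫ t l x) {k l : MarkedSimplex} (p : Quiver.Path k l) :
    ∀ x : obj l ⟶ C, t k (pathMap.map p ≫ x) = pathMap.map p ≫ t l x := by
  induction p with
  | nil =>
    intro x
    have e : pathMap.{u}.map (Quiver.Path.nil : Quiver.Path k k) = 𝟙 (obj k) := pathMap.map_id _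
    exact (congrArg (t k) ((congrArg (· ≫ x) e).trans (Category.id_comp x))).trans
      ((congrArg (· ≫ t k x) e).trans (Category.id_comp _)).symm
  | cons p f ih =>
    intro x
    have e : pathMap.{u}.map (p.cons f) = pathMap.map p ≫ genMap f := rfl
    refine (congrArg (t k) ((congrArg (· ≫ x) e).trans (Category.assoc _ _ x))).trans
      (Eq.trans ?_ ((congrArg (· ≫ t _ x) e).trans (Category.assoc _ _ _)).symm)
    exact (ih _).trans (congrArg (pathMap.map p ≫ ·) (h f x))

/-- A map between nerves, from its compatible actions on simplices and marked simplices. -/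
def ofAct (t : ∀ k : MarkedSimplex, (obj k ⟶ C) → (obj k ⟶ B))
    (h : ∀ {k l : MarkedSimplex} (f : Gen k l) (x : obj l ⟶ C),
      t k (genMap f ≫ x) = genMap f ≫ t l x) :
    naturalNerve.obj C ⟶ naturalNerve.obj B where
  app k := ↾(t k.unop.as)
  naturality {l k} f := by
    obtain ⟨p, hp⟩ := (CategoryTheory.Quotient.functor MarkedSimplex.Rel).map_surjective
      (X := k.unop.as) (Y := l.unop.as) f.unop
    obtain rfl : ((CategoryTheory.Quotient.functor MarkedSimplex.Rel).map p).op = f :=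
      congrArg Quiver.Hom.op hp
    ext x
    exact natural_pathMap h p x

/-- The action of a map between nerves on simplices. -/
def simplexAct (u : naturalNerve.obj C ⟶ naturalNerve.obj B) {m : ℕ} (x : Simplex C m) :
    Simplex B m :=
  act u (simplex m) x

theorem simplexAct_pull (u : naturalNerve.obj C ⟶ naturalNerve.obj B) {m n : ℕ}
    (φ : SimplexCategory.mk n ⟶ .mk m) (x : Simplex C m) :
    simplexAct u (x.pull φ) = (simplexAct u x).pull φ := by
  let W : MorphismProperty SimplexCategory := fun a b φ =>
    ∀ x : Simplex C b.len, simplexAct u (x.pull (n := a.len) φ) = (simplexAct u x).pull φ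
  have : W.IsMultiplicative :=
    { id_mem a x := by
        refine (congrArg (simplexAct u) x.pull_id).trans (Simplex.pull_id _).symm
      comp_mem {a b c} φ ψ hφ hψ x := by
        refine (congrArg (simplexAct u) (x.pull_comp φ ψ)).trans ?_
        rw [hφ, hψ]
        exact (Simplex.pull_comp _ φ ψ).symm }
  have hW : W = ⊤ := SimplexCategory.morphismProperty_eq_top W
    (fun i x => act_genMap u (.δ i) x) (fun i x => act_genMap u (.σ i) x)
  exact (hW ▸ MorphismProperty.top_apply φ : W φ) x

theorem act_inv (u : naturalNerve.obj C ⟶ naturalNerve.obj B) (y : invOriental ⟶ C) :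
    orientalToInv ≫ act u (marked 1) y = simplexAct u (orientalToInv ≫ y) :=
  (act_genMap u (.φ 1) y).symm

theorem act_adjEquiv (u : naturalNerve.obj C ⟶ naturalNerve.obj B) (e : freeAdjEquiv ⟶ C) :
    pickHom freeAdjEquiv FreeAdjEquiv.homF ≫ act u (marked 0) e =
      simplexAct u (pickHom freeAdjEquiv FreeAdjEquiv.homF ≫ e) :=
  (act_genMap u (.φ 0) e).symm

/-- Maps between natural nerves agree if they agree on simplices and on adjoint equivalences. -/
theorem hom_ext {u v : naturalNerve.obj C ⟶ naturalNerve.obj B}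
    (h : ∀ {m : ℕ} (x : Simplex C m), simplexAct u x = simplexAct v x)
    (h' : ∀ e : freeAdjEquiv ⟶ C, act u (marked 0) e = act v (marked 0) e) : u = v := by
  refine act_ext fun k x => ?_
  match k with
  | simplex m => exact h x
  | marked 0 => exact h' x
  | marked 1 => exact invOriental_ext ((act_inv u x).trans ((h _).trans (act_inv v x).symm))
  | marked (m + 2) =>
    have key (u : naturalNerve.obj C ⟶ naturalNerve.obj B) :
        act u (marked (m + 2)) x = simplexAct u (m := m + 3) x :=
      (Category.id_comp _).symm.trans ((act_genMap u (.φ (m + 2)) x).symm.trans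
        (congrArg (act u (simplex (m + 3))) (Category.id_comp x)))
    rw [key, key]
    exact h (m := m + 3) x

/-- A map between nerves, from its action on simplices, on simplices with an invertible 2-morphism
and on adjoint equivalences. -/
def ofSimplexAct (s : ∀ {m : ℕ}, Simplex C m → Simplex B m)
    (tE : (freeAdjEquiv ⟶ C) → (freeAdjEquiv ⟶ B)) (tO : (invOriental ⟶ C) → (invOriental ⟶ B))
    (hs : ∀ {m n : ℕ} (φ : SimplexCategory.mk n ⟶ .mk m) (x : Simplex C m),
      s (x.pull φ) = (s x).pull φ)
    (hE : ∀ e, s (pickHom freeAdjEquiv FreeAdjEquiv.homF ≫ e : oriental.obj ⟨1⟩ ⟶ C) =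
      pickHom freeAdjEquiv FreeAdjEquiv.homF ≫ tE e)
    (hE' : ∀ x : Simplex C 0, tE (toPoint _ ≫ (x : oriental.obj ⟨0⟩ ⟶ C)) =
      toPoint _ ≫ (s x : oriental.obj ⟨0⟩ ⟶ B))
    (hO : ∀ x, s (orientalToInv ≫ x : oriental.obj ⟨2⟩ ⟶ C) = orientalToInv ≫ tO x) :
    naturalNerve.obj C ⟶ naturalNerve.obj B :=
  ofAct (fun
      | simplex _ => s
      | marked 0 => tE
      | marked 1 => tO
      | marked (m + 2) => s (m := m + 3)) fun {k l} f x => by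
    cases f with
    | δ i => exact hs (SimplexCategory.δ i) x
    | σ i => exact hs (SimplexCategory.σ i) x
    | φ m =>
      match m with
      | 0 => exact hE x
      | 1 => exact hO x
      | m + 2 =>
        let y : oriental.obj ⟨m + 3⟩ ⟶ B := s (m := m + 3) x
        have e : y = 𝟙 _ ≫ y := (Category.id_comp y).symm
        exact (congrArg (s (m := m + 3)) (Category.id_comp x)).trans e
    | @ζ m i =>
      match m with
      | 0 => exact hE' x
      | 1 =>
        refine invOriental_ext ((hO _).symm.trans ?_)
        have e {D : TwoCat.{u}} (y : oriental.obj ⟨1⟩ ⟶ D) :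
            orientalToInv.{u} ≫ invOrientalσ i ≫ y = oriental.map (SimplexCategory.σ i) ≫ y := by
          rw [← Category.assoc, orientalToInv_σ]
        refine (congrArg s (e x)).trans (Eq.trans ?_ (e (s x : oriental.obj ⟨1⟩ ⟶ B)).symm)
        exact hs (SimplexCategory.σ i) x
      | m + 2 => exact hs (SimplexCategory.σ i) x

end NaturalNerve

end

namespace Cell

variable {B : Type u} [Bicategory.{w, v} B]

theorem mk_comp_of_one {a b a' b' : B} {f g h : a ⟶ b} {k : a' ⟶ b'} (η : f ⟶ g) {θ : g ⟶ h}
    (e : mk θ = one k) : mk (η ≫ θ) = mk η := by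
  cases e
  rw [Category.comp_id]

theorem mk_one_comp {a b a' b' : B} {f g h : a ⟶ b} {k : a' ⟶ b'} {θ : f ⟶ g} (η : g ⟶ h)
    (e : mk θ = one k) : mk (θ ≫ η) = mk η := by
  cases e
  rw [Category.id_comp]

theorem whiskerRight_one {a b c a' b' : B} {f g : a ⟶ b} {k : a' ⟶ b'} {θ : f ⟶ g}
    (e : mk θ = one k) (h : b ⟶ c) : mk (θ ▷ h) = one (f ≫ h) := by
  cases e
  rw [id_whiskerRight]

theorem whiskerLeft_one {a b c a' b' : B} (h : a ⟶ b) {f g : b ⟶ c} {k : a' ⟶ b'} {θ : f ⟶ g}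
    (e : mk θ = one k) : mk (h ◁ θ) = one (h ≫ f) := by
  cases e
  rw [whiskerLeft_id]

end Cell

/-! ### Pseudofunctors from actions on triangles -/

/-- An assignment of 1-morphisms to 1-morphisms, and of 2-morphisms `J h ⟶ J f ≫ J g` to
2-morphisms `h ⟶ f ≫ g`, that is compatible with degenerate triangles and tetrahedra. It determines
a pseudofunctor that preserves identities strictly. -/
structure TriangleMap (C : Type u) [Bicategory.{w, v} C] (B : Type u₁) [Bicategory.{w₁, v₁} B] where
  obj : C → B
  map {a b : C} : (a ⟶ b) → (obj a ⟶ obj b)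
  map_id (a : C) : map (𝟙 a) = 𝟙 (obj a)
  tri {a b c : C} {f : a ⟶ b} {g : b ⟶ c} {h : a ⟶ c} : (h ⟶ f ≫ g) → (map h ⟶ map f ≫ map g)
  tri_leftUnitor {a b : C} (f : a ⟶ b) : Cell.mk (tri (λ_ f).inv) = .one (map f)
  tri_rightUnitor {a b : C} (f : a ⟶ b) : Cell.mk (tri (ρ_ f).inv) = .one (map f)
  cocycle (D : Tetrahedron C) : tri D.t₀₁₃ ≫ map D.f₀₁ ◁ tri D.t₁₂₃ =
    tri D.t₀₂₃ ≫ tri D.t₀₁₂ ▷ map D.f₂₃ ≫ (α_ _ _ _).hom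
  isIso_tri {a b c : C} (f : a ⟶ b) (g : b ⟶ c) : IsIso (tri (𝟙 (f ≫ g)))

namespace TriangleMap

variable {C : Type u} [Bicategory.{w, v} C] {B : Type u₁} [Bicategory.{w₁, v₁} B]
  (J : TriangleMap C B)

/-- The comparison isomorphism for composites. -/
noncomputable def mapComp {a b c : C} (f : a ⟶ b) (g : b ⟶ c) : J.map (f ≫ g) ≅ J.map f ≫ J.map g :=
  @asIso _ _ _ _ (J.tri (𝟙 (f ≫ g))) (J.isIso_tri f g)

theorem mapComp_hom {a b c : C} (f : a ⟶ b) (g : b ⟶ c) :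
    (J.mapComp f g).hom = J.tri (𝟙 (f ≫ g)) := rfl

variable [Strict B]

theorem map_id_comp {a b : C} (f : a ⟶ b) : J.map (𝟙 a) ≫ J.map f = J.map f := by
  rw [map_id, Strict.id_comp]

theorem mk_id_whiskerLeft {a : C} {X : B} {p q : J.obj a ⟶ X} (η : p ⟶ q) :
    Cell.mk (J.map (𝟙 a) ◁ η) = .mk η :=
  (Cell.whiskerLeft_congr (Cell.one_congr (J.map_id a)) rfl).trans (Cell.mk_id_whiskerLeft η)

/-- The action on 2-morphisms. -/
def map₂ {a b : C} {f g : a ⟶ b} (η : f ⟶ g) : J.map f ⟶ J.map g :=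
  J.tri (η ≫ (λ_ g).inv) ≫ eqToHom (J.map_id_comp g)

theorem mk_map₂ {a b : C} {f g : a ⟶ b} (η : f ⟶ g) :
    Cell.mk (J.map₂ η) = .mk (J.tri (η ≫ (λ_ g).inv)) :=
  Cell.mk_comp_eqToHom _ _

/-- The cocycle condition, up to the associator. -/
theorem mk_cocycle {x₀ x₁ x₂ x₃ : C} {f₀₁ : x₀ ⟶ x₁} {f₁₂ : x₁ ⟶ x₂} {f₂₃ : x₂ ⟶ x₃}
    {f₀₂ : x₀ ⟶ x₂} {f₁₃ : x₁ ⟶ x₃} {f₀₃ : x₀ ⟶ x₃} (t₀₁₂ : f₀₂ ⟶ f₀₁ ≫ f₁₂)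
    (t₁₂₃ : f₁₃ ⟶ f₁₂ ≫ f₂₃) (t₀₁₃ : f₀₃ ⟶ f₀₁ ≫ f₁₃) (t₀₂₃ : f₀₃ ⟶ f₀₂ ≫ f₂₃)
    (h : t₀₁₃ ≫ f₀₁ ◁ t₁₂₃ = t₀₂₃ ≫ t₀₁₂ ▷ f₂₃ ≫ (α_ f₀₁ f₁₂ f₂₃).hom) :
    Cell.mk (J.tri t₀₁₃ ≫ J.map f₀₁ ◁ J.tri t₁₂₃) =
      .mk (J.tri t₀₂₃ ≫ J.tri t₀₁₂ ▷ J.map f₂₃) := by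
  rw [J.cocycle ⟨t₀₁₂, t₁₂₃, t₀₁₃, t₀₂₃, h⟩]
  exact Cell.comp_congr rfl (Cell.mk_comp_associator _ _ _ _)

section

variable {a b c : C} {f f' : a ⟶ b} {g g' : b ⟶ c} {h h' : a ⟶ c}

theorem tri_comp (s : h ⟶ h') (t : h' ⟶ f ≫ g) : J.tri (s ≫ t) = J.map₂ s ≫ J.tri t := by
  have := J.mk_cocycle (λ_ f).inv t (s ≫ (λ_ h').inv) (s ≫ t) (by simp)
  apply Cell.mk_inj
  refine (Cell.mk_comp_of_one _ (Cell.whiskerRight_one (J.tri_leftUnitor f) _)).symm.trans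
    (this.symm.trans ?_)
  exact Cell.comp_congr (J.mk_map₂ s).symm (J.mk_id_whiskerLeft _)

theorem tri_whiskerLeft (t : h ⟶ f ≫ g) (β : g ⟶ g') :
    J.tri (t ≫ f ◁ β) = J.tri t ≫ J.map f ◁ J.map₂ β := by
  have := J.mk_cocycle (ρ_ f).inv (β ≫ (λ_ g').inv) t (t ≫ f ◁ β) (by simp)
  apply Cell.mk_inj
  refine (Cell.mk_comp_of_one _ (Cell.whiskerRight_one (J.tri_rightUnitor f) _)).symm.trans
    (this.symm.trans ?_)
  exact Cell.comp_congr rfl (Cell.whiskerLeft_congr rfl (J.mk_map₂ β).symm)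

theorem tri_whiskerRight (t : h ⟶ f ≫ g) (α : f ⟶ f') :
    J.tri (t ≫ α ▷ g) = J.tri t ≫ J.map₂ α ▷ J.map g := by
  have := J.mk_cocycle (α ≫ (λ_ f').inv) (𝟙 (f' ≫ g)) (t ≫ α ▷ g ≫ (λ_ _).inv) t (by simp)
  have e : J.tri (t ≫ α ▷ g) = J.map₂ (t ≫ α ▷ g) ≫ J.tri (𝟙 (f' ≫ g)) := by
    rw [← tri_comp, Category.comp_id]
  rw [e]
  apply Cell.mk_inj
  refine Eq.trans (Cell.comp_congr ?_ (J.mk_id_whiskerLeft _).symm) (this.trans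
    (Cell.comp_congr rfl (Cell.whiskerRight_congr (J.mk_map₂ α).symm rfl)))
  rw [mk_map₂, Category.assoc]

end

theorem map₂_id {a b : C} (f : a ⟶ b) : J.map₂ (𝟙 f) = 𝟙 (J.map f) := by
  apply Cell.mk_inj
  rw [mk_map₂, Category.id_comp, tri_leftUnitor]

theorem map₂_comp {a b : C} {f g h : a ⟶ b} (η : f ⟶ g) (θ : g ⟶ h) :
    J.map₂ (η ≫ θ) = J.map₂ η ≫ J.map₂ θ := by
  rw [map₂, Category.assoc, tri_comp, Category.assoc]; rfl

theorem tri_eq {a b c : C} {f : a ⟶ b} {g : b ⟶ c} {h : a ⟶ c} (t : h ⟶ f ≫ g) :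
    J.tri t = J.map₂ t ≫ (J.mapComp f g).hom := by
  rw [mapComp_hom, ← tri_comp, Category.comp_id]

/-- The pseudofunctor determined by an action on triangles. -/
noncomputable def pseudofunctor : C ⥤ᵖ B where
  obj := J.obj
  map := J.map
  map₂ := J.map₂
  map₂_id := J.map₂_id
  map₂_comp := J.map₂_comp
  mapId a := eqToIso (J.map_id a)
  mapComp := J.mapComp
  map₂_whisker_left f g h η := by
    rw [← Category.assoc, Iso.eq_comp_inv, ← tri_eq, mapComp_hom, ← tri_whiskerLeft,
      Category.id_comp]
  map₂_whisker_right η h := by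
    rw [← Category.assoc, Iso.eq_comp_inv, ← tri_eq, mapComp_hom, ← tri_whiskerRight,
      Category.id_comp]
  map₂_associator f g h := by
    have := J.cocycle
      { t₀₁₂ := 𝟙 (f ≫ g), t₁₂₃ := 𝟙 (g ≫ h), t₀₁₃ := (α_ f g h).hom, t₀₂₃ := 𝟙 ((f ≫ g) ≫ h)
        cocycle := by simp }
    dsimp only at this
    rw [tri_eq, ← mapComp_hom, ← mapComp_hom, ← mapComp_hom, Category.assoc] at this
    rw [← cancel_mono (J.mapComp f (g ≫ h)).hom, ← cancel_mono (J.map f ◁ (J.mapComp g h).hom),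
      Category.assoc, this]
    simp
  map₂_left_unitor {a b} f := by
    apply Cell.mk_inj
    rw [mk_map₂, Iso.hom_inv_id, ← mapComp_hom]
    refine (Cell.mk_comp_of_one _ (k := J.map f) ?_).symm
    refine (Cell.mk_one_comp _ (k := J.map (𝟙 a) ≫ J.map f)
      (Cell.whiskerRight_one (Cell.mk_eqToHom (J.map_id a)) _)).trans ?_
    rw [Strict.leftUnitor_eqToIso, eqToIso.hom, Cell.mk_eqToHom, Cell.one_id_comp]
  map₂_right_unitor {a b} f := by
    have : J.map₂ (ρ_ f).hom ≫ J.tri (ρ_ f).inv = (J.mapComp f (𝟙 b)).hom := by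
      rw [← tri_comp, Iso.hom_inv_id, mapComp_hom]
    apply Cell.mk_inj
    rw [← Cell.mk_comp_of_one _ (J.tri_rightUnitor f), this]
    refine (Cell.mk_comp_of_one _ (k := J.map f) ?_).symm
    refine (Cell.mk_one_comp _ (k := J.map f ≫ J.map (𝟙 b))
      (Cell.whiskerLeft_one _ (Cell.mk_eqToHom (J.map_id b)))).trans ?_
    rw [Strict.rightUnitor_eqToIso, eqToIso.hom, Cell.mk_eqToHom, Cell.one_comp_id]

end TriangleMap

section

open Oriental

theorem Cell.isIso_congr {B : Type u} [Bicategory.{w, v} B] {a b a' b' : B} {f g : a ⟶ b}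
    {f' g' : a' ⟶ b'} {η : f ⟶ g} {η' : f' ⟶ g'} (h : Cell.mk η = .mk η') [IsIso η'] :
    IsIso η := by
  cases h; assumption

namespace Simplex

variable {C : TwoCat.{u}} {m : ℕ}

theorem mk_face_of_dim_one (x : Simplex C 1) {i j k : Fin 2} (h : i ≤ j) (h' : j ≤ k) :
    Cell.mk (x.face h h') = .one (x.edge (h.trans h')) := by
  rw [mk_face]
  refine Eq.trans (StrictCell.map_congr x (LocallyThin.cell_ext rfl ?_)) (StrictCell.map_one x _)
  exact Cell.one_congr (path_eq le_rfl _ _)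

theorem isIso_filler (y : invOriental.{u} ⟶ C) :
    IsIso (filler (orientalToInv ≫ y : oriental.{u}.obj ⟨2⟩ ⟶ C)) := by
  let y' : StrictPseudofunctor (LocallyThin (indiscrete (SimplicialThickening (ULift.{u} (Fin 3)))))
    C := y
  let S (i j : Fin 3) (h : i ≤ j) := Oriental.edge
    (P := indiscrete (SimplicialThickening (ULift.{u} (Fin 3)))) (i := ULift.up.{u} i)
    (j := ULift.up.{u} j) h
  let θ : S 0 2 (by decide) ≅ S 0 1 (by decide) ≫ S 1 2 (by decide) :=
    ⟨LocallyThin.homMk trivial, LocallyThin.homMk trivial, Subsingleton.elim _ _,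
      Subsingleton.elim _ _⟩
  exact Cell.isIso_congr (η' := (y'.map₂Iso θ).hom) (mk_face _ _ _)

theorem pull_const (x : Simplex C m) (i : Fin (m + 1)) :
    x.pull (SimplexCategory.const (.mk 0) (.mk m) i) = ofObj (x.vertex i) :=
  ext₀ rfl

theorem pull_mkOfLe (x : Simplex C m) {i j : Fin (m + 1)} (h : i ≤ j) :
    x.pull (SimplexCategory.mkOfLe i j h) = ofHom (x.edge h) :=
  ext₁ (one_edge_pull _ _ _)

theorem pull_mkOfLeComp (x : Simplex C m) {i j k : Fin (m + 1)} (h : i ≤ j) (h' : j ≤ k) :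
    x.pull (SimplexCategory.mkOfLeComp i j k h h') = triangle (x.face h h') :=
  eq_triangle (one_edge_pull _ _ _) (one_edge_pull _ _ _) (mk_face_pull _ _ _ _)

end Simplex

/-! ### The pseudofunctor of a map between nerves -/

namespace NaturalNerve

open Simplex MarkedSimplex

variable {C B : TwoCat.{u}} (u : naturalNerve.obj C ⟶ naturalNerve.obj B)

/-- The action of a map between nerves on objects. -/
def objAct (a : C) : B := (simplexAct u (ofObj a)).vertex 0

theorem vertex_simplexAct {m : ℕ} (x : Simplex C m) (i : Fin (m + 1)) :
    (simplexAct u x).vertex i = objAct u (x.vertex i) := by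
  rw [objAct, ← pull_const, simplexAct_pull]
  rfl

theorem exists_homAct {a b : C} (f : a ⟶ b) :
    ∃ g : objAct u a ⟶ objAct u b, Cell.one g = .one (simplexAct u (ofHom f)).arrow :=
  Cell.exists_one _ (vertex_simplexAct u (ofHom f) 0) (vertex_simplexAct u (ofHom f) 1)

/-- The action of a map between nerves on 1-morphisms. -/
noncomputable def homAct {a b : C} (f : a ⟶ b) : objAct u a ⟶ objAct u b :=
  (exists_homAct u f).choose

theorem one_homAct {a b : C} (f : a ⟶ b) :
    Cell.one (homAct u f) = .one (simplexAct u (ofHom f)).arrow :=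
  (exists_homAct u f).choose_spec

theorem one_edge_simplexAct {m : ℕ} (x : Simplex C m) {i j : Fin (m + 1)} (h : i ≤ j) :
    Cell.one ((simplexAct u x).edge h) = .one (homAct u (x.edge h)) := by
  rw [one_homAct, ← pull_mkOfLe, simplexAct_pull, pull_mkOfLe]
  rfl

theorem homAct_congr {a b a' b' : C} {f : a ⟶ b} {f' : a' ⟶ b'} (h : Cell.one f = .one f') :
    Cell.one (homAct u f) = .one (homAct u f') := by
  cases h; rfl

theorem homAct_id (a : C) : homAct u (𝟙 a) = 𝟙 (objAct u a) := by
  apply Cell.one_inj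
  rw [one_homAct, ofHom_id, simplexAct_pull, one_edge_pull]
  exact Cell.one_congr (Simplex.edge_self _ _)

variable {a b c : C} {f : a ⟶ b} {g : b ⟶ c} {h : a ⟶ c}

theorem exists_triAct (t : h ⟶ f ≫ g) :
    ∃ s : homAct u h ⟶ homAct u f ≫ homAct u g,
      Cell.mk s = .mk (simplexAct u (triangle t)).filler := by
  refine Cell.exists_hom _ ?_ (Cell.one_comp_congr ?_ ?_)
  · exact (one_edge_simplexAct u _ _).trans (homAct_congr u (one_edge₀₂_triangle t))
  · exact (one_edge_simplexAct u _ _).trans (homAct_congr u (one_edge₀₁_triangle t))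
  · exact (one_edge_simplexAct u _ _).trans (homAct_congr u (one_edge₁₂_triangle t))

/-- The action of a map between nerves on 2-morphisms that fill a triangle. -/
noncomputable def triAct (t : h ⟶ f ≫ g) : homAct u h ⟶ homAct u f ≫ homAct u g :=
  (exists_triAct u t).choose

theorem mk_triAct (t : h ⟶ f ≫ g) :
    Cell.mk (triAct u t) = .mk (simplexAct u (triangle t)).filler :=
  (exists_triAct u t).choose_spec

theorem mk_face_simplexAct {m : ℕ} (x : Simplex C m) {i j k : Fin (m + 1)} (h : i ≤ j)
    (h' : j ≤ k) : Cell.mk ((simplexAct u x).face h h') = .mk (triAct u (x.face h h')) := by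
  rw [mk_triAct, ← pull_mkOfLeComp, simplexAct_pull, pull_mkOfLeComp, mk_face_triangle]

theorem triAct_cocycle (D : Tetrahedron C) :
    triAct u D.t₀₁₃ ≫ homAct u D.f₀₁ ◁ triAct u D.t₁₂₃ =
      triAct u D.t₀₂₃ ≫ triAct u D.t₀₁₂ ▷ homAct u D.f₂₃ ≫ (α_ _ _ _).hom := by
  let y := simplexAct u D.simplex
  have h₀₁₂ : Cell.mk (triAct u D.t₀₁₂) =
      .mk (y.face (i := 0) (j := 1) (k := 2) (by decide) (by decide)) := by
    rw [mk_triAct, ← D.pull₀₁₂, simplexAct_pull]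
    exact mk_face_pull _ _ _ _
  have h₁₂₃ : Cell.mk (triAct u D.t₁₂₃) =
      .mk (y.face (i := 1) (j := 2) (k := 3) (by decide) (by decide)) := by
    rw [mk_triAct, ← D.pull₁₂₃, simplexAct_pull]
    exact mk_face_pull _ _ _ _
  have h₀₁₃ : Cell.mk (triAct u D.t₀₁₃) =
      .mk (y.face (i := 0) (j := 1) (k := 3) (by decide) (by decide)) := by
    rw [mk_triAct, ← D.pull₀₁₃, simplexAct_pull]
    exact mk_face_pull _ _ _ _
  have h₀₂₃ : Cell.mk (triAct u D.t₀₂₃) =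
      .mk (y.face (i := 0) (j := 2) (k := 3) (by decide) (by decide)) := by
    rw [mk_triAct, ← D.pull₀₂₃, simplexAct_pull]
    exact mk_face_pull _ _ _ _
  have h₀₁ : Cell.one (homAct u D.f₀₁) = .one (y.edge (i := 0) (j := 1) (by decide)) :=
    ((one_edge_simplexAct u _ _).trans (homAct_congr u (Cell.one_congr D.edge₀₁))).symm
  have h₂₃ : Cell.one (homAct u D.f₂₃) = .one (y.edge (i := 2) (j := 3) (by decide)) :=
    ((one_edge_simplexAct u _ _).trans (homAct_congr u (Cell.one_congr D.edge₂₃))).symm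
  apply Cell.mk_inj
  refine (Cell.comp_congr h₀₁₃ (Cell.whiskerLeft_congr h₀₁ h₁₂₃)).trans
    ((congrArg Cell.mk (y.cocycle (i := 0) (j := 1) (k := 2) (l := 3) (by decide) (by decide)
      (by decide))).trans ?_)
  refine (Cell.comp_congr h₀₂₃ ?_).symm
  exact (Cell.mk_comp_associator _ _ _ _).trans ((Cell.whiskerRight_congr h₀₁₂ h₂₃).trans
    (Cell.mk_comp_associator _ _ _ _).symm)

/-- The action of a map between nerves on triangles. -/
noncomputable def triangleMap : TriangleMap C B where
  obj := objAct u
  map := homAct u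
  map_id := homAct_id u
  tri := triAct u
  tri_leftUnitor f := by
    rw [mk_triAct, triangle_leftUnitor, simplexAct_pull, mk_face_pull, mk_face_of_dim_one,
      one_homAct]
    rfl
  tri_rightUnitor f := by
    rw [mk_triAct, triangle_rightUnitor, simplexAct_pull, mk_face_pull, mk_face_of_dim_one,
      one_homAct]
    rfl
  cocycle := triAct_cocycle u
  isIso_tri f g := by
    have := isIso_filler (act u (marked 1) (markedTriangle f g))
    refine Cell.isIso_congr (η' := filler (orientalToInv ≫ act u (marked 1) (markedTriangle f g) :
      oriental.{u}.obj ⟨2⟩ ⟶ B)) ((mk_triAct u _).trans ?_)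
    rw [← orientalToInv_markedTriangle]
    exact congrArg (fun x : Simplex B 2 => Cell.mk x.filler) (act_inv u (markedTriangle f g)).symm

/-- The pseudofunctor determined by a map between nerves. -/
noncomputable def toPseudofunctor : C ⥤ᵖ B := (triangleMap u).pseudofunctor

end NaturalNerve

end

/-! ### The 2-category of strictifications of a pseudofunctor -/

/-- The objects of the 2-category `Strictification J` of a pseudofunctor `J : C ⥤ᵖ B` are those of
`C`. Its 1-morphisms are the 1-morphisms `f` of `C` equipped with a 1-morphism of `B` isomorphic
to `J f`, and its 2-morphisms are those of `C`. The projections to `C` and to `B` are strict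
2-functors. -/
structure Strictification {C : Type u} [Bicategory.{w, v} C] {B : Type u₁} [Bicategory.{w₁, v₁} B]
    (J : C ⥤ᵖ B) : Type u where
  as : C

namespace Strictification

variable {C : Type u} [Bicategory.{w, v} C] {B : Type u₁} [Bicategory.{w₁, v₁} B] (J : C ⥤ᵖ B)

/-- A 1-morphism `fst` of `C` and a 1-morphism `snd` of `B` that is isomorphic to its image. -/
structure Mor (a b : Strictification J) : Type max v v₁ w₁ where
  fst : a.as ⟶ b.as
  snd : J.obj a.as ⟶ J.obj b.as
  iso : snd ≅ J.map fst

variable {J}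

theorem Mor.ext' {a b : Strictification J} {m n : Mor J a b} (h₁ : m.fst = n.fst)
    (h₂ : Cell.mk m.iso.hom = .mk n.iso.hom) : m = n := by
  obtain ⟨f, p, κ⟩ := m
  obtain ⟨g, q, κ'⟩ := n
  dsimp only at h₁ h₂
  obtain rfl := Cell.one_inj (Cell.dom_eq h₂)
  subst h₁
  obtain rfl := Iso.ext (Cell.mk_inj h₂)
  rfl

instance : CategoryStruct (Strictification J) where
  Hom a b := Mor J a b
  id a := ⟨𝟙 a.as, 𝟙 _, (J.mapId a.as).symm⟩
  comp m n := ⟨m.fst ≫ n.fst, m.snd ≫ n.snd,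
    whiskerRightIso m.iso n.snd ≪≫ whiskerLeftIso (J.map m.fst) n.iso ≪≫
      (J.mapComp m.fst n.fst).symm⟩

instance (a b : Strictification J) : Category (a ⟶ b) where
  Hom m n := m.fst ⟶ n.fst
  id m := 𝟙 m.fst
  comp η θ := CategoryStruct.comp (obj := a.as ⟶ b.as) η θ
  id_comp η := Category.id_comp (obj := a.as ⟶ b.as) η
  comp_id η := Category.comp_id (obj := a.as ⟶ b.as) η
  assoc η θ κ := Category.assoc (obj := a.as ⟶ b.as) η θ κ

/-- A 2-morphism of `C`, as a 2-morphism of `Strictification J`. -/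
def homMk {a b : Strictification J} {m n : a ⟶ b} (η : m.fst ⟶ n.fst) : m ⟶ n := η

/-- The 2-morphism of `C` that underlies a 2-morphism of `Strictification J`. -/
def under {a b : Strictification J} {m n : a ⟶ b} (η : m ⟶ n) : m.fst ⟶ n.fst := η

/-- An invertible 2-morphism of `C`, as an invertible 2-morphism of `Strictification J`. -/
def isoMk {a b : Strictification J} {m n : a ⟶ b} (η : m.fst ≅ n.fst) : m ≅ n :=
  ⟨homMk η.hom, homMk η.inv, η.hom_inv_id, η.inv_hom_id⟩

instance : Bicategory (Strictification J) where
  whiskerLeft m _ _ η := homMk (m.fst ◁ under η)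
  whiskerRight η m := homMk (under η ▷ m.fst)
  associator m n k := isoMk (α_ m.fst n.fst k.fst)
  leftUnitor m := isoMk (λ_ m.fst)
  rightUnitor m := isoMk (ρ_ m.fst)
  whiskerLeft_id m n := whiskerLeft_id m.fst n.fst
  whiskerLeft_comp m _ _ _ η θ := whiskerLeft_comp m.fst (under η) (under θ)
  id_whiskerLeft η := id_whiskerLeft (under η)
  comp_whiskerLeft m n _ _ η := comp_whiskerLeft m.fst n.fst (under η)
  id_whiskerRight m n := id_whiskerRight m.fst n.fst
  comp_whiskerRight η θ m := comp_whiskerRight (under η) (under θ) m.fst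
  whiskerRight_id η := whiskerRight_id (under η)
  whiskerRight_comp η m n := whiskerRight_comp (under η) m.fst n.fst
  whisker_assoc m _ _ η n := whisker_assoc m.fst (under η) n.fst
  whisker_exchange η θ := whisker_exchange (under η) (under θ)
  pentagon m n k l := pentagon m.fst n.fst k.fst l.fst
  triangle m n := triangle m.fst n.fst

theorem under_eqToHom {a b : Strictification J} {m n : a ⟶ b} (h : m = n) :
    under (eqToHom h) = eqToHom (congrArg Mor.fst h) := by
  subst h; rfl

theorem mk_map₂_eqToHom (J : C ⥤ᵖ B) {a b : C} {f g : a ⟶ b} (h : f = g) :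
    Cell.mk (J.map₂ (eqToHom h)) = .one (J.map f) := by
  subst h; simp

section Strict

variable [Strict C] [Strict B]

theorem id_comp' {a b : Strictification J} (m : a ⟶ b) : 𝟙 a ≫ m = m := by
  refine Mor.ext' (Strict.id_comp _) ?_
  have : (𝟙 a ≫ m).iso.hom = (λ_ m.snd).hom ≫ m.iso.hom ≫ J.map₂ (λ_ m.fst).inv := by
    change (J.mapId a.as).inv ▷ m.snd ≫ J.map (𝟙 a.as) ◁ m.iso.hom ≫
      (J.mapComp (𝟙 a.as) m.fst).inv = _
    rw [J.mapComp_id_left_inv, ← whisker_exchange_assoc, inv_hom_whiskerRight_assoc,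
      id_whiskerLeft]
    simp
  rw [this, Strict.leftUnitor_eqToIso, Strict.leftUnitor_eqToIso, eqToIso.hom, eqToIso.inv,
    Cell.mk_eqToHom_comp]
  exact Cell.mk_comp_of_one _ (mk_map₂_eqToHom J _)

theorem comp_id' {a b : Strictification J} (m : a ⟶ b) : m ≫ 𝟙 b = m := by
  refine Mor.ext' (Strict.comp_id _) ?_
  have : (m ≫ 𝟙 b).iso.hom = (ρ_ m.snd).hom ≫ m.iso.hom ≫ J.map₂ (ρ_ m.fst).inv := by
    change m.iso.hom ▷ 𝟙 _ ≫ J.map m.fst ◁ (J.mapId b.as).inv ≫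
      (J.mapComp m.fst (𝟙 b.as)).inv = _
    rw [J.mapComp_id_right_inv, whiskerLeft_inv_hom_assoc, whiskerRight_id]
    simp
  rw [this, Strict.rightUnitor_eqToIso, Strict.rightUnitor_eqToIso, eqToIso.hom, eqToIso.inv,
    Cell.mk_eqToHom_comp]
  exact Cell.mk_comp_of_one _ (mk_map₂_eqToHom J _)

theorem assoc' {a b c d : Strictification J} (m : a ⟶ b) (n : b ⟶ c) (k : c ⟶ d) :
    (m ≫ n) ≫ k = m ≫ n ≫ k := by
  refine Mor.ext' (Strict.assoc _ _ _) ?_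
  have h : (J.mapComp m.fst n.fst).inv ▷ J.map k.fst ≫ (J.mapComp (m.fst ≫ n.fst) k.fst).inv ≫
      J.map₂ (α_ m.fst n.fst k.fst).hom = (α_ _ _ _).hom ≫
        J.map m.fst ◁ (J.mapComp n.fst k.fst).inv ≫ (J.mapComp m.fst (n.fst ≫ k.fst)).inv := by
    rw [J.mapComp_assoc_right_inv, Iso.hom_inv_id_assoc]
  have : (m ≫ n ≫ k).iso.hom = (α_ m.snd n.snd k.snd).inv ≫ ((m ≫ n) ≫ k).iso.hom ≫
      J.map₂ (α_ m.fst n.fst k.fst).hom := by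
    change m.iso.hom ▷ (n.snd ≫ k.snd) ≫ J.map m.fst ◁ (n.iso.hom ▷ k.snd ≫
      J.map n.fst ◁ k.iso.hom ≫ (J.mapComp n.fst k.fst).inv) ≫
        (J.mapComp m.fst (n.fst ≫ k.fst)).inv =
      _ ≫ ((m.iso.hom ▷ n.snd ≫ J.map m.fst ◁ n.iso.hom ≫ (J.mapComp m.fst n.fst).inv) ▷ k.snd ≫
        J.map (m.fst ≫ n.fst) ◁ k.iso.hom ≫ (J.mapComp (m.fst ≫ n.fst) k.fst).inv) ≫ _
    simp only [whiskerLeft_comp, comp_whiskerRight, Category.assoc]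
    rw [← whisker_exchange_assoc (J.mapComp m.fst n.fst).inv, h]
    simp
  rw [this, Strict.associator_eqToIso, Strict.associator_eqToIso, eqToIso.hom, eqToIso.inv,
    Cell.mk_eqToHom_comp]
  exact (Cell.mk_comp_of_one _ (mk_map₂_eqToHom J _)).symm

instance : Strict (Strictification J) where
  id_comp := id_comp'
  comp_id := comp_id'
  assoc := assoc'
  leftUnitor_eqToIso m := Iso.ext ((congrArg Iso.hom (Strict.leftUnitor_eqToIso m.fst)).trans
    (under_eqToHom (id_comp' m)).symm)
  rightUnitor_eqToIso m := Iso.ext ((congrArg Iso.hom (Strict.rightUnitor_eqToIso m.fst)).trans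
    (under_eqToHom (comp_id' m)).symm)
  associator_eqToIso m n k := Iso.ext ((congrArg Iso.hom
    (Strict.associator_eqToIso m.fst n.fst k.fst)).trans (under_eqToHom (assoc' m n k)).symm)

end Strict

end Strictification

namespace Strictification

variable {C B : TwoCat.{u}} {J : C ⥤ᵖ B}

variable (J) in
/-- The projection to `C`. -/
def proj₁ : StrictPseudofunctor (Strictification J) C :=
  StrictPseudofunctor.mk''
    { obj a := a.as
      map m := m.fst
      map₂ η := under η
      map₂_id _ := rfl
      map₂_comp _ _ := rfl
      map_id _ := rfl
      map_comp _ _ := rfl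
      map₂_whisker_left f _ _ η := Cell.mk_inj <| by
        rw [Cell.mk_eqToHom_comp, Cell.mk_comp_eqToHom]; rfl
      map₂_whisker_right η f := Cell.mk_inj <| by
        rw [Cell.mk_eqToHom_comp, Cell.mk_comp_eqToHom]; rfl }

variable (J) in
/-- The projection to `B`. -/
def proj₂ : StrictPseudofunctor (Strictification J) B :=
  StrictPseudofunctor.mk''
    { obj a := J.obj a.as
      map m := m.snd
      map₂ {_ _ m n} η := m.iso.hom ≫ J.map₂ (under η) ≫ n.iso.inv
      map₂_id m := by
        change m.iso.hom ≫ J.map₂ (𝟙 m.fst) ≫ m.iso.inv = _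
        simp
      map₂_comp {_ _ m n k} η θ := by
        change m.iso.hom ≫ J.map₂ (under η ≫ under θ) ≫ k.iso.inv = _
        simp
      map_id _ := rfl
      map_comp _ _ := rfl
      map₂_whisker_left m n k η := Cell.mk_inj <| by
        rw [Cell.mk_eqToHom_comp, Cell.mk_comp_eqToHom]
        congr 1
        change (m.iso.hom ▷ n.snd ≫ J.map m.fst ◁ n.iso.hom ≫ (J.mapComp m.fst n.fst).inv) ≫
          J.map₂ (m.fst ◁ under η) ≫ (((J.mapComp m.fst k.fst).hom ≫
            J.map m.fst ◁ k.iso.inv) ≫ m.iso.inv ▷ k.snd) = _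
        rw [J.map₂_whisker_left]
        simp only [Category.assoc, Iso.inv_hom_id_assoc, whiskerLeft_comp]
        rw [whisker_exchange, whisker_exchange_assoc, whisker_exchange_assoc]
        simp
      map₂_whisker_right {_ _ _ m n} η k := Cell.mk_inj <| by
        rw [Cell.mk_eqToHom_comp, Cell.mk_comp_eqToHom]
        congr 1
        change (m.iso.hom ▷ k.snd ≫ J.map m.fst ◁ k.iso.hom ≫ (J.mapComp m.fst k.fst).inv) ≫
          J.map₂ (under η ▷ k.fst) ≫ (((J.mapComp n.fst k.fst).hom ≫
            J.map n.fst ◁ k.iso.inv) ≫ n.iso.inv ▷ k.snd) = _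
        rw [J.map₂_whisker_right]
        simp only [Category.assoc, Iso.inv_hom_id_assoc, comp_whiskerRight]
        rw [← whisker_exchange_assoc (J.map₂ (under η)), whiskerLeft_hom_inv_assoc] }

theorem cell_ext {a b a' b' : Strictification J} {m n : a ⟶ b} {m' n' : a' ⟶ b'} {η : m ⟶ n}
    {η' : m' ⟶ n'} (h₁ : Cell.one m = .one m') (h₂ : Cell.one n = .one n')
    (h : Cell.mk (under η) = .mk (under η')) : Cell.mk η = .mk η' := by
  cases h₁
  cases h₂
  have e : under η = under η' := Cell.mk_inj h
  exact congrArg (fun θ : m.fst ⟶ n.fst => Cell.mk (homMk θ)) e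

/-- Strict 2-functors to `Strictification J` agree if they agree on 1-morphisms and over `C`. -/
theorem functor_ext {A : Type u} [Bicategory.{u, u} A]
    {F G : StrictPseudofunctor A (Strictification J)}
    (h₁ : ∀ {a b : A} (f : a ⟶ b), Cell.one (F.map f) = .one (G.map f))
    (h : ∀ {a b : A} {f g : a ⟶ b} (η : f ⟶ g),
      Cell.mk (under (F.map₂ η)) = .mk (under (G.map₂ η))) : F = G :=
  TwoCat.functor_ext_cell fun {_ _ f g} η => cell_ext (h₁ f) (h₁ g) (h η)

section Lift

variable {A : Type u} [Bicategory.{u, u} A] [Strict A] (x : StrictPseudofunctor A C)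
  (m : ∀ {i j : A}, (i ⟶ j) → ((⟨x.obj i⟩ : Strictification J) ⟶ ⟨x.obj j⟩))
  (hm : ∀ {i j : A} (S : i ⟶ j), (m S).fst = x.map S)
  (hid : ∀ i : A, m (𝟙 i) = 𝟙 _)
  (hcomp : ∀ {i j k : A} (S : i ⟶ j) (T : j ⟶ k), m (S ≫ T) = m S ≫ m T)

/-- The 2-morphisms of a lift. -/
def liftMap₂ {i j : A} {S T : i ⟶ j} (η : S ⟶ T) : m S ⟶ m T :=
  homMk (eqToHom (hm S) ≫ x.map₂ η ≫ eqToHom (hm T).symm)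

theorem mk_under_liftMap₂ {i j : A} {S T : i ⟶ j} (η : S ⟶ T) :
    Cell.mk (under (liftMap₂ x m hm η)) = .mk (x.map₂ η) := by
  change Cell.mk (eqToHom (hm S) ≫ x.map₂ η ≫ eqToHom (hm T).symm) = _
  simp

/-- A lift of a strict 2-functor to `C` is determined by a lift of its action on 1-morphisms. -/
def lift : StrictPseudofunctor A (Strictification J) :=
  StrictPseudofunctor.mk''
    { obj i := ⟨x.obj i⟩
      map := m
      map₂ := liftMap₂ x m hm
      map₂_id S := Cell.mk_inj <| by
        refine cell_ext rfl rfl ?_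
        rw [mk_under_liftMap₂, x.map₂_id]
        exact Cell.one_congr (hm S).symm
      map₂_comp η θ := Cell.mk_inj <| by
        refine cell_ext rfl rfl ?_
        rw [mk_under_liftMap₂, x.map₂_comp]
        exact Cell.comp_congr (mk_under_liftMap₂ x m hm η).symm (mk_under_liftMap₂ x m hm θ).symm
      map_id := hid
      map_comp := hcomp
      map₂_whisker_left S _ _ η := Cell.mk_inj <| by
        rw [Cell.mk_eqToHom_comp, Cell.mk_comp_eqToHom]
        refine cell_ext (Cell.one_congr (hcomp _ _)) (Cell.one_congr (hcomp _ _)) ?_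
        rw [mk_under_liftMap₂, StrictCell.mk_map_whiskerLeft]
        exact Cell.whiskerLeft_congr (Cell.one_congr (hm S).symm) (mk_under_liftMap₂ x m hm η).symm
      map₂_whisker_right η S := Cell.mk_inj <| by
        rw [Cell.mk_eqToHom_comp, Cell.mk_comp_eqToHom]
        refine cell_ext (Cell.one_congr (hcomp _ _)) (Cell.one_congr (hcomp _ _)) ?_
        rw [mk_under_liftMap₂, StrictCell.mk_map_whiskerRight]
        exact Cell.whiskerRight_congr (mk_under_liftMap₂ x m hm η).symm
          (Cell.one_congr (hm S).symm) }

theorem lift_comp_proj₁ :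
    StrictPseudofunctor.comp (lift x m hm hid hcomp) (proj₁ J) = x :=
  TwoCat.functor_ext_cell fun η => mk_under_liftMap₂ x m hm η

end Lift

end Strictification

section

open Oriental

/-! ### Lifting a map between nerves to strictifications -/

namespace Strictification

section

variable {C : Type u} [Bicategory.{w, v} C] {B : Type u₁} [Bicategory.{w₁, v₁} B] (J : C ⥤ᵖ B)

/-- The canonical 1-morphism over a 1-morphism `f` of `C`: it consists of `f` and `J f`. -/
def can {a b : C} (f : a ⟶ b) : (⟨a⟩ : Strictification J) ⟶ ⟨b⟩ :=
  ⟨f, J.map f, Iso.refl _⟩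

theorem one_can_congr {a b a' b' : C} {f : a ⟶ b} {f' : a' ⟶ b'} (h : Cell.one f = .one f') :
    Cell.one (can J f) = .one (can J f') := by
  cases h; rfl

theorem can_id {a : C} (h : Cell.mk (J.mapId a).hom = .one (𝟙 (J.obj a))) :
    can J (𝟙 a) = 𝟙 _ := by
  refine Mor.ext' rfl ?_
  change Cell.mk (𝟙 (J.map (𝟙 a))) = .mk (J.mapId a).inv
  have e : J.map (𝟙 a) = 𝟙 _ := Cell.one_inj (Cell.dom_eq h)
  exact (Cell.one_congr e).trans (Cell.inv_congr (η := J.mapId a) (η' := Iso.refl _) h).symm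

end

variable {C B : TwoCat.{u}} {J : C ⥤ᵖ B} {V : Type u} [LinearOrder V] [Finite V]
  {P : LocalPreorder (SimplicialThickening V)}

theorem simplex_ext {y y' : StrictPseudofunctor (LocallyThin P) (Strictification J)}
    (h₁ : ∀ {i j : V} (h : i ≤ j), Cell.one (y.map (edge h)) = .one (y'.map (edge h)))
    (h : StrictPseudofunctor.comp y (proj₁ J) = StrictPseudofunctor.comp y' (proj₁ J)) : y = y' :=
  functor_ext (fun S => one_map_eq h₁ S) fun η =>
    congrArg (fun x : StrictPseudofunctor (LocallyThin P) C => Cell.mk (x.map₂ η)) h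

/-- A strict 2-functor from an oriental lifts to the strictification, canonically on edges. -/
theorem exists_simplex (hJ : ∀ a, Cell.mk (J.mapId a).hom = .one (𝟙 (J.obj a)))
    (x : StrictPseudofunctor (LocallyThin P) C) :
    ∃ y : StrictPseudofunctor (LocallyThin P) (Strictification J),
      StrictPseudofunctor.comp y (proj₁ J) = x ∧
      ∀ {i j : V} (h : i ≤ j), Cell.one (y.map (edge h)) = .one (can J (x.map (edge h))) := by
  obtain ⟨m, hid, hcomp, he⟩ := exists_functor P
    (fun i : V => (⟨x.obj ⟨⟨i⟩⟩⟩ : Strictification J)) fun h => can J (x.map (edge h.le))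
  have hm {i j : LocallyThin P} (S : i ⟶ j) : (m S).fst = x.map S := by
    induction S using path_induction with
    | id => rw [hid, x.map_id]; rfl
    | comp S hkj ih =>
      rw [hcomp, x.map_comp, he hkj, ← ih]
      rfl
  refine ⟨lift x m hm hid hcomp, lift_comp_proj₁ x m hm hid hcomp, fun {i j} h => ?_⟩
  rcases h.eq_or_lt with rfl | h'
  · rw [edge_self, StrictCell.one_map_id]
    refine Eq.trans ?_ (one_can_congr J (StrictCell.one_map_id x _)).symm
    rw [can_id J (hJ _)]
    rfl
  · exact Cell.one_congr (he h')

end Strictification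

namespace NaturalNerve

open Strictification Simplex MarkedSimplex

variable {C B : TwoCat.{u}} (u : naturalNerve.obj C ⟶ naturalNerve.obj B)

theorem mk_toPseudofunctor_mapId (a : C) :
    Cell.mk ((toPseudofunctor u).mapId a).hom = .one (𝟙 ((toPseudofunctor u).obj a)) :=
  (Cell.mk_eqToHom (homAct_id u a)).trans (Cell.one_congr (homAct_id u a))

/-- The 2-category of strictifications of the pseudofunctor of a map between nerves. -/
noncomputable abbrev strictified : TwoCat.{u} := ⟨Strictification (toPseudofunctor u)⟩

section

variable {V : Type u} [LinearOrder V] [Finite V] {P : LocalPreorder (SimplicialThickening V)}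

/-- The lift of a simplex, or of a simplex with invertible 2-morphisms. It exists for both since
2-morphisms lift uniquely and the underlying category is free on the edges. -/
noncomputable def simplexLift (x : StrictPseudofunctor (LocallyThin P) C) :
    StrictPseudofunctor (LocallyThin P) (Strictification (toPseudofunctor u)) :=
  (exists_simplex (mk_toPseudofunctor_mapId u) x).choose

theorem simplexLift_proj₁ (x : StrictPseudofunctor (LocallyThin P) C) :
    StrictPseudofunctor.comp (simplexLift u x) (proj₁ _) = x :=
  (exists_simplex (mk_toPseudofunctor_mapId u) x).choose_spec.1

theorem one_simplexLift (x : StrictPseudofunctor (LocallyThin P) C) {i j : V} (h : i ≤ j) :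
    Cell.one ((simplexLift u x).map (edge h)) = .one (can _ (x.map (edge h))) :=
  (exists_simplex (mk_toPseudofunctor_mapId u) x).choose_spec.2 h

theorem eq_simplexLift {x : StrictPseudofunctor (LocallyThin P) C}
    {y : StrictPseudofunctor (LocallyThin P) (Strictification (toPseudofunctor u))}
    (h₁ : ∀ {i j : V} (h : i ≤ j), Cell.one (y.map (edge h)) = .one (can _ (x.map (edge h))))
    (h : StrictPseudofunctor.comp y (proj₁ _) = x) : y = simplexLift u x :=
  simplex_ext (fun h => (h₁ h).trans (one_simplexLift u x h).symm)
    (h.trans (simplexLift_proj₁ u x).symm)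

end

theorem simplexLift_pull {m n : ℕ} (φ : SimplexCategory.mk n ⟶ .mk m) (x : Simplex C m) :
    simplexLift u (x.pull φ) =
      Simplex.pull (C := strictified u) (simplexLift u x) φ := by
  refine (eq_simplexLift u ?_ ?_).symm
  · rintro ⟨i⟩ ⟨j⟩ h
    refine (Simplex.one_edge_pull (C := strictified u) (simplexLift u x) φ h).trans ?_
    refine (one_simplexLift u x _).trans (one_can_congr _ (one_edge_pull x φ h).symm)
  · exact (TwoCat.functor_ext rfl : StrictPseudofunctor.comp
      (Simplex.pull (C := strictified u) (simplexLift u x) φ) (proj₁ _) = Simplex.pull (C := C)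
      (StrictPseudofunctor.comp (simplexLift u x) (proj₁ _)) φ).trans
      (congrArg (fun y : Simplex C m => y.pull φ) (simplexLift_proj₁ u x))

/-- The lift of a 2-simplex with invertible 2-morphism. -/
noncomputable def invLift (x : invOriental ⟶ C) : invOriental ⟶ strictified u :=
  simplexLift (P := indiscrete (SimplicialThickening (ULift.{u} (Fin 3)))) u x

theorem simplexLift_inv (x : invOriental ⟶ C) :
    simplexLift u (P := inclusion (ULift.{u} (Fin 3))) (orientalToInv ≫ x : oriental.obj ⟨2⟩ ⟶ C) =
      (orientalToInv ≫ invLift u x : oriental.obj ⟨2⟩ ⟶ strictified u) := by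
  refine (eq_simplexLift u ?_ ?_).symm
  · intro i j h
    exact one_simplexLift (P := indiscrete (SimplicialThickening (ULift.{u} (Fin 3)))) u _ h
  · exact (Category.assoc orientalToInv (invLift u x)
      (proj₁ (toPseudofunctor u) : strictified u ⟶ C)).trans <|
      congrArg (orientalToInv ≫ ·) (simplexLift_proj₁
      (P := indiscrete (SimplicialThickening (ULift.{u} (Fin 3)))) u x)

/-- The projection from the strictified 2-category to `C`. -/
noncomputable def toBase : strictified u ⟶ C := proj₁ (toPseudofunctor u)

/-- The projection from the strictified 2-category to `B`. -/
noncomputable def toTarget : strictified u ⟶ B := proj₂ (toPseudofunctor u)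

/-- The canonical lift of a triangle is projected to the action of `u` on the triangle. -/
theorem mk_triAct_eq {a b c : C} {f : a ⟶ b} {g : b ⟶ c} {h : a ⟶ c} (t : h ⟶ f ≫ g) :
    Cell.mk (triAct u t) = .mk ((toTarget u).map₂ (homMk t : can _ h ⟶ can _ f ≫ can _ g)) := by
  have e : triAct u t = (toPseudofunctor u).map₂ t ≫ ((toPseudofunctor u).mapComp f g).hom :=
    (triangleMap u).tri_eq t
  have e' : (toTarget u).map₂ (homMk t : can _ h ⟶ can _ f ≫ can _ g) =
      𝟙 _ ≫ (toPseudofunctor u).map₂ t ≫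
        (((toPseudofunctor u).mapComp f g).hom ≫ _ ◁ 𝟙 _) ≫ 𝟙 _ ▷ _ := rfl
  rw [e, e']
  simp only [whiskerLeft_id, id_whiskerRight, Category.id_comp, Category.comp_id]
  rfl

theorem simplexLift_toTarget {m : ℕ} (x : Simplex C m) :
    (simplexLift u x : oriental.obj ⟨m⟩ ⟶ _) ≫ toTarget u = simplexAct u x := by
  let y : Simplex (strictified u) m := simplexLift u x
  have hy : StrictPseudofunctor.comp y (proj₁ _) = x := simplexLift_proj₁ u x
  have h₁ {i j : Fin (m + 1)} (h : i ≤ j) : Cell.one (y.edge h) = .one (can _ (x.edge h)) :=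
    one_simplexLift u x (i := ULift.up i) (j := ULift.up j) h
  refine Simplex.ext (fun i => ?_) (fun {i j} h => ?_) fun {i j k} h h' => ?_
  · rw [vertex_simplexAct]
    exact congrArg (fun z : Simplex C m => objAct u (z.vertex i)) hy
  · rw [one_edge_simplexAct]
    exact StrictCell.map_one_congr (toTarget u) (h₁ h.le)
  · rw [mk_face_simplexAct, mk_triAct_eq]
    refine (mk_face _ _ _).trans ?_
    refine StrictCell.map_congr (toTarget u) ?_
    refine (y.mk_face _ _).symm.trans
      (cell_ext (h₁ _) (Cell.one_comp_congr (h₁ _) (h₁ _)) ?_)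
    refine Eq.trans ?_ (congrArg (fun z : Simplex C m => Cell.mk (z.face h.le h'.le)) hy)
    exact (StrictCell.map_congr (toBase u) (y.mk_face _ _)).trans
      (mk_face (StrictPseudofunctor.comp y (proj₁ _) : Simplex C m) h.le h'.le).symm

end NaturalNerve

end

/-! ### Uniqueness of right adjoints -/

namespace RightAdjointUnique

variable {B : Type u} [Bicategory.{w, v} B] {a b : B} {f : a ⟶ b} {g g' : b ⟶ a}

/-- Right adjoints represent, so a 2-morphism out of one is determined by its transpose. -/
theorem eq_of_unit_comp (adj : f ⊣ g) {κ κ' : g ⟶ g'}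
    (h : adj.unit ≫ f ◁ κ = adj.unit ≫ f ◁ κ') : κ = κ' := by
  have key (κ : g ⟶ g') :
      κ = 𝟙 _ ⊗≫ g ◁ (adj.unit ≫ f ◁ κ) ⊗≫ adj.counit ▷ g' ⊗≫ 𝟙 _ := by
    symm
    calc
      _ = 𝟙 _ ⊗≫ g ◁ adj.unit ⊗≫ ((g ≫ f) ◁ κ ≫ adj.counit ▷ g') ⊗≫ 𝟙 _ := by bicategory
      _ = 𝟙 _ ⊗≫ rightZigzag adj.unit adj.counit ⊗≫ κ ⊗≫ 𝟙 _ := by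
        rw [whisker_exchange]; bicategory
      _ = 𝟙 _ ⊗≫ κ ⊗≫ 𝟙 _ := by
        rw [adj.right_triangle]; bicategory
      _ = κ := by bicategory
  rw [key κ, key κ', h]

/-- The comparison between two right adjoints of `f`. -/
def comparison (adj : f ⊣ g) (adj' : f ⊣ g') : g ⟶ g' :=
  𝟙 _ ⊗≫ g ◁ adj'.unit ⊗≫ adj.counit ▷ g' ⊗≫ 𝟙 _

theorem unit_comparison (adj : f ⊣ g) (adj' : f ⊣ g') :
    adj.unit ≫ f ◁ comparison adj adj' = adj'.unit := by
  rw [comparison]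
  calc
    _ = 𝟙 _ ⊗≫ (adj.unit ▷ 𝟙 a ≫ (f ≫ g) ◁ adj'.unit) ⊗≫ f ◁ adj.counit ▷ g' ⊗≫ 𝟙 _ := by
      bicategory
    _ = adj'.unit ⊗≫ leftZigzag adj.unit adj.counit ▷ g' ⊗≫ 𝟙 _ := by
      rw [← whisker_exchange]; bicategory
    _ = adj'.unit ⊗≫ 𝟙 _ := by
      rw [adj.left_triangle]; bicategory
    _ = _ := by bicategory

theorem comparison_counit (adj : f ⊣ g) (adj' : f ⊣ g') :
    comparison adj adj' ▷ f ≫ adj'.counit = adj.counit := by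
  rw [comparison]
  calc
    _ = 𝟙 _ ⊗≫ g ◁ adj'.unit ▷ f ⊗≫ (adj.counit ▷ (g' ≫ f) ≫ 𝟙 b ◁ adj'.counit) ⊗≫ 𝟙 _ := by
      bicategory
    _ = 𝟙 _ ⊗≫ g ◁ leftZigzag adj'.unit adj'.counit ⊗≫ adj.counit := by
      rw [← whisker_exchange]; bicategory
    _ = 𝟙 _ ⊗≫ adj.counit := by
      rw [adj'.left_triangle]; bicategory
    _ = _ := by bicategory

theorem comparison_comp (adj : f ⊣ g) (adj' : f ⊣ g') :
    comparison adj adj' ≫ comparison adj' adj = 𝟙 g := by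
  apply eq_of_unit_comp adj
  rw [whiskerLeft_comp, ← Category.assoc, unit_comparison, unit_comparison, whiskerLeft_id,
    Category.comp_id]

/-- Two right adjoints of `f` are isomorphic. -/
def comparisonIso (adj : f ⊣ g) (adj' : f ⊣ g') : g ≅ g' :=
  ⟨comparison adj adj', comparison adj' adj, comparison_comp adj adj', comparison_comp adj' adj⟩

/-- An adjunction with the same cells, for an equal left adjoint. -/
theorem exists_transport {a' b' : B} {f' : a' ⟶ b'} (h : Cell.one f = .one f') (adj : f ⊣ g) :
    ∃ (k : b' ⟶ a') (adj' : f' ⊣ k), Cell.one g = .one k ∧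
      Cell.mk adj.unit = .mk adj'.unit ∧ Cell.mk adj.counit = .mk adj'.counit := by
  cases h
  exact ⟨g, adj, rfl, rfl, rfl⟩

theorem mk_mapAdjunction_unit {X Y : Type*} [Bicategory.{w, v} X] [Bicategory.{w₁, v₁} Y]
    (F : StrictPseudofunctor X Y) {a b : X} {f : a ⟶ b} {g : b ⟶ a} (adj : f ⊣ g) :
    Cell.mk (F.mapAdjunction adj).unit = .mk (F.map₂ adj.unit) := by
  rw [F.mapAdjunction_unit', Cell.mk_eqToHom_comp, Cell.mk_comp_eqToHom]

theorem mk_mapAdjunction_counit {X Y : Type*} [Bicategory.{w, v} X] [Bicategory.{w₁, v₁} Y]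
    (F : StrictPseudofunctor X Y) {a b : X} {f : a ⟶ b} {g : b ⟶ a} (adj : f ⊣ g) :
    Cell.mk (F.mapAdjunction adj).counit = .mk (F.map₂ adj.counit) := by
  rw [F.mapAdjunction_counit', Cell.mk_eqToHom_comp, Cell.mk_comp_eqToHom]

/-- The comparison is an identity if the right adjoints and the units have the same image. -/
theorem mk_map_comparison {X Y : Type*} [Bicategory.{w, v} X] [Bicategory.{w₁, v₁} Y]
    (F : StrictPseudofunctor X Y) {a b : X} {f : a ⟶ b} {g g' : b ⟶ a} (adj : f ⊣ g)
    (adj' : f ⊣ g') (h : F.map g = F.map g')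
    (h' : Cell.mk (F.map₂ adj.unit) = .mk (F.map₂ adj'.unit)) :
    Cell.mk (F.map₂ (comparison adj adj')) = .one (F.map g) := by
  have key : F.map₂ (comparison adj adj') ≫ eqToHom h.symm = 𝟙 _ := by
    apply eq_of_unit_comp (F.mapAdjunction adj)
    apply Cell.mk_inj
    rw [whiskerLeft_id, Category.comp_id]
    refine Eq.trans ?_ ((mk_mapAdjunction_unit F adj).trans h').symm
    rw [← unit_comparison adj adj', F.map₂_comp]
    refine Cell.comp_congr (mk_mapAdjunction_unit F adj) (Eq.trans ?_
      (StrictCell.mk_map_whiskerLeft F f _).symm)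
    exact Cell.whiskerLeft_congr rfl (Cell.mk_comp_eqToHom _ _)
  rw [← Cell.mk_comp_eqToHom _ h.symm, key]

end RightAdjointUnique

/-! ### 2-functors on the free adjoint equivalence -/

namespace FreeAdjEquiv

open TwoPresentation Quiver

/-- The 2-category `𝔼`. -/
abbrev E : Type u := Presented (V := Obj.{u}) ⟨Gen₂, Rel₂⟩

/-- The 1-morphism `f` of `𝔼`. -/
abbrev left : (⟨.x⟩ : E.{u}) ⟶ ⟨.y⟩ := f

/-- The 1-morphism `g` of `𝔼`. -/
abbrev right : (⟨.y⟩ : E.{u}) ⟶ ⟨.x⟩ := g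

/-- The invertible unit. -/
def unitIso : 𝟙 (⟨.x⟩ : E.{u}) ≅ left ≫ right where
  hom := Presented.homMk (.of .η)
  inv := Presented.homMk (.of .ηInv)
  hom_inv_id := Quot.sound (.of_rel .η_ηInv)
  inv_hom_id := Quot.sound (.of_rel .ηInv_η)

/-- The invertible counit. -/
def counitIso : right ≫ left ≅ 𝟙 (⟨.y⟩ : E.{u}) where
  hom := Presented.homMk (.of .ε)
  inv := Presented.homMk (.of .εInv)
  hom_inv_id := Quot.sound (.of_rel .ε_εInv)
  inv_hom_id := Quot.sound (.of_rel .εInv_ε)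

/-- The generating adjunction. -/
def adj : left.{u} ⊣ right where
  unit := unitIso.hom
  counit := counitIso.hom
  left_triangle := by
    have e : unitIso.{u}.hom ▷ left ≫ (α_ left right left).hom ≫ left ◁ counitIso.hom =
        eqToHom (Strict.id_comp left.{u}) := by
      rw [Strict.associator_eqToIso, eqToIso.hom, ← Presented.homMk_ofEq, ← Presented.homMk_ofEq]
      exact Quot.sound (.of_rel .left_triangle)
    have e' : leftZigzag unitIso.{u}.hom counitIso.hom =
        unitIso.hom ▷ left ≫ (α_ left right left).hom ≫ left ◁ counitIso.hom := by
      simp [bicategoricalComp]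
    rw [e', e, Strict.leftUnitor_eqToIso, Strict.rightUnitor_eqToIso, eqToIso.hom, eqToIso.inv,
      eqToHom_trans]
    rfl
  right_triangle := by
    have e : right.{u} ◁ unitIso.{u}.hom ≫ (α_ right left right).inv ≫ counitIso.hom ▷ right =
        eqToHom (Strict.comp_id right.{u}) := by
      rw [Strict.associator_eqToIso, eqToIso.inv, ← Presented.homMk_ofEq, ← Presented.homMk_ofEq]
      exact Quot.sound (.of_rel .right_triangle)
    have e' : rightZigzag unitIso.{u}.hom counitIso.hom =
        right ◁ unitIso.hom ≫ (α_ right left right).inv ≫ counitIso.hom ▷ right := by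
      simp [bicategoricalComp]
    rw [e', e, Strict.leftUnitor_eqToIso, Strict.rightUnitor_eqToIso, eqToIso.hom, eqToIso.inv,
      eqToHom_trans]
    rfl

/-- A 2-functor on `𝔼` is determined by its values on `f`, `g`, the unit and the counit. -/
theorem ext {B : Type u} [Bicategory.{u, u} B] {F G : StrictPseudofunctor E.{u} B}
    (hf : Cell.one (F.map left) = .one (G.map left))
    (hg : Cell.one (F.map right) = .one (G.map right))
    (hη : Cell.mk (F.map₂ unitIso.hom) = .mk (G.map₂ unitIso.hom))
    (hε : Cell.mk (F.map₂ counitIso.hom) = .mk (G.map₂ counitIso.hom)) : F = G := by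
  have hobj (a : Obj) : F.obj ⟨a⟩ = G.obj ⟨a⟩ := by
    cases a
    exacts [Cell.src_eq hf, Cell.tgt_eq hf]
  have hgen : ∀ {a b : Obj} (γ : Gen₁ a b),
      Cell.one (F.map (X := ⟨a⟩) (Y := ⟨b⟩) (Hom.toPath (V := Obj) γ)) =
        .one (G.map (X := ⟨a⟩) (Y := ⟨b⟩) (Hom.toPath (V := Obj) γ)) := by
    rintro _ _ (_ | _)
    exacts [hf, hg]
  have h₁ {a b : Obj} (p : Path a b) :
      Cell.one (F.map (X := ⟨a⟩) (Y := ⟨b⟩) p) = .one (G.map (X := ⟨a⟩) (Y := ⟨b⟩) p) := by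
    induction p with
    | nil =>
      exact (StrictCell.one_map_id F ⟨a⟩).trans ((Cell.zero_congr (hobj a)).trans
        (StrictCell.one_map_id G ⟨a⟩).symm)
    | @cons b c p γ ih =>
      let p' : (⟨a⟩ : E.{u}) ⟶ ⟨b⟩ := p
      let γ' : (⟨b⟩ : E.{u}) ⟶ ⟨c⟩ := Hom.toPath γ
      exact (StrictCell.one_map_comp F p' γ').trans
        ((Cell.one_comp_congr ih (hgen γ)).trans (StrictCell.one_map_comp G p' γ').symm)
  have h₂ {a b : Obj} {p q : Path a b} (η : PreHom₂ Gen₂ p q) :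
      Cell.mk (F.map₂ (Presented.homMk (a := ⟨a⟩) (b := ⟨b⟩) η)) =
        .mk (G.map₂ (Presented.homMk (a := ⟨a⟩) (b := ⟨b⟩) η)) := by
    induction η with
    | of γ =>
      cases γ
      exacts [hη, Cell.inv_congr (η := F.map₂Iso unitIso) (η' := G.map₂Iso unitIso) hη, hε,
        Cell.inv_congr (η := F.map₂Iso counitIso) (η' := G.map₂Iso counitIso) hε]
    | @id a b p =>
      let p' : (⟨a⟩ : E.{u}) ⟶ ⟨b⟩ := p
      exact (StrictCell.map_one F p').trans ((h₁ p).trans (StrictCell.map_one G p').symm)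
    | vcomp η θ ih ih' =>
      refine (congrArg Cell.mk (F.map₂_comp (Presented.homMk η) (Presented.homMk θ))).trans
        (Eq.trans ?_ (congrArg Cell.mk (G.map₂_comp (Presented.homMk η) (Presented.homMk θ))).symm)
      exact Cell.comp_congr ih ih'
    | @whiskerLeft a b c p q r η ih =>
      let p' : (⟨a⟩ : E.{u}) ⟶ ⟨b⟩ := p
      refine (StrictCell.mk_map_whiskerLeft F p' (Presented.homMk (a := ⟨b⟩) (b := ⟨c⟩) η)).trans
        (Eq.trans ?_ (StrictCell.mk_map_whiskerLeft G p' (Presented.homMk η)).symm)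
      exact Cell.whiskerLeft_congr (h₁ p) ih
    | @whiskerRight a b c p q η r ih =>
      let r' : (⟨b⟩ : E.{u}) ⟶ ⟨c⟩ := r
      refine (StrictCell.mk_map_whiskerRight F (Presented.homMk (a := ⟨a⟩) (b := ⟨b⟩) η) r').trans
        (Eq.trans ?_ (StrictCell.mk_map_whiskerRight G (Presented.homMk η) r').symm)
      exact Cell.whiskerRight_congr ih (h₁ r)
  refine TwoCat.functor_ext_cell fun {a b p q} η => ?_
  obtain ⟨η⟩ := η
  exact h₂ η

end FreeAdjEquiv

/-! ### Lifting adjoint equivalences to strictifications -/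

namespace Strictification

open FreeAdjEquiv Quiver RightAdjointUnique

variable {C B : TwoCat.{u}} {J : C ⥤ᵖ B}

section

variable (e : StrictPseudofunctor E.{u} C) {g : J.obj (e.obj ⟨.y⟩) ⟶ J.obj (e.obj ⟨.x⟩)}
  (κ : g ≅ J.map (e.map right))

/-- The lifts of the generators `f` and `g` of `𝔼`. -/
def genMor : ∀ {a b : Obj.{u}}, Gen₁ a b →
    ((⟨e.obj ⟨a⟩⟩ : Strictification J) ⟶ ⟨e.obj ⟨b⟩⟩)
  | _, _, .f => can J (e.map left)
  | _, _, .g => ⟨e.map right, g, κ⟩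

/-- The lifts of the 1-morphisms of `𝔼`. -/
def pathMor {a : Obj.{u}} : ∀ {b : Obj.{u}}, Path a b →
    ((⟨e.obj ⟨a⟩⟩ : Strictification J) ⟶ ⟨e.obj ⟨b⟩⟩)
  | _, .nil => 𝟙 _
  | _, .cons p γ => pathMor p ≫ genMor e κ γ

theorem pathMor_comp {a b c : Obj.{u}} (p : Path a b) (q : Path b c) :
    pathMor e κ (p.comp q) = pathMor e κ p ≫ pathMor e κ q := by
  induction q with
  | nil => exact (Strict.comp_id _).symm
  | cons q γ ih => exact (congrArg (· ≫ genMor e κ γ) ih).trans (Strict.assoc _ _ _)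

theorem genMor_fst : ∀ {a b : Obj.{u}} (γ : Gen₁ a b),
    (genMor e κ γ).fst = e.map (X := ⟨a⟩) (Y := ⟨b⟩) (Hom.toPath (V := Obj) γ) := by
  rintro _ _ (_ | _) <;> rfl

theorem pathMor_fst {a b : Obj.{u}} (p : Path a b) :
    (pathMor e κ p).fst = e.map (X := ⟨a⟩) (Y := ⟨b⟩) p := by
  induction p with
  | nil => exact (e.map_id _).symm
  | @cons b c p γ ih =>
    have h : (pathMor e κ (p.cons γ)).fst = (pathMor e κ p).fst ≫ (genMor e κ γ).fst := rfl
    rw [h, ih, genMor_fst]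
    exact (e.map_comp (a := ⟨a⟩) (b := ⟨b⟩) (c := ⟨c⟩) p (Hom.toPath (V := Obj) γ)).symm

/-- A lift of an adjoint equivalence that is canonical on the left adjoint. -/
def adjEquivLift : StrictPseudofunctor E.{u} (Strictification J) :=
  lift e (fun {a b} p => pathMor e κ (a := a.as) (b := b.as) p) (fun p => pathMor_fst e κ p)
    (fun _ => rfl) (fun p q => pathMor_comp e κ p q)

theorem adjEquivLift_left :
    (adjEquivLift e κ).map left = can J (e.map left) :=
  Strict.id_comp (can J (e.map left))

theorem adjEquivLift_right :
    (adjEquivLift e κ).map right = ⟨e.map right, g, κ⟩ :=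
  Strict.id_comp (genMor e κ .g)

theorem mk_under_adjEquivLift {a b : E.{u}} {p q : a ⟶ b} (η : p ⟶ q) :
    Cell.mk (under ((adjEquivLift e κ).map₂ η)) = .mk (e.map₂ η) :=
  mk_under_liftMap₂ e (fun p => pathMor e κ p) (fun p => pathMor_fst e κ p) η

theorem adjEquivLift_proj₁ : StrictPseudofunctor.comp (adjEquivLift e κ) (proj₁ J) = e :=
  TwoCat.functor_ext_cell fun η => mk_under_adjEquivLift e κ η

end

/-- The projection to `B` of a unit. -/
theorem mk_proj₂_unit {a b : C} {f : a ⟶ b} {g : b ⟶ a} (adj : f ⊣ g)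
    {k : J.obj b ⟶ J.obj a} (κ : k ≅ J.map g) :
    Cell.mk ((proj₂ J).map₂ (homMk adj.unit :
      𝟙 (⟨a⟩ : Strictification J) ⟶ can J f ≫ (⟨g, k, κ⟩ : Mor J ⟨b⟩ ⟨a⟩))) =
      .mk ((J.mapAdjunction adj).unit ≫ J.map f ◁ κ.inv) := by
  have h : (proj₂ J).map₂ (homMk adj.unit :
      𝟙 (⟨a⟩ : Strictification J) ⟶ can J f ≫ (⟨g, k, κ⟩ : Mor J ⟨b⟩ ⟨a⟩)) =
      (J.mapId a).inv ≫ J.map₂ adj.unit ≫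
        ((J.mapComp f g).hom ≫ J.map f ◁ κ.inv) ≫ 𝟙 _ ▷ k := rfl
  rw [h, Pseudofunctor.mapAdjunction_unit, id_whiskerRight]
  simp only [Category.assoc, Category.comp_id]
  rfl

/-- The projection to `B` of a counit. -/
theorem mk_proj₂_counit {a b : C} {f : a ⟶ b} {g : b ⟶ a} (adj : f ⊣ g)
    {k : J.obj b ⟶ J.obj a} (κ : k ≅ J.map g) :
    Cell.mk ((proj₂ J).map₂ (homMk adj.counit :
      (⟨g, k, κ⟩ : Mor J ⟨b⟩ ⟨a⟩) ≫ can J f ⟶ 𝟙 (⟨b⟩ : Strictification J))) =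
      .mk (κ.hom ▷ J.map f ≫ (J.mapAdjunction adj).counit) := by
  have h : (proj₂ J).map₂ (homMk adj.counit :
      (⟨g, k, κ⟩ : Mor J ⟨b⟩ ⟨a⟩) ≫ can J f ⟶ 𝟙 (⟨b⟩ : Strictification J)) =
      (κ.hom ▷ J.map f ≫ J.map g ◁ 𝟙 _ ≫ (J.mapComp g f).inv) ≫ J.map₂ adj.counit ≫
        (J.mapId b).hom := rfl
  rw [h, Pseudofunctor.mapAdjunction_counit, whiskerLeft_id]
  simp only [Category.assoc, Category.id_comp]
  rfl

/-- The projections to `C` and to `B` are jointly conservative on identities of 1-morphisms. -/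
theorem eq_of_cell {a b : Strictification J} {m n : a ⟶ b} (θ : m ⟶ n)
    (h₁ : Cell.mk (under θ) = .one m.fst) (h₂ : Cell.mk ((proj₂ J).map₂ θ) = .one m.snd) :
    m = n := by
  obtain ⟨f, p, κ⟩ := m
  obtain ⟨g, q, κ'⟩ := n
  obtain rfl : f = g := Cell.one_inj (Cell.cod_eq h₁).symm
  obtain rfl : p = q := Cell.one_inj (Cell.cod_eq h₂).symm
  refine Mor.ext' rfl (congrArg Cell.mk ?_)
  have e₁ : under θ = 𝟙 f := Cell.mk_inj h₁
  have e₂ : κ.hom ≫ J.map₂ (under θ) ≫ κ'.inv = 𝟙 p := Cell.mk_inj h₂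
  rw [e₁, J.map₂_id, Category.id_comp, Iso.comp_inv_eq, Category.id_comp] at e₂
  exact e₂

/-- A lift of an adjoint equivalence is determined by its projections and by the lift of the left
adjoint, since right adjoints are unique up to a unique isomorphism. -/
theorem adjEquiv_ext {y y' : StrictPseudofunctor E.{u} (Strictification J)}
    (hl : Cell.one (y.map left) = .one (y'.map left))
    (h₁ : StrictPseudofunctor.comp y (proj₁ J) = StrictPseudofunctor.comp y' (proj₁ J))
    (h₂ : StrictPseudofunctor.comp y (proj₂ J) = StrictPseudofunctor.comp y' (proj₂ J)) :
    y = y' := by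
  have hc₁ {a b : E.{u}} {p q : a ⟶ b} (η : p ⟶ q) :
      Cell.mk ((proj₁ J).map₂ (y.map₂ η)) = .mk ((proj₁ J).map₂ (y'.map₂ η)) :=
    congrArg (fun z : StrictPseudofunctor E.{u} C => Cell.mk (z.map₂ η)) h₁
  have hc₂ {a b : E.{u}} {p q : a ⟶ b} (η : p ⟶ q) :
      Cell.mk ((proj₂ J).map₂ (y.map₂ η)) = .mk ((proj₂ J).map₂ (y'.map₂ η)) :=
    congrArg (fun z : StrictPseudofunctor E.{u} B => Cell.mk (z.map₂ η)) h₂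
  have hr : Cell.one (y.map right) = .one (y'.map right) := by
    obtain ⟨k, adj', hk, hη, -⟩ := exists_transport hl.symm (y'.mapAdjunction adj)
    rw [mk_mapAdjunction_unit] at hη
    rw [hk]
    refine Cell.one_congr (eq_of_cell (comparison (y.mapAdjunction adj) adj') ?_ ?_)
    · refine mk_map_comparison (proj₁ J) _ _ (Cell.one_inj ?_) ?_
      · exact (congrArg (fun z : StrictPseudofunctor E.{u} C => Cell.one (z.map right)) h₁).trans
          (StrictCell.map_one_congr (proj₁ J) hk)
      · exact (StrictCell.map_congr (proj₁ J) (mk_mapAdjunction_unit y adj)).trans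
          ((hc₁ _).trans (StrictCell.map_congr (proj₁ J) hη))
    · refine mk_map_comparison (proj₂ J) _ _ (Cell.one_inj ?_) ?_
      · exact (congrArg (fun z : StrictPseudofunctor E.{u} B => Cell.one (z.map right)) h₂).trans
          (StrictCell.map_one_congr (proj₂ J) hk)
      · exact (StrictCell.map_congr (proj₂ J) (mk_mapAdjunction_unit y adj)).trans
          ((hc₂ _).trans (StrictCell.map_congr (proj₂ J) hη))
  refine FreeAdjEquiv.ext hl hr ?_ ?_
  · exact cell_ext ((StrictCell.one_map_id y _).trans ((Cell.zero_congr (Cell.src_eq hl)).trans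
      (StrictCell.one_map_id y' _).symm)) ((StrictCell.one_map_comp y _ _).trans
      ((Cell.one_comp_congr hl hr).trans (StrictCell.one_map_comp y' _ _).symm)) (hc₁ _)
  · exact cell_ext ((StrictCell.one_map_comp y _ _).trans
      ((Cell.one_comp_congr hr hl).trans (StrictCell.one_map_comp y' _ _).symm))
      ((StrictCell.one_map_id y _).trans ((Cell.zero_congr (Cell.tgt_eq hl)).trans
      (StrictCell.one_map_id y' _).symm)) (hc₁ _)

/-- Adjoint equivalences `e` in `C` and `e'` in `B` have a common lift if `J` sends the left adjoint
of `e` to that of `e'`: the right adjoint of `e'` is isomorphic to the image of that of `e`,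
compatibly with units and counits. -/
theorem exists_adjEquiv (e : StrictPseudofunctor E.{u} C) (e' : StrictPseudofunctor E.{u} B)
    (h : Cell.one (e'.map left) = .one (J.map (e.map left))) :
    ∃ y : StrictPseudofunctor E.{u} (Strictification J),
      StrictPseudofunctor.comp y (proj₁ J) = e ∧ StrictPseudofunctor.comp y (proj₂ J) = e' ∧
        Cell.one (y.map left) = .one (can J (e.map left)) := by
  obtain ⟨g, adj₁, hg, hη, hε⟩ := exists_transport h (e'.mapAdjunction adj)
  rw [mk_mapAdjunction_unit] at hη
  rw [mk_mapAdjunction_counit] at hε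
  let adj₂ := J.mapAdjunction (e.mapAdjunction adj)
  let κ : g ≅ J.map (e.map right) := comparisonIso adj₁ adj₂
  have hl : Cell.one ((adjEquivLift e κ).map left) = .one (can J (e.map left)) :=
    Cell.one_congr (adjEquivLift_left e κ)
  have hr : Cell.one ((adjEquivLift e κ).map right) = .one _ :=
    Cell.one_congr (adjEquivLift_right e κ)
  refine ⟨adjEquivLift e κ, adjEquivLift_proj₁ e κ, FreeAdjEquiv.ext ?_ ?_ ?_ ?_, hl⟩
  · exact (StrictCell.map_one_congr (proj₂ J) hl).trans h.symm
  · exact (StrictCell.map_one_congr (proj₂ J) hr).trans hg.symm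
  · have e₁ : Cell.mk ((adjEquivLift e κ).map₂ unitIso.hom) =
        .mk (homMk (e.mapAdjunction adj).unit :
          𝟙 (⟨_⟩ : Strictification J) ⟶ can J _ ≫ (⟨e.map right, g, κ⟩ : Mor J ⟨_⟩ ⟨_⟩)) := by
      refine cell_ext (StrictCell.one_map_id _ _) ((StrictCell.one_map_comp _ _ _).trans
        (Cell.one_comp_congr hl hr)) ?_
      exact (mk_under_adjEquivLift e κ _).trans (mk_mapAdjunction_unit e adj).symm
    refine (StrictCell.map_congr (proj₂ J) e₁).trans ((mk_proj₂_unit _ κ).trans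
      (Eq.trans ?_ hη.symm))
    rw [← unit_comparison adj₂ adj₁]
    rfl
  · have e₁ : Cell.mk ((adjEquivLift e κ).map₂ counitIso.hom) =
        .mk (homMk (e.mapAdjunction adj).counit :
          (⟨e.map right, g, κ⟩ : Mor J ⟨_⟩ ⟨_⟩) ≫ can J _ ⟶ 𝟙 (⟨_⟩ : Strictification J)) := by
      refine cell_ext ((StrictCell.one_map_comp _ _ _).trans
        (Cell.one_comp_congr hr hl)) (StrictCell.one_map_id _ _) ?_
      exact (mk_under_adjEquivLift e κ _).trans (mk_mapAdjunction_counit e adj).symm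
    refine (StrictCell.map_congr (proj₂ J) e₁).trans ((mk_proj₂_counit _ κ).trans
      (Eq.trans ?_ hε.symm))
    rw [← comparison_counit adj₁ adj₂]
    rfl

end Strictification

namespace NaturalNerve

open Strictification MarkedSimplex FreeAdjEquiv Simplex

variable {C B : TwoCat.{u}} (u : naturalNerve.obj C ⟶ naturalNerve.obj B)

theorem one_act_left (e : freeAdjEquiv ⟶ C) :
    Cell.one ((act u (marked 0) e).map (left.{u} : objX ⟶ objY)) =
      .one (homAct u (e.map (left.{u} : objX ⟶ objY))) :=
  (congrArg (fun x : Simplex B 1 => Cell.one x.arrow) (act_adjEquiv u e)).trans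
    (one_edge_simplexAct u _ _)

theorem exists_lift_adjEquiv (e : freeAdjEquiv ⟶ C) :
    ∃ y : freeAdjEquiv ⟶ strictified u, y ≫ toBase u = e ∧
      y ≫ toTarget u = act u (marked 0) e ∧
        Cell.one (y.map (left.{u} : objX ⟶ objY)) =
          .one (can _ (e.map (left.{u} : objX ⟶ objY))) :=
  exists_adjEquiv (J := toPseudofunctor u) e (act u (marked 0) e) (one_act_left u e)

/-- The lift of an adjoint equivalence. -/
noncomputable def liftAdjEquiv (e : freeAdjEquiv ⟶ C) : freeAdjEquiv ⟶ strictified u :=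
  (exists_lift_adjEquiv u e).choose

theorem liftAdjEquiv_toBase (e : freeAdjEquiv ⟶ C) : liftAdjEquiv u e ≫ toBase u = e :=
  (exists_lift_adjEquiv u e).choose_spec.1

theorem liftAdjEquiv_toTarget (e : freeAdjEquiv ⟶ C) :
    liftAdjEquiv u e ≫ toTarget u = act u (marked 0) e :=
  (exists_lift_adjEquiv u e).choose_spec.2.1

theorem one_liftAdjEquiv (e : freeAdjEquiv ⟶ C) :
    Cell.one ((liftAdjEquiv u e).map (left.{u} : objX ⟶ objY)) =
      .one (can _ (e.map (left.{u} : objX ⟶ objY))) :=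
  (exists_lift_adjEquiv u e).choose_spec.2.2

theorem simplexLift_homF (e : freeAdjEquiv ⟶ C) :
    simplexLift u (P := Oriental.inclusion (ULift.{u} (Fin 2)))
        (pickHom freeAdjEquiv FreeAdjEquiv.homF ≫ e : oriental.obj ⟨1⟩ ⟶ C) =
      (pickHom freeAdjEquiv FreeAdjEquiv.homF ≫ liftAdjEquiv u e :
        oriental.obj ⟨1⟩ ⟶ strictified u) :=
  Simplex.ext₁ (C := strictified u) <| by
    refine (one_simplexLift u _ (i := ULift.up 0) (j := ULift.up 1) (by decide)).trans ?_
    exact (one_liftAdjEquiv u e).symm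

theorem liftAdjEquiv_toPoint (x : Simplex C 0) :
    liftAdjEquiv u (toPoint _ ≫ (x : oriental.obj ⟨0⟩ ⟶ C)) =
      toPoint _ ≫ (simplexLift u x : oriental.obj ⟨0⟩ ⟶ strictified u) := by
  refine adjEquiv_ext (J := toPseudofunctor u) ?_ ?_ ?_
  · refine (one_liftAdjEquiv u _).trans ?_
    have h := one_simplexLift u x (i := ULift.up 0) (j := ULift.up 0) le_rfl
    have e : (toPoint freeAdjEquiv.{u}).map (left.{u} : objX ⟶ objY) =
      Oriental.edge (P := Oriental.inclusion (ULift.{u} (Fin 1))) (i := ULift.up 0)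
        (j := ULift.up 0) le_rfl :=
      (Oriental.edge_self (P := Oriental.inclusion (ULift.{u} (Fin 1))) _).symm
    refine Eq.trans ?_ ((congrArg (fun S => Cell.one ((simplexLift u x).map S)) e).trans h).symm
    exact congrArg (fun S => Cell.one (can (toPseudofunctor u) (x.map S))) e
  · refine (liftAdjEquiv_toBase u _).trans (Eq.trans ?_ (Category.assoc _ _ (toBase u)).symm)
    exact congrArg (toPoint _ ≫ ·) (simplexLift_proj₁ u x).symm
  · refine (liftAdjEquiv_toTarget u _).trans (Eq.trans ?_ (Category.assoc _ _ (toTarget u)).symm)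
    refine (act_genMap u (.ζ (m := 0) 0) x).trans ?_
    exact congrArg (toPoint _ ≫ ·) (simplexLift_toTarget u x).symm

/-- The lift of a map between nerves. -/
noncomputable def nerveLift : naturalNerve.obj C ⟶ naturalNerve.obj (strictified u) :=
  ofSimplexAct (fun x => simplexLift u x) (liftAdjEquiv u) (invLift u)
    (fun φ x => simplexLift_pull u φ x) (simplexLift_homF u) (liftAdjEquiv_toPoint u)
    (simplexLift_inv u)

theorem nerveLift_toBase : nerveLift u ≫ naturalNerve.map (toBase u) = 𝟙 _ :=
  hom_ext (fun x => simplexLift_proj₁ u x) (liftAdjEquiv_toBase u)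

theorem nerveLift_toTarget : nerveLift u ≫ naturalNerve.map (toTarget u) = u :=
  hom_ext (fun x => simplexLift_toTarget u x) (liftAdjEquiv_toTarget u)

end NaturalNerve

/-! ### The counit -/

/-- The strict 2-functors that are surjective on objects, surjective on 1-morphisms with prescribed
endpoints, and bijective on 2-morphisms with prescribed boundary. -/
structure IsTrivial {A C : TwoCat.{u}} (F : A ⟶ C) : Prop where
  obj_surjective (c : C) : ∃ a : A, F.obj a = c
  map_surjective {a b : A} (f : F.obj a ⟶ F.obj b) : ∃ g : a ⟶ b, F.map g = f
  map₂_surjective {a b : A} {f g : a ⟶ b} (α : F.map f ⟶ F.map g) : ∃ θ : f ⟶ g, F.map₂ θ = α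
  map₂_injective {a b : A} {f g : a ⟶ b} {θ θ' : f ⟶ g} (h : F.map₂ θ = F.map₂ θ') : θ = θ'

namespace NaturalNerve

open Strictification MarkedSimplex Simplex

section

variable {C A : TwoCat.{u}} {u : naturalNerve.obj C ⟶ naturalNerve.obj A} {F : A ⟶ C}

theorem simplexAct_comp (hu : u ≫ naturalNerve.map F = 𝟙 _) {m : ℕ} (x : Simplex C m) :
    StrictPseudofunctor.comp (simplexAct u x) F = x :=
  congrArg (fun v => act v (simplex m) x) hu

theorem map_objAct (hu : u ≫ naturalNerve.map F = 𝟙 _) (a : C) : F.obj (objAct u a) = a :=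
  congrArg (fun x : Simplex C 0 => x.vertex 0) (simplexAct_comp hu (ofObj a))

theorem one_map_homAct (hu : u ≫ naturalNerve.map F = 𝟙 _) {a b : C} (f : a ⟶ b) :
    Cell.one (F.map (homAct u f)) = .one f :=
  (StrictCell.map_one_congr F (one_homAct u f)).trans
    (congrArg (fun x : Simplex C 1 => Cell.one x.arrow) (simplexAct_comp hu (ofHom f)))

theorem mk_map_toPseudofunctor (hu : u ≫ naturalNerve.map F = 𝟙 _) {a b : C} {f g : a ⟶ b}
    (η : f ⟶ g) :
    Cell.mk (F.map₂ ((toPseudofunctor u).map₂ η)) = .mk η := by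
  have h₁ : Cell.mk ((toPseudofunctor u).map₂ η) =
      .mk (simplexAct u (Simplex.triangle (η ≫ (λ_ g).inv))).filler :=
    ((triangleMap u).mk_map₂ η).trans (mk_triAct u _)
  let y : Simplex C 2 :=
    StrictPseudofunctor.comp (simplexAct u (Simplex.triangle (η ≫ (λ_ g).inv))) F
  have h₂ : Cell.mk y.filler = .mk (Simplex.triangle (η ≫ (λ_ g).inv)).filler :=
    congrArg (fun x : Simplex C 2 => Cell.mk x.filler) (simplexAct_comp hu _)
  refine (StrictCell.map_congr F (h₁.trans (mk_face _ _ _))).trans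
    ((y.mk_face _ _).symm.trans (h₂.trans (Eq.trans (mk_face_triangle _) ?_)))
  rw [Strict.leftUnitor_eqToIso, eqToIso.inv, Cell.mk_comp_eqToHom]

/-- The objects of `A` are determined by their images in `C`, because those of the strictified
2-category are the objects of `C`. -/
theorem objAct_map {s : A ⟶ strictified u} (h₁ : s ≫ toBase u = F) (h₂ : s ≫ toTarget u = 𝟙 A)
    (a : A) : objAct u (F.obj a) = a :=
  (congrArg (fun G : A ⟶ C => objAct u (G.obj a)) h₁).symm.trans
    (congrArg (fun G : A ⟶ A => G.obj a) h₂)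

/-- A 2-functor `F` from a 2-category `A` is trivial if it admits a section `u` on nerves such that
`A` is a retract of the strictifications of the pseudofunctor of `u`, compatibly with `F`. -/
theorem isTrivial_of_section (hu : u ≫ naturalNerve.map F = 𝟙 _) {s : A ⟶ strictified u}
    (h₁ : s ≫ toBase u = F) (h₂ : s ≫ toTarget u = 𝟙 A) : IsTrivial F := by
  refine ⟨fun c => ⟨_, map_objAct hu c⟩, fun {a b} f => ?_, fun {a b f g} α => ?_,
    fun {a b f g θ θ'} h => ?_⟩
  · obtain ⟨g, hg⟩ := Cell.exists_one (homAct u f) (objAct_map h₁ h₂ a) (objAct_map h₁ h₂ b)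
    exact ⟨g, Cell.one_inj ((StrictCell.map_one_congr F hg).trans (one_map_homAct hu f))⟩
  · let J := toPseudofunctor u
    have hsnd {f : a ⟶ b} : Cell.one (s.map f).snd = .one f :=
      congrArg (fun G : A ⟶ A => Cell.one (G.map f)) h₂
    -- `f` and `g` are isomorphic to the values `J p` and `J q` of 1-morphisms of `C`, through
    -- 2-morphisms `φ` and `ψ` that `F` need not preserve; so `α` is conjugated by their images
    let φ := (s.map f).iso
    let ψ := (s.map g).iso
    obtain ⟨α', hα⟩ := Cell.exists_hom (f := F.map (s.map f).snd) (g := F.map (s.map g).snd)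
      (.mk α) (StrictCell.map_one_congr F hsnd.symm) (StrictCell.map_one_congr F hsnd.symm)
    obtain ⟨x, hx⟩ := Cell.exists_hom (f := (s.map f).fst) (g := (s.map g).fst)
      (.mk (F.map₂ φ.inv ≫ α' ≫ F.map₂ ψ.hom)) (one_map_homAct hu _) (one_map_homAct hu _)
    obtain ⟨θ, hθ⟩ := Cell.exists_hom (f := f) (g := g) (.mk (φ.hom ≫ J.map₂ x ≫ ψ.inv)) hsnd hsnd
    refine ⟨θ, Cell.mk_inj (Eq.trans ?_ hα)⟩
    refine (StrictCell.map_congr F hθ).trans ?_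
    have e : F.map₂ (J.map₂ x) = F.map₂ φ.inv ≫ α' ≫ F.map₂ ψ.hom :=
      Cell.mk_inj ((mk_map_toPseudofunctor hu x).trans hx)
    rw [F.map₂_comp, F.map₂_comp, e]
    simp [← F.map₂_comp, ← F.map₂_comp_assoc]
  · -- the section `s` is faithful, and it only depends on the image in `C`
    have e (θ : f ⟶ g) : Cell.mk ((toBase u).map₂ (s.map₂ θ)) = .mk (F.map₂ θ) :=
      congrArg (fun G : A ⟶ C => Cell.mk (G.map₂ θ)) h₁
    have e' (θ : f ⟶ g) : Cell.mk ((toTarget u).map₂ (s.map₂ θ)) = .mk θ :=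
      congrArg (fun G : A ⟶ A => Cell.mk (G.map₂ θ)) h₂
    have e₁ : under (s.map₂ θ) = under (s.map₂ θ') :=
      Cell.mk_inj ((e θ).trans ((congrArg Cell.mk h).trans (e θ').symm))
    have e₂ : s.map₂ θ = s.map₂ θ' := e₁
    apply Cell.mk_inj
    rw [← e' θ, ← e' θ', e₂]

end

/-- The transpose of the lift of the unit is a section `s` of the projection from the strictified
2-category to `c (N C)`, and it lies over the counit. -/
theorem exists_section {c : (tDeltaᵒᵖ ⥤ Type u) ⥤ TwoCat.{u}} (adj : c ⊣ naturalNerve.{u})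
    (C : TwoCat.{u}) :
    ∃ (u : naturalNerve.obj C ⟶ naturalNerve.obj (c.obj (naturalNerve.obj C)))
      (s : c.obj (naturalNerve.obj C) ⟶ strictified u),
      u ≫ naturalNerve.map (adj.counit.app C) = 𝟙 _ ∧ s ≫ toBase u = adj.counit.app C ∧
        s ≫ toTarget u = 𝟙 _ := by
  let η := adj.unit.app (naturalNerve.obj C)
  let s : c.obj (naturalNerve.obj C) ⟶ strictified η := (adj.homEquiv _ _).symm (nerveLift η)
  have hs : η ≫ naturalNerve.map s = nerveLift η :=
    (adj.homEquiv_unit _ _ _).symm.trans (Equiv.apply_symm_apply _ _)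
  have hε : η ≫ naturalNerve.map (adj.counit.app C) = 𝟙 _ := adj.right_triangle_components C
  have ext {D : TwoCat.{u}} {F G : c.obj (naturalNerve.obj C) ⟶ D}
      (h : η ≫ naturalNerve.map F = η ≫ naturalNerve.map G) : F = G :=
    (adj.homEquiv _ _).injective
      ((adj.homEquiv_unit _ _ _).trans (h.trans (adj.homEquiv_unit _ _ _).symm))
  refine ⟨η, s, hε, ext ?_, ext ?_⟩
  · rw [hε, naturalNerve.map_comp, reassoc_of% hs]
    exact nerveLift_toBase η
  · rw [naturalNerve.map_comp, reassoc_of% hs]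
    refine (nerveLift_toTarget η).trans ?_
    exact ((congrArg (η ≫ ·) (naturalNerve.map_id _)).trans (Category.comp_id η)).symm

end NaturalNerve

/-! ### 2-functors on suspensions -/

namespace Suspension

variable {V : Type u} [Category.{u} V] {X : TwoCat.{u}}

section

variable {a b : X} (H : V ⥤ (a ⟶ b))

/-- The objects in the image of a functor on a suspension. -/
def descObj (a b : X) : Suspension V → X
  | .x => a
  | .y => b

/-- The action of `desc` on 1-morphisms. -/
def descMap : ∀ {c d : Suspension V}, (c ⟶ d) → (descObj a b c ⟶ descObj a b d)
  | _, _, .id _ => 𝟙 _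
  | _, _, .of v => H.obj v

/-- The action of `desc` on 2-morphisms. -/
def descMap₂ : ∀ {c d : Suspension V} {f g : c ⟶ d}, (f ⟶ g) → (descMap H f ⟶ descMap H g)
  | _, _, _, _, .id _ => 𝟙 _
  | _, _, _, _, .of η => H.map η

theorem descMap_comp {c d e : Suspension V} (f : c ⟶ d) (g : d ⟶ e) :
    descMap H (f ≫ g) = descMap H f ≫ descMap H g := by
  rcases f with _ | _ <;> rcases g with _ | _
  exacts [(Strict.id_comp _).symm, (Strict.id_comp _).symm, (Strict.comp_id _).symm]

/-- The 2-functor on `ΣV` determined by a functor from `V` to a hom-category. -/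
def desc : TwoCat.mk (Suspension V) ⟶ X :=
  StrictPseudofunctor.mk'' (B := Suspension V)
    { obj := descObj a b
      map := descMap H
      map₂ := descMap₂ H
      map₂_id f := by
        rcases f with _ | v
        exacts [rfl, H.map_id v]
      map₂_comp η θ := by
        rcases η with _ | η <;> rcases θ with _ | θ
        exacts [(Category.id_comp _).symm, H.map_comp η θ]
      map_id _ := rfl
      map_comp := descMap_comp H
      map₂_whisker_left f _ _ η := Cell.mk_inj <| by
        rw [Cell.mk_eqToHom_comp, Cell.mk_comp_eqToHom]
        rcases f with _ | v
        · exact (Cell.mk_id_whiskerLeft _).symm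
        · rcases η with _ | _
          refine (congrArg Cell.mk (H.map_id v)).trans
            (((Cell.one_comp_id (H.obj v)).symm).trans (congrArg Cell.mk ?_))
          exact (whiskerLeft_id _ _).symm
      map₂_whisker_right η f := Cell.mk_inj <| by
        rw [Cell.mk_eqToHom_comp, Cell.mk_comp_eqToHom]
        rcases η with c | η <;> rcases f with _ | v
        · exact (Cell.mk_whiskerRight_id _).symm
        · refine (congrArg Cell.mk (H.map_id v)).trans
            (((Cell.one_id_comp (H.obj v)).symm).trans (congrArg Cell.mk ?_))
          exact (id_whiskerRight _ _).symm
        · exact (Cell.mk_whiskerRight_id _).symm }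

end

/-- An object of `V`, as a 1-morphism of `ΣV`. -/
def arrow (v : V) : (.x : Suspension V) ⟶ .y := Mor.of v

/-- A morphism of `V`, as a 2-morphism of `ΣV`. -/
def cell {v w : V} (η : v ⟶ w) : arrow v ⟶ arrow w := Mor₂.of η

/-- A 2-functor on `ΣV` is determined by the two objects and the functor on hom-categories. -/
theorem ext {F G : TwoCat.mk (Suspension V) ⟶ X} 
    (hx : F.obj (.x : Suspension V) = G.obj (.x : Suspension V))
    (hy : F.obj (.y : Suspension V) = G.obj (.y : Suspension V))
    (h : ∀ {v w : V} (η : v ⟶ w),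
      Cell.mk (F.map₂ (cell η)) = .mk (G.map₂ (cell η))) : F = G := by
  have hobj (c : Suspension V) : F.obj c = G.obj c := by
    cases c
    exacts [hx, hy]
  refine TwoCat.functor_ext_cell (B := Suspension V) fun {_ _ _ _} η => ?_
  rcases η with _ | η
  · rename_i c
    have e (K : TwoCat.mk (Suspension V) ⟶ X) :
        Cell.mk (K.map₂ (𝟙 (𝟙 (c : Suspension V)))) = .zero (K.obj c) :=
      (StrictCell.map_one K _).trans (StrictCell.one_map_id K c)
    exact (e F).trans ((Cell.zero_congr (hobj c)).trans (e G).symm)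
  · exact h η

end Suspension

/-! ### Lifting properties -/

namespace IsTrivial

variable {A C : TwoCat.{u}} {F : A ⟶ C}

/-- Injectivity on 2-morphisms, for boundaries that are only propositionally equal. -/
theorem mk_injective (hF : IsTrivial F) {a b a' b' : A} {f g : a ⟶ b} {f' g' : a' ⟶ b'}
    {θ : f ⟶ g} {θ' : f' ⟶ g'} (h₁ : Cell.one f = .one f') (h₂ : Cell.one g = .one g')
    (h : Cell.mk (F.map₂ θ) = .mk (F.map₂ θ')) : Cell.mk θ = .mk θ' := by
  cases h₁
  cases h₂
  exact congrArg Cell.mk (hF.map₂_injective (Cell.mk_inj h))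

theorem biequivalences (hF : IsTrivial F) : biequivalences F := by
  refine ⟨fun c => ?_, fun a b => ?_⟩
  · obtain ⟨a, rfl⟩ := hF.obj_surjective c
    exact ⟨a, ⟨.id _⟩⟩
  · have : ((TwoCat.Hom.functor F).mapFunctor a b).Faithful := ⟨fun h => hF.map₂_injective h⟩
    have : ((TwoCat.Hom.functor F).mapFunctor a b).Full := ⟨fun α => hF.map₂_surjective α⟩
    have : ((TwoCat.Hom.functor F).mapFunctor a b).EssSurj := ⟨fun f => by
      obtain ⟨g, hg⟩ := hF.map_surjective f
      exact ⟨g, ⟨eqToIso hg⟩⟩⟩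
    exact { }

/-- Since 2-morphisms lift uniquely, a lift on the objects of `W` that agrees with the given one on
the objects of `V` extends uniquely to a functor on `W`, and to a lift on `ΣW`. -/
theorem hasLiftingProperty_suspend (hF : IsTrivial F) {V W : Type u} [Category.{u} V]
    [Category.{u} W] (i : V ⥤ W) (hi : Function.Injective i.obj) :
    HasLiftingProperty (suspend i) F where
  sq_hasLift {T S} sq := by
    have hsq {c d : Suspension V} {f g : c ⟶ d} (η : f ⟶ g) :
        Cell.mk (F.map₂ (T.map₂ η)) = .mk (S.map₂ ((Suspension.map i).map₂ η)) :=
      congrArg (fun G : TwoCat.mk (Suspension V) ⟶ C => Cell.mk (G.map₂ η)) sq.w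
    -- the square determines the lift on the image of `i`; other 1-morphisms are lifted by choice
    let a := T.obj (Suspension.x : Suspension V)
    let b := T.obj (Suspension.y : Suspension V)
    let Tm (v : V) : a ⟶ b := T.map (Suspension.arrow v)
    have hobj (c : Suspension V) : F.obj (T.obj c) = S.obj (Suspension.mapObj c : Suspension W) :=
      congrArg (fun G : TwoCat.mk (Suspension V) ⟶ C => G.obj c) sq.w
    have hx : F.obj a = S.obj (Suspension.x : Suspension W) := hobj .x
    have hy : F.obj b = S.obj (Suspension.y : Suspension W) := hobj .y
    have hm (w : W) : ∃ g : a ⟶ b, (∀ v, i.obj v = w → g = Tm v) ∧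
        Cell.one (F.map g) = .one (S.map (Suspension.arrow w)) := by
      by_cases h : ∃ v, i.obj v = w
      · obtain ⟨v, rfl⟩ := h
        refine ⟨Tm v, fun v' h' => by rw [hi h'], ?_⟩
        exact Cell.dom_eq (hsq (Suspension.cell (𝟙 v)))
      · obtain ⟨f, hf⟩ := Cell.exists_one (a' := F.obj a) (b' := F.obj b)
          (S.map (Suspension.arrow w)) hx.symm hy.symm
        obtain ⟨g, rfl⟩ := hF.map_surjective f
        exact ⟨g, fun v hv => absurd ⟨v, hv⟩ h, hf⟩
    choose m hmT hmS using hm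
    have hm₂ {w w' : W} (η : w ⟶ w') : ∃ θ : m w ⟶ m w', Cell.mk (F.map₂ θ) =
        .mk (S.map₂ (Suspension.cell η)) := by
      obtain ⟨α, hα⟩ := Cell.exists_hom (f := F.map (m w)) (g := F.map (m w'))
        (.mk (S.map₂ (Suspension.cell η)))
        (hmS w).symm (hmS w').symm
      obtain ⟨θ, rfl⟩ := hF.map₂_surjective α
      exact ⟨θ, hα⟩
    choose m₂ hm₂ using @hm₂
    let H : W ⥤ (a ⟶ b) :=
      { obj := m
        map η := m₂ η
        map_id w := hF.map₂_injective <| Cell.mk_inj <| by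
          refine (hm₂ _).trans (Eq.trans ?_ (StrictCell.map_one F _).symm)
          exact (StrictCell.map_one S (Suspension.arrow w)).trans (hmS w).symm
        map_comp η θ := hF.map₂_injective <| Cell.mk_inj <| by
          refine (hm₂ _).trans (Eq.trans ?_ (congrArg Cell.mk (F.map₂_comp _ _)).symm)
          refine (congrArg Cell.mk (S.map₂_comp (Suspension.cell η) (Suspension.cell θ))).trans ?_
          exact (Cell.comp_congr (hm₂ η) (hm₂ θ)).symm }
    refine ⟨⟨⟨Suspension.desc H, ?_, ?_⟩⟩⟩
    · refine Suspension.ext rfl rfl fun {v w} η => ?_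
      refine hF.mk_injective (Cell.one_congr (hmT _ v rfl)) (Cell.one_congr (hmT _ w rfl)) ?_
      exact (hm₂ _).trans (hsq (Suspension.cell η)).symm
    · refine Suspension.ext hx hy fun {v w} η => ?_
      exact hm₂ η

theorem hasLiftingProperty_fromEmpty (hF : IsTrivial F) :
    HasLiftingProperty (fromEmpty (oriental.{u}.obj ⟨0⟩)) F where
  sq_hasLift {T S} sq := by
    obtain ⟨a, ha⟩ := hF.obj_surjective (Simplex.vertex (S : Simplex C 0) 0)
    refine ⟨⟨⟨pickObj A a, ?_, Simplex.ext₀ ha⟩⟩⟩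
    exact TwoCat.functor_ext_cell (B := LocallyDiscrete (Discrete PEmpty.{u + 1}))
      fun {a} => a.as.as.elim

theorem rlp_lackGeneratingCofibrations (hF : IsTrivial F) : lackGeneratingCofibrations.rlp F := by
  rintro _ _ _ (_ | _ | _ | _)
  · exact hF.hasLiftingProperty_fromEmpty
  · exact hF.hasLiftingProperty_suspend _ fun v => v.as.elim
  · exact hF.hasLiftingProperty_suspend _ fun _ _ h => Discrete.ext h
  · refine hF.hasLiftingProperty_suspend _ ?_
    rintro (_ | _) (_ | _) h <;> first
      | rfl
      | exact absurd (congrArg ULift.down h) (by decide)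

end IsTrivial

namespace NaturalNerve

open MarkedSimplex

/-- An adjoint equivalence `S` in `C` lifts to `A` as its image under the section `u`. The source of
the lift is the prescribed one, since `u` is inverse to `F` on objects. -/
theorem hasLiftingProperty_adjEquiv {C A : TwoCat.{u}} {u : naturalNerve.obj C ⟶ naturalNerve.obj A}
    {F : A ⟶ C} (hu : u ≫ naturalNerve.map F = 𝟙 _) (hobj : ∀ a, objAct u (F.obj a) = a) :
    HasLiftingProperty (pickObj freeAdjEquiv.{u} FreeAdjEquiv.objX) F where
  sq_hasLift {T S} sq := by
    let T' : Simplex A 0 := T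
    refine ⟨⟨⟨act u (marked 0) S, Simplex.ext₀ ?_, congrArg (fun v => act v (marked 0) S) hu⟩⟩⟩
    have h₁ : F.obj (T'.vertex 0) = S.obj FreeAdjEquiv.objX :=
      congrArg (fun x : Simplex C 0 => x.vertex 0) sq.w
    refine Eq.trans ?_ (hobj (T'.vertex 0))
    rw [h₁]
    refine (congrArg (fun x : Simplex A 1 => x.vertex 0) (act_adjEquiv u S)).trans ?_
    exact vertex_simplexAct u _ 0

end NaturalNerve

theorem mainTheorem2 :
    naturalNerve.{u}.IsRightAdjoint ∧
      ∀ (c : (tDeltaᵒᵖ ⥤ Type u) ⥤ TwoCat.{u}) (adj : c ⊣ naturalNerve.{u}) (C : TwoCat.{u}),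
        lackAcyclicFibrations (adj.counit.app C) ∧
        lackGeneratingCofibrations.rlp (adj.counit.app C) ∧
        biequivalences (adj.counit.app C) := by
  refine ⟨TwoCat.nerve_isRightAdjoint NaturalNerve.coNatural, fun c adj C => ?_⟩
  obtain ⟨u, s, hu, h₁, h₂⟩ := NaturalNerve.exists_section adj C
  have h := NaturalNerve.isTrivial_of_section hu h₁ h₂
  refine ⟨⟨?_, h.biequivalences⟩, h.rlp_lackGeneratingCofibrations, h.biequivalences⟩
  rintro _ _ _ (_ | _)
  · exact NaturalNerve.hasLiftingProperty_adjEquiv hu (NaturalNerve.objAct_map h₁ h₂)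
  · exact h.hasLiftingProperty_suspend _ fun _ _ _ => Subsingleton.elim _ _
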